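/- Let $0<u_-<u_+<1$, put $s(p)=p\log p+(1-p)\log(1-p)$ for $p\in[0,1]$ (with $0\log 0=0$), $\phi_\pm=s'(u_\pm)=\log\frac{u_\pm}{1-u_\pm}$ and $g(u,\phi,p)=s(u)+s(p)+(1-u)\phi-\log(1+e^\phi)$. Read all the signs below consistently as upper or as lower signs, with $\mathbb R_+=[0,\infty)$ and $\mathbb R_-=(-\infty,0]$, and assume $u_-+u_+>1$ (upper signs), respectively $u_-+u_+<1$ (lower signs). Let $\mathcal C^\pm$ be the set of absolutely continuous $\phi:\mathbb R_\pm\to\mathbb R$ with $0\le\phi'\le1$ a.e., $\phi(0)=\phi_\mp$ and $\lim_{x\to\pm\infty}\phi(x)=\phi_\pm$, with the topology of uniform convergence, and let $\mathcal X^\pm=L^\infty(\mathbb R_\pm;[0,1])\times\mathcal C^\pm$, where the first factor carries the weak* topology. Let $\mathcal D^\pm$ be the set of $(u,\phi)\in\mathcal X^\pm$ with $\|u-u_\pm\|_{L^2(\mathbb R_\pm)}+\|\phi-\phi_\pm\|_{L^1(\mathbb R_\pm)}<\infty$, and let $\mathcal G^\pm(u,\phi)=\int_{\mathbb R_\pm}[g(u,\phi,\phi')-g(u_\pm,\phi_\pm,0)]\,dx$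 on $\mathcal D^\pm$ and $\mathcal G^\pm=+\infty$ on $\mathcal X^\pm\setminus\mathcal D^\pm$. For $\ell>0$ let $\mathcal G^\pm_\ell(u,\phi)=\int_{\pm(0,\ell)}[g(u,\phi,\phi')-g(u_\pm,\phi_\pm,0)]\,dx$ if $u=u_\pm$ and $\phi=\phi_\pm$ on $\pm[\ell,\infty)$, and $\mathcal G^\pm_\ell(u,\phi)=+\infty$ otherwise. Let $\bar u^\pm(x)=\frac12+A^\pm\tanh[A^\pm(x-x^\pm)]$, where $A^\pm=|u_\pm-\frac12|$ and $x^\pm$ is such that $\bar u^\pm(0)=u_\mp$ (the stationary solution of the viscous Burgers equation on $\mathbb R_\pm$ with $u(0)=u_\mp$ and $u(\pm\infty)=u_\pm$), and let $\bar\phi^\pm=s'(\bar u^\pm)$. (i) The integrand $g(u,\phi,\phi')-g(u_\pm,\phi_\pm,0)$ is integrable on $\mathbb R_\pm$ for every $(u,\phi)\in\mathcal D^\pm$, and there is a constant $C\in(1,\infty)$ such that for all $(u,\phi)\in\mathcal D^\pm$ $$\frac1C\big(\|u-u_\pm\|_{L^2(\mathbb R_\pm)}^2+\|\phi-\phi_\pm\|_{L^1(\mathbb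 R_\pm)}\big)-C\le\mathcal G^\pm(u,\phi)\le C\big(\|u-u_\pm\|_{L^2(\mathbb R_\pm)}^2+\|\phi-\phi_\pm\|_{L^1(\mathbb R_\pm)}\big)+C .$$ Moreover $\mathcal G^\pm$ is lower semicontinuous and coercive (its sublevel sets are precompact) on $\mathcal X^\pm$, the pair $(\bar u^\pm,\bar\phi^\pm)$ belongs to $\mathcal X^\pm$, and it is the unique minimizer of $\mathcal G^\pm$. (ii) The family $\{\mathcal G^\pm_\ell\}_{\ell>0}$ is equi-coercive (for all $\ell_n>0$, every sequence $(p_n)$ in $\mathcal X^\pm$ with $\limsup_n\mathcal G^\pm_{\ell_n}(p_n)<\infty$ is precompact) and $\Gamma$-converges to $\mathcal G^\pm$ as $\ell\to\infty$ (that is, along every sequence $\ell_n\to\infty$ of positive numbers). For $\ell>\phi_+-\phi_-$ the functional $\mathcal G^\pm_\ell$ has a unique minimizer. It is the pair $(\bar u^\pm_\ell,\bar\phi^\pm_\ell)$, where on $\pm(0,\ell)$ the function $\bar u^\pm_\ell$ is the unique solution of $u''-[u(1-u)]'=0$ with $u(0)=u_\mp$, $u(\pm\ell)=u_\pm$, and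 $\bar\phi^\pm_\ell=s'(\bar u^\pm_\ell)$, both extended by the constants $u_\pm$ and $\phi_\pm$ to $\pm[\ell,\infty)$. Finally, $(\bar u^\pm_\ell,\bar\phi^\pm_\ell)\to(\bar u^\pm,\bar\phi^\pm)$ in $\mathcal X^\pm$ as $\ell\to\infty$. -/

import Mathlib

open MeasureTheory Filter Topology Set

namespace BurgersHalfLine

noncomputable section

/-- The sign `±`: `pos` is the half-line `[0, ∞)` (used when `u₋ + u₊ > 1`), `neg` is `(-∞, 0]`
(used when `u₋ + u₊ < 1`). -/
inductive Side
  | pos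
  | neg

namespace Side

/-- The closed half-line. -/
def halfLine : Side → Set ℝ
  | pos => Ici 0
  | neg => Iic 0

/-- The condition `u₋ + u₊ ≷ 1`. -/
def Unbalanced (um up : ℝ) : Side → Prop
  | pos => 1 < um + up
  | neg => um + up < 1

/-- The boundary datum imposed at the origin: `u₋` on `[0, ∞)`, `u₊` on `(-∞, 0]`. -/
def near (um up : ℝ) : Side → ℝ
  | pos => um
  | neg => up

/-- The boundary datum imposed at infinity: `u₊` on `[0, ∞)`, `u₋` on `(-∞, 0]`. -/
def far (um up : ℝ) : Side → ℝ
  | pos => up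
  | neg => um

/-- `x → ±∞`. -/
def infinity : Side → Filter ℝ
  | pos => atTop
  | neg => atBot

/-- The bounded open interval `±(0, ℓ)`. -/
def interval (ℓ : ℝ) : Side → Set ℝ
  | pos => Ioo 0 ℓ
  | neg => Ioo (-ℓ) 0

/-- The endpoint `±ℓ`. -/
def endpoint (ℓ : ℝ) : Side → ℝ
  | pos => ℓ
  | neg => -ℓ

/-- The unbounded interval `±[ℓ, ∞)`. -/
def outer (ℓ : ℝ) : Side → Set ℝ
  | pos => Ici ℓ
  | neg => Iic (-ℓ)

/-- The nearest-point projection of the real line onto the half-line. -/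
def proj : (σ : Side) → ℝ → σ.halfLine
  | pos => fun x => ⟨max 0 x, le_max_left 0 x⟩
  | neg => fun x => ⟨min 0 x, min_le_left 0 x⟩

/-- Lebesgue measure on the half-line. -/
def μ (σ : Side) : Measure ℝ := volume.restrict σ.halfLine

end Side

/-- A function on the half-line, extended to the real line by its value at the origin. -/
def extHalf (σ : Side) (φ : σ.halfLine → ℝ) : ℝ → ℝ := fun x => φ (σ.proj x)

/-- The entropy `s(p) = p log p + (1 - p) log (1 - p)` (with `0 log 0 = 0`). -/
def ent (p : ℝ) : ℝ := p * Real.log p + (1 - p) * Real.log (1 - p)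

/-- The chemical potential `s'(p) = log (p / (1 - p))`. -/
def pot (p : ℝ) : ℝ := Real.log (p / (1 - p))

/-- The energy density `g(u, φ, p)`. -/
def dens (u φ p : ℝ) : ℝ := ent u + ent p + (1 - u) * φ - Real.log (1 + Real.exp φ)

/-- The space `L^∞(ℝ±; [0,1])`. -/
def UnitLinfty (σ : Side) : Type :=
  {u : Lp ℝ ⊤ σ.μ // ∀ᵐ x ∂σ.μ, u x ∈ Icc (0 : ℝ) 1}

/-- The weak-* topology: the coarsest one that makes `u ↦ ∫ u f` continuous for all `f ∈ L¹`. -/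
instance (σ : Side) : TopologicalSpace (UnitLinfty σ) :=
  TopologicalSpace.induced
    (fun (u : UnitLinfty σ) (f : Lp ℝ 1 σ.μ) => ∫ x, u.1 x * f x ∂σ.μ) inferInstance

/-- The conditions defining the set `𝒞±` of admissible `φ`. -/
structure IsProfile (σ : Side) (um up : ℝ) (φ : σ.halfLine → ℝ) : Prop where
  absolutelyContinuous :
    ∀ a ∈ σ.halfLine, ∀ b ∈ σ.halfLine, AbsolutelyContinuousOnInterval (extHalf σ φ) a b
  deriv_mem : ∀ᵐ x ∂σ.μ, deriv (extHalf σ φ) x ∈ Icc (0 : ℝ) 1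
  zero : extHalf σ φ 0 = pot (σ.near um up)
  tendsto : Tendsto (extHalf σ φ) σ.infinity (𝓝 (pot (σ.far um up)))

/-- The space `𝒞±` with the topology of uniform convergence: a subspace of the space of bounded
continuous functions on the half-line. -/
abbrev Profile (σ : Side) (um up : ℝ) : Type :=
  {φ : BoundedContinuousFunction σ.halfLine ℝ // IsProfile σ um up φ}

/-- The space `𝒳± = L^∞(ℝ±; [0,1]) × 𝒞±` with the product topology. -/
abbrev Phase (σ : Side) (um up : ℝ) : Type := UnitLinfty σ × Profile σ um up

section Functionals

variable (σ : Side) (um up : ℝ)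

/-- The function `u` of a pair `(u, φ)`. -/
def uOf (p : Phase σ um up) : ℝ → ℝ := fun x => p.1.1 x

/-- The function `φ` of a pair `(u, φ)`. -/
def phiOf (p : Phase σ um up) : ℝ → ℝ := extHalf σ p.2.1

/-- The integrand `g(u, φ, φ') - g(u±, φ±, 0)`. -/
def excess (p : Phase σ um up) (x : ℝ) : ℝ :=
  dens (uOf σ um up p x) (phiOf σ um up p x) (deriv (phiOf σ um up p) x)
    - dens (σ.far um up) (pot (σ.far um up)) 0

/-- `‖u - u±‖` in `L²(ℝ±)`, possibly infinite. -/
def normU (p : Phase σ um up) : ENNReal :=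
  eLpNorm (fun x => uOf σ um up p x - σ.far um up) 2 σ.μ

/-- `‖φ - φ±‖` in `L¹(ℝ±)`, possibly infinite. -/
def normPhi (p : Phase σ um up) : ENNReal :=
  eLpNorm (fun x => phiOf σ um up p x - pot (σ.far um up)) 1 σ.μ

/-- The set `𝒟±`. -/
def domD : Set (Phase σ um up) := {p | normU σ um up p + normPhi σ um up p < ⊤}

open Classical in
/-- The limiting functional `𝒢±`. -/
def energy (p : Phase σ um up) : EReal :=
  if p ∈ domD σ um up then ((∫ x, excess σ um up p x ∂σ.μ : ℝ) : EReal) else ⊤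

/-- The set `B±_ℓ`. -/
def setB (ℓ : ℝ) : Set (Phase σ um up) :=
  {p | (∀ x ∈ σ.outer ℓ, phiOf σ um up p x = pot (σ.far um up)) ∧
    ∀ᵐ x ∂(volume.restrict (σ.outer ℓ)), uOf σ um up p x = σ.far um up}

open Classical in
/-- The functional `𝒢±_ℓ`. -/
def energyL (ℓ : ℝ) (p : Phase σ um up) : EReal :=
  if p ∈ setB σ um up ℓ then ((∫ x in σ.interval ℓ, excess σ um up p x : ℝ) : EReal) else ⊤

/-- `A± = |u± - 1/2|`. -/
def ampl : ℝ := |σ.far um up - 1 / 2|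

/-- The centre `x±`, for which the function `uBar` below has the value `u∓` at the origin. -/
def centre : ℝ := -(Real.artanh ((σ.near um up - 1 / 2) / ampl σ um up) / ampl σ um up)

/-- The stationary solution `ū±` on the half-line. -/
def uBar (x : ℝ) : ℝ :=
  1 / 2 + ampl σ um up * Real.tanh (ampl σ um up * (x - centre σ um up))

/-- `p` is the pair `(ū±, φ̄±)`, with `φ̄± = s'(ū±)`. -/
def IsStationaryPair (p : Phase σ um up) : Prop :=
  uOf σ um up p =ᵐ[σ.μ] uBar σ um up ∧
    ∀ x ∈ σ.halfLine, phiOf σ um up p x = pot (uBar σ um up x)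

/-- `v` solves `v'' - (v (1 - v))' = 0` in `±(0, ℓ)` with `v(0) = u∓` and `v(±ℓ) = u±`. -/
structure SolvesBVP (ℓ : ℝ) (v : ℝ → ℝ) : Prop where
  continuousOn : ContinuousOn v (closure (σ.interval ℓ))
  differentiable : ∀ x ∈ σ.interval ℓ, DifferentiableAt ℝ v x
  equation : ∀ x ∈ σ.interval ℓ, HasDerivAt (deriv v) (deriv (fun y => v y * (1 - v y)) x) x
  zero : v 0 = σ.near um up
  endpoint : v (σ.endpoint ℓ) = σ.far um up

/-- `p` is the pair `(ū±_ℓ, φ̄±_ℓ)`: the stationary solution in `±(0, ℓ)` and its chemical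
potential, extended by the constants `u±` and `φ±` to the rest of the half-line. -/
def IsStationaryPairL (ℓ : ℝ) (p : Phase σ um up) : Prop :=
  p ∈ setB σ um up ℓ ∧ ∃ v : ℝ → ℝ, SolvesBVP σ um up ℓ v ∧
    uOf σ um up p =ᵐ[volume.restrict (σ.interval ℓ)] v ∧
    ∀ x ∈ σ.interval ℓ, phiOf σ um up p x = pot (v x)

end Functionals

section Variational

variable {X : Type*}

/-- `p` is the unique minimizer of `F`. -/
def IsUniqueMinimizer (F : X → EReal) (p : X) : Prop :=
  (∀ q, F p ≤ F q) ∧ ∀ q, (∀ r, F q ≤ F r) → q = p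

variable [TopologicalSpace X]

/-- Coercivity: the sublevel sets are precompact. -/
def Coercive (F : X → EReal) : Prop := ∀ t : ℝ, IsCompact (closure {x | F x ≤ t})

/-- Equi-coercivity of a sequence of functionals. -/
def EquiCoercive (F : ℕ → X → EReal) : Prop :=
  ∀ x : ℕ → X, limsup (fun n => F n (x n)) atTop < ⊤ → IsCompact (closure (range x))

/-- `Γ`-convergence of a sequence of functionals. -/
def GammaConverges (F : ℕ → X → EReal) (F₀ : X → EReal) : Prop :=
  ∀ x : X,
    (∀ y : ℕ → X, Tendsto y atTop (𝓝 x) → F₀ x ≤ liminf (fun n => F n (y n)) atTop) ∧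
    ∃ y : ℕ → X, Tendsto y atTop (𝓝 x) ∧ limsup (fun n => F n (y n)) atTop ≤ F₀ x

end Variational

end

end BurgersHalfLine

open BurgersHalfLine

/-!
The reflection `x ↦ -x`, `u ↦ 1 - u`, `φ ↦ -φ` carries the half-line `(-∞, 0]` to `[0, ∞)` and the
condition `u₋ + u₊ < 1` to `u₋ + u₊ > 1`, so both signs are instances of one structure
(`HalfLineModel`, `halfLineModel`): pairs `(u, φ)` on `[0, ∞)` with `φ 0 = pot a`, `φ → pot b`,
`a < b`, `a + b > 1`, with weak-* convergence of `u` and uniform convergence of `φ`.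

*Decomposition of the energy.* The density splits as
`g (u, φ, p) = relEnt (u, φ) + redDens φ + s p`, where `relEnt (u, φ) ≥ 0` is the relative entropy
of Bernoulli laws with parameters `u` and `sigmoid φ`, and
`redDens φ = log (sigmoid φ * (1 - sigmoid φ))` is concave and even. Since `-pot b < pot a`,
`redDens φ - redDens (pot b)` dominates a multiple of the gap `pot b - φ` on `[pot a, pot b]`, and
the relative entropy is comparable with `(u - sigmoid φ) ^ 2`. The only negative term is the entropy
`s (φ')`. By Young's inequality, `s p` is at least a linear function of `p` minus the exponential of
its slope. With a weight that decreases linearly in `x`, the linear part integrates by parts into a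
small multiple of the gap and the exponential is integrable. This gives the two-sided bounds, the
integrability of the density on `𝒟`, and smallness of the negative part of the energy on tails.

*Compactness and semicontinuity.* A bound on the energy bounds the integral of the gap, and hence
gives a uniform rate `pot b - φ x ≤ M / x` for the monotone function `φ`. Together with
`0 ≤ φ' ≤ 1` this yields uniform limits along ultrafilters. Weak-* limits of densities are obtained
from limits of their primitives, which are monotone and 1-Lipschitz as well. Lower semicontinuity
follows from the convexity of `relEnt` in `u` and of `s` in `φ'` on bounded intervals, together with
the tail estimate. Since the functional on `(0, ℓ)` is the restriction of the limiting one to pairs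
that are constant beyond `ℓ`, equi-coercivity and the lower bound of the `Γ`-convergence are
consequences, and the recovery sequence joins `φ` to `pot b` before `ℓ`.

*Minimizers.* The stationary densities solve `v' = v (1 - v) - J` with a constant flux `J`, so
their potentials solve the autonomous equation `φ' = speed J φ`. Young's inequality with the slope
`pot (speed J φ)`, a function of `φ` only, is a calibration: the energy of any pair equals a boundary
term that depends on the end values of `φ` only, plus the nonnegative integral of `defect`, and the
defect vanishes exactly when `u = sigmoid φ` and `φ' = speed J φ`. On `(0, ℓ)` the flux is the one
for which the solution starting at `a` reaches `b` at `ℓ`; it exists by shooting in the amplitude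
`A = √(1 / 4 - J)`. On the half-line `J = b (1 - b)`, the speed vanishes at `pot b`, and the
comparison is made up to the levels `φ < pot b`, with the tail estimate for the remainder. Uniqueness
for the boundary value problem and for the minimizers is uniqueness for the Riccati equation.
Convergence of the minimizers then follows from coercivity, lower semicontinuity and the recovery
sequence.
-/

namespace BurgersHalfLine

noncomputable section

/-! ### Scalar identities and inequalities for the energy density -/

/-- The relative entropy of the Bernoulli law with mean `u` with respect to the Bernoulli law with
mean `sigmoid y`. As a function of `u` it is the gap in the Legendre inequality between `ent` and
its tangent of slope `y`. -/
def relEnt (u y : ℝ) : ℝ := ent u - u * y + Real.log (1 + Real.exp y)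

/-- The part of the energy density that is left after minimizing over `u`, as a function of `φ`. -/
def redDens (y : ℝ) : ℝ := y - 2 * Real.log (1 + Real.exp y)

lemma dens_eq (u y p : ℝ) : dens u y p = relEnt u y + redDens y + ent p := by
  unfold dens relEnt redDens; ring

lemma one_add_exp_pos (y : ℝ) : 0 < 1 + Real.exp y := by positivity

lemma sigmoid_eq (y : ℝ) : Real.sigmoid y = Real.exp y / (1 + Real.exp y) := by
  rw [Real.sigmoid_def, Real.exp_neg]
  have := Real.exp_pos y
  field_simp
  ring

lemma log_sigmoid (y : ℝ) : Real.log (Real.sigmoid y) = y - Real.log (1 + Real.exp y) := by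
  rw [sigmoid_eq, Real.log_div (Real.exp_pos y).ne' (one_add_exp_pos y).ne', Real.log_exp]

lemma one_sub_sigmoid (y : ℝ) : 1 - Real.sigmoid y = 1 / (1 + Real.exp y) := by
  rw [sigmoid_eq]
  have := one_add_exp_pos y
  field_simp
  ring

lemma log_one_sub_sigmoid (y : ℝ) :
    Real.log (1 - Real.sigmoid y) = -Real.log (1 + Real.exp y) := by
  rw [one_sub_sigmoid, one_div, Real.log_inv]

lemma one_sub_sigmoid_pos (y : ℝ) : 0 < 1 - Real.sigmoid y := by
  linarith [Real.sigmoid_lt_one y]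

lemma sigmoid_pot {u : ℝ} (h0 : 0 < u) (h1 : u < 1) : Real.sigmoid (pot u) = u := by
  have h : 0 < 1 - u := by linarith
  rw [sigmoid_eq, pot, Real.exp_log (by positivity)]
  field_simp
  ring

lemma pot_lt_pot {u v : ℝ} (h0 : 0 < u) (huv : u < v) (h1 : v < 1) : pot u < pot v := by
  rw [← Real.sigmoid_lt_iff, sigmoid_pot h0 (huv.trans h1), sigmoid_pot (h0.trans huv) h1]
  exact huv

lemma pot_one_sub (u : ℝ) : pot (1 - u) = -pot u := by
  unfold pot
  rw [← Real.log_inv, inv_div, sub_sub_cancel]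

lemma exp_redDens (y : ℝ) :
    Real.exp (redDens y) = Real.sigmoid y * (1 - Real.sigmoid y) := by
  have h : redDens y = Real.log (Real.sigmoid y) + Real.log (1 - Real.sigmoid y) := by
    rw [log_sigmoid, log_one_sub_sigmoid, redDens]; ring
  rw [h, Real.exp_add, Real.exp_log (Real.sigmoid_pos y), Real.exp_log (one_sub_sigmoid_pos y)]

lemma relEnt_eq (u y : ℝ) : relEnt u y =
    u * (Real.log u - Real.log (Real.sigmoid y)) +
      (1 - u) * (Real.log (1 - u) - Real.log (1 - Real.sigmoid y)) := by
  rw [log_sigmoid, log_one_sub_sigmoid, relEnt, ent]; ring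

lemma two_mul_sub_le_mul_log {u q : ℝ} (hu : 0 ≤ u) (hq : 0 < q) :
    2 * u - 2 * (√u * √q) ≤ u * (Real.log u - Real.log q) := by
  rcases hu.eq_or_lt with rfl | hu
  · simp
  have hsu := Real.sqrt_pos.2 hu
  have hsq := Real.sqrt_pos.2 hq
  have h := Real.log_le_sub_one_of_pos (div_pos hsq hsu)
  rw [Real.log_div hsq.ne' hsu.ne', Real.log_sqrt hq.le, Real.log_sqrt hu.le] at h
  have h2 := mul_le_mul_of_nonneg_left h hu.le
  have h3 : u * (√q / √u - 1) = √u * √q - u := by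
    have := Real.mul_self_sqrt hu.le
    field_simp
    linear_combination -√q * this
  rw [h3] at h2
  linarith

lemma mul_log_le {u q : ℝ} (hu : 0 ≤ u) (hq : 0 < q) :
    u * (Real.log u - Real.log q) ≤ u * (u / q - 1) := by
  rcases hu.eq_or_lt with rfl | hu
  · simp
  rw [← Real.log_div hu.ne' hq.ne']
  exact mul_le_mul_of_nonneg_left (Real.log_le_sub_one_of_pos (div_pos hu hq)) hu.le

/-- A Pinsker-type bound, obtained by comparison with the Hellinger distance. -/
lemma sq_le_relEnt {u : ℝ} (hu : u ∈ Icc (0 : ℝ) 1) (y : ℝ) :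
    (u - Real.sigmoid y) ^ 2 / 2 ≤ relEnt u y := by
  set q := Real.sigmoid y with hq
  have hq0 : 0 < q := Real.sigmoid_pos y
  have hq1 : 0 < 1 - q := one_sub_sigmoid_pos y
  have h1u : 0 ≤ 1 - u := by linarith [hu.2]
  have e1 := two_mul_sub_le_mul_log hu.1 hq0
  have e2 := two_mul_sub_le_mul_log h1u hq1
  rw [relEnt_eq, ← hq]
  refine le_trans ?_ (add_le_add e1 e2)
  have r1 := Real.sq_sqrt hu.1
  have r2 := Real.sq_sqrt hq0.le
  have r3 := Real.sq_sqrt h1u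
  have r4 := Real.sq_sqrt hq1.le
  have k1 : √u ≤ 1 := Real.sqrt_le_one.2 hu.2
  have k2 : √q ≤ 1 := Real.sqrt_le_one.2 (by linarith)
  have k3 : √(1 - u) ≤ 1 := Real.sqrt_le_one.2 (by linarith [hu.1])
  have k4 : √(1 - q) ≤ 1 := Real.sqrt_le_one.2 (by linarith)
  have g1 := Real.sqrt_nonneg u
  have g2 := Real.sqrt_nonneg q
  have g3 := Real.sqrt_nonneg (1 - u)
  have g4 := Real.sqrt_nonneg (1 - q)
  have m1 : (u - q) ^ 2 ≤ 4 * (√u - √q) ^ 2 := by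
    have : (u - q) ^ 2 = (√u - √q) ^ 2 * (√u + √q) ^ 2 := by
      rw [← mul_pow, ← r1, ← r2]; ring_nf; simp [r1, r2]
    rw [this, mul_comm]
    refine mul_le_mul_of_nonneg_right ?_ (sq_nonneg _)
    nlinarith
  have m2 : (u - q) ^ 2 ≤ 4 * (√(1 - u) - √(1 - q)) ^ 2 := by
    have : (u - q) ^ 2 = (√(1 - u) - √(1 - q)) ^ 2 * (√(1 - u) + √(1 - q)) ^ 2 := by
      have : (u - q) ^ 2 = ((1 - u) - (1 - q)) ^ 2 := by ring
      rw [← mul_pow, this, ← r3, ← r4]; ring_nf; simp [r3, r4]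
    rw [this, mul_comm]
    refine mul_le_mul_of_nonneg_right ?_ (sq_nonneg _)
    nlinarith
  nlinarith

lemma relEnt_nonneg {u : ℝ} (hu : u ∈ Icc (0 : ℝ) 1) (y : ℝ) : 0 ≤ relEnt u y :=
  le_trans (by positivity) (sq_le_relEnt hu y)

/-- The relative entropy is at most the chi-square divergence. -/
lemma relEnt_le {u : ℝ} (hu : u ∈ Icc (0 : ℝ) 1) (y : ℝ) :
    relEnt u y ≤ (u - Real.sigmoid y) ^ 2 / (Real.sigmoid y * (1 - Real.sigmoid y)) := by
  have hq0 : 0 < Real.sigmoid y := Real.sigmoid_pos y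
  have hq1 : 0 < 1 - Real.sigmoid y := one_sub_sigmoid_pos y
  rw [relEnt_eq]
  refine (add_le_add (mul_log_le hu.1 hq0) (mul_log_le (by linarith [hu.2]) hq1)).trans (le_of_eq ?_)
  field_simp
  ring

lemma relEnt_sigmoid (y : ℝ) : relEnt (Real.sigmoid y) y = 0 := by
  rw [relEnt_eq]; ring

lemma eq_sigmoid_of_relEnt_le {u y : ℝ} (hu : u ∈ Icc (0 : ℝ) 1) (h : relEnt u y ≤ 0) :
    u = Real.sigmoid y := by
  have := sq_le_relEnt hu y
  nlinarith [sq_nonneg (u - Real.sigmoid y), sq_eq_zero_iff.1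
    (le_antisymm (by linarith : (u - Real.sigmoid y) ^ 2 ≤ 0) (sq_nonneg _))]

lemma ent_eq (p : ℝ) : ent p = -Real.binEntropy p := by
  rw [ent, Real.binEntropy, Real.log_inv, Real.log_inv]; ring

@[fun_prop]
lemma continuous_ent : Continuous ent := by
  have : ent = fun p => -Real.binEntropy p := funext ent_eq
  rw [this]; fun_prop

lemma ent_nonpos {p : ℝ} (hp : p ∈ Icc (0 : ℝ) 1) : ent p ≤ 0 := by
  rw [ent_eq, neg_nonpos]; exact Real.binEntropy_nonneg hp.1 hp.2

lemma neg_log_two_le_ent (p : ℝ) : -Real.log 2 ≤ ent p := by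
  rw [ent_eq, neg_le_neg_iff]; exact Real.binEntropy_le_log_two

lemma ent_zero : ent 0 = 0 := by simp [ent]

lemma ent_one_sub (p : ℝ) : ent (1 - p) = ent p := by
  rw [ent, ent, sub_sub_cancel]; ring

@[fun_prop]
lemma continuous_log_one_add_exp : Continuous fun y : ℝ => Real.log (1 + Real.exp y) :=
  Continuous.log (by fun_prop) fun y => (one_add_exp_pos y).ne'

@[fun_prop]
lemma continuous_redDens : Continuous redDens := by
  unfold redDens; fun_prop

lemma ent_eq_relEnt (p y : ℝ) :
    ent p = relEnt p y + p * y - Real.log (1 + Real.exp y) := by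
  unfold relEnt; ring

lemma dens_far {b : ℝ} (h0 : 0 < b) (h1 : b < 1) : dens b (pot b) 0 = redDens (pot b) := by
  have := relEnt_sigmoid (pot b)
  rw [sigmoid_pot h0 h1] at this
  rw [dens_eq, this, ent_zero]; ring

lemma log_one_add_exp_neg (y : ℝ) :
    Real.log (1 + Real.exp (-y)) = Real.log (1 + Real.exp y) - y := by
  have : 1 + Real.exp (-y) = (1 + Real.exp y) / Real.exp y := by
    rw [Real.exp_neg]; field_simp; ring
  rw [this, Real.log_div (one_add_exp_pos y).ne' (Real.exp_pos y).ne', Real.log_exp]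

lemma dens_reflect (u y p : ℝ) : dens (1 - u) (-y) p = dens u y p := by
  unfold dens
  rw [ent_one_sub, log_one_add_exp_neg]; ring

lemma log_one_add_exp_le (y : ℝ) : Real.log (1 + Real.exp y) ≤ Real.exp y := by
  have := Real.log_le_sub_one_of_pos (one_add_exp_pos y)
  linarith

lemma hasDerivAt_log_one_add_exp (y : ℝ) :
    HasDerivAt (fun y : ℝ => Real.log (1 + Real.exp y)) (Real.sigmoid y) y := by
  rw [sigmoid_eq]
  exact ((Real.hasDerivAt_exp y).const_add 1).log (one_add_exp_pos y).ne'

lemma hasDerivAt_redDens (y : ℝ) : HasDerivAt redDens (1 - 2 * Real.sigmoid y) y :=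
  (hasDerivAt_id y).sub ((hasDerivAt_log_one_add_exp y).const_mul 2)

lemma concaveOn_redDens : ConcaveOn ℝ univ redDens := by
  refine AntitoneOn.concaveOn_of_deriv convex_univ continuous_redDens.continuousOn
    (fun y _ => (hasDerivAt_redDens y).differentiableAt.differentiableWithinAt) ?_
  intro x _ y _ hxy
  rw [(hasDerivAt_redDens x).deriv, (hasDerivAt_redDens y).deriv]
  linarith [Real.sigmoid_monotone hxy]

lemma redDens_sub_le {x y : ℝ} (hxy : x ≤ y) : redDens x - redDens y ≤ y - x := by
  have h : Real.log (1 + Real.exp y) ≤ (y - x) + Real.log (1 + Real.exp x) := by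
    have h1 : 1 + Real.exp y ≤ Real.exp (y - x) * (1 + Real.exp x) := by
      rw [mul_add, ← Real.exp_add, sub_add_cancel, mul_one]
      linarith [Real.one_le_exp (sub_nonneg.2 hxy)]
    have h2 := Real.log_le_log (one_add_exp_pos y) h1
    rwa [Real.log_mul (Real.exp_pos _).ne' (one_add_exp_pos x).ne', Real.log_exp] at h2
  unfold redDens
  linarith

lemma sigmoid_sub_le {x y : ℝ} (hxy : x ≤ y) : Real.sigmoid y - Real.sigmoid x ≤ y - x := by
  have : ∀ z, HasDerivAt (fun y => y - Real.sigmoid y)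
      (1 - Real.sigmoid z * (1 - Real.sigmoid z)) z := fun z =>
    (hasDerivAt_id z).sub (Real.hasDerivAt_sigmoid z)
  have hm : Monotone fun y => y - Real.sigmoid y := by
    refine monotone_of_deriv_nonneg (fun z => (this z).differentiableAt) fun z => ?_
    rw [(this z).deriv]
    nlinarith [Real.sigmoid_pos z, one_sub_sigmoid_pos z]
  have := hm hxy
  simp only at this
  linarith

lemma sigmoid_mul_lt {x y : ℝ} (h1 : -y < x) (h2 : x < y) :
    Real.sigmoid y * (1 - Real.sigmoid y) < Real.sigmoid x * (1 - Real.sigmoid x) := by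
  have a1 := Real.sigmoid_strictMono h1
  have a2 := Real.sigmoid_strictMono h2
  rw [Real.sigmoid_neg] at a1
  nlinarith

lemma redDens_lt {x y : ℝ} (h1 : -y < x) (h2 : x < y) : redDens y < redDens x := by
  rw [← Real.exp_lt_exp, exp_redDens, exp_redDens]
  exact sigmoid_mul_lt h1 h2

lemma exists_redDens_ge {α β : ℝ} (h1 : -β < α) (h2 : α < β) :
    ∃ κ : ℝ, 0 < κ ∧ ∀ y ∈ Icc α β, κ * (β - y) ≤ redDens y - redDens β := by
  have hd : 0 < β - α := by linarith
  refine ⟨(redDens α - redDens β) / (β - α), div_pos (by linarith [redDens_lt h1 h2]) hd, ?_⟩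
  intro y hy
  have hc := concaveOn_redDens.2 (mem_univ α) (mem_univ β)
    (div_nonneg (sub_nonneg.2 hy.2) hd.le) (div_nonneg (sub_nonneg.2 hy.1) hd.le)
    (by field_simp; ring)
  have hy' : (β - y) / (β - α) * α + (y - α) / (β - α) * β = y := by field_simp; ring
  simp only [smul_eq_mul] at hc
  rw [hy'] at hc
  refine le_trans (le_of_eq ?_) (sub_le_sub_right hc (redDens β))
  field_simp
  ring

/-! ### Monotone 1-Lipschitz functions -/

/-- A monotone function of Lipschitz constant `1`: the functions that are absolutely continuous with
derivative in `[0, 1]`. -/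
structure MonoLip (φ : ℝ → ℝ) : Prop where
  mono : Monotone φ
  sub_le : ∀ x y, x ≤ y → φ y - φ x ≤ y - x

namespace MonoLip

variable {φ : ℝ → ℝ}

lemma lipschitzWith (h : MonoLip φ) : LipschitzWith 1 φ := by
  refine LipschitzWith.of_le_add fun x y => ?_
  rw [Real.dist_eq]
  rcases le_total x y with hxy | hxy
  · linarith [h.mono hxy, abs_nonneg (x - y)]
  · linarith [h.sub_le y x hxy, le_abs_self (x - y)]

lemma abs_sub_le (h : MonoLip φ) (x y : ℝ) : |φ x - φ y| ≤ |x - y| := by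
  simpa [Real.dist_eq] using h.lipschitzWith.dist_le_mul x y

lemma continuous (h : MonoLip φ) : Continuous φ := h.lipschitzWith.continuous

lemma deriv_mem (h : MonoLip φ) (x : ℝ) : deriv φ x ∈ Icc (0 : ℝ) 1 := by
  refine ⟨h.mono.deriv_nonneg, ?_⟩
  have := norm_deriv_le_of_lipschitz (x₀ := x) h.lipschitzWith
  exact (le_abs_self _).trans (by simpa using this)

lemma absolutelyContinuous (h : MonoLip φ) (a b : ℝ) : AbsolutelyContinuousOnInterval φ a b :=
  (h.lipschitzWith.lipschitzOnWith (s := uIcc a b)).absolutelyContinuousOnInterval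

lemma integral_deriv (h : MonoLip φ) (a b : ℝ) : ∫ x in a..b, deriv φ x = φ b - φ a :=
  (h.absolutelyContinuous a b).integral_deriv_eq_sub

lemma ae_differentiableAt (h : MonoLip φ) : ∀ᵐ x, DifferentiableAt ℝ φ x :=
  h.lipschitzWith.ae_differentiableAt_real

lemma integral_sub_mul_deriv (h : MonoLip φ) (X R : ℝ) :
    ∫ x in X..R, (x - X) * deriv φ x = (R - X) * φ R - ∫ x in X..R, φ x := by
  have hid : AbsolutelyContinuousOnInterval (fun x : ℝ => x - X) X R := by
    refine LipschitzOnWith.absolutelyContinuousOnInterval (K := 1) ?_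
    exact (LipschitzWith.of_le_add fun x y => by
      rw [Real.dist_eq]; linarith [le_abs_self (x - y)]).lipschitzOnWith
  rw [hid.integral_mul_deriv_eq_deriv_mul (h.absolutelyContinuous X R)]
  simp

/-- The substitution rule for a Lipschitz change of variable. -/
lemma integral_comp_mul_deriv (h : MonoLip φ) {F : ℝ → ℝ} (hF : Continuous F) (a b : ℝ) :
    ∫ x in a..b, F (φ x) * deriv φ x = ∫ y in φ a..φ b, F y := by
  set W : ℝ → ℝ := fun y => ∫ t in φ a..y, F t with hW
  have hWd : ∀ y, HasDerivAt W (F y) y := fun y =>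
    intervalIntegral.integral_hasDerivAt_right (hF.intervalIntegrable _ _)
      (hF.stronglyMeasurableAtFilter _ _) hF.continuousAt
  have hWc : ContDiff ℝ 1 W := by
    rw [contDiff_one_iff_deriv]
    refine ⟨fun y => (hWd y).differentiableAt, ?_⟩
    have : deriv W = F := funext fun y => (hWd y).deriv
    rwa [this]
  obtain ⟨K, hK⟩ := (hWc.contDiffOn (s := Icc (min (φ a) (φ b)) (max (φ a) (φ b)))
    ).exists_lipschitzOnWith one_ne_zero (convex_Icc _ _) isCompact_Icc
  have hmaps : MapsTo φ (uIcc a b) (Icc (min (φ a) (φ b)) (max (φ a) (φ b))) := by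
    intro x hx
    have h1 := h.mono hx.1
    have h2 := h.mono hx.2
    rw [h.mono.map_min] at h1
    rw [h.mono.map_max] at h2
    exact ⟨h1, h2⟩
  have hac : AbsolutelyContinuousOnInterval (W ∘ φ) a b :=
    (hK.comp h.lipschitzWith.lipschitzOnWith hmaps).absolutelyContinuousOnInterval
  have hint := hac.integral_deriv_eq_sub
  have hWa : W (φ a) = 0 := by simp [hW]
  rw [Function.comp, Function.comp, hWa, sub_zero] at hint
  refine Eq.trans ?_ hint
  refine intervalIntegral.integral_congr_ae ?_
  filter_upwards [h.ae_differentiableAt] with x hx _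
  exact ((hWd (φ x)).comp x hx.hasDerivAt).deriv.symm

end MonoLip

lemma monoLip_max {φ ψ : ℝ → ℝ} (h : MonoLip φ) (k : MonoLip ψ) :
    MonoLip fun x => max (φ x) (ψ x) := by
  refine ⟨fun x y hxy => max_le_max (h.mono hxy) (k.mono hxy), fun x y hxy => ?_⟩
  rw [sub_le_iff_le_add]
  exact max_le (by linarith [h.sub_le x y hxy, le_max_left (φ x) (ψ x)])
    (by linarith [k.sub_le x y hxy, le_max_right (φ x) (ψ x)])

lemma intervalIntegrable_of_bounded {f : ℝ → ℝ} {a b C : ℝ} (hf : AEStronglyMeasurable f volume)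
    (hC : ∀ᵐ x, x ∈ uIoc a b → |f x| ≤ C) : IntervalIntegrable f volume a b := by
  rw [intervalIntegrable_iff]
  refine Measure.integrableOn_of_bounded (M := C) (by simp [uIoc]) hf ?_
  rw [ae_restrict_iff' measurableSet_uIoc]
  exact hC

/-- Lebesgue measure on `[0, ∞)`. -/
abbrev halfVol : Measure ℝ := volume.restrict (Ici 0)

/-! ### Weak-* convergence from convergence of primitives -/

section WeakStar

variable {ι : Type*} {l : Filter ι}

lemma tendsto_setIntegral_iUnion {d : ι → ℝ → ℝ} {ν : Measure ℝ}
    (hm : ∀ i, AEStronglyMeasurable (d i) ν) (hd : ∀ i, ∀ᵐ x ∂ν, |d i x| ≤ 1)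
    {s : ℕ → Set ℝ} (hs : ∀ k, MeasurableSet (s k)) (hdisj : Pairwise (Function.onFun Disjoint s))
    (hfin : ν (⋃ k, s k) ≠ ⊤) (h : ∀ k, Tendsto (fun i => ∫ x in s k, d i x ∂ν) l (𝓝 0)) :
    Tendsto (fun i => ∫ x in ⋃ k, s k, d i x ∂ν) l (𝓝 0) := by
  have hint : ∀ i, IntegrableOn (d i) (⋃ k, s k) ν := fun i =>
    Measure.integrableOn_of_bounded (M := 1) hfin (hm i) (ae_restrict_of_ae (hd i))
  have hk : ∀ k, ν (s k) ≠ ⊤ := fun k =>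
    ((measure_mono (subset_iUnion s k)).trans_lt hfin.lt_top).ne
  have hsum : Summable fun k => (ν (s k)).toReal := by
    refine ENNReal.summable_toReal ?_
    rwa [← measure_iUnion hdisj hs]
  have := tendsto_tsum_of_dominated_convergence (𝓕 := l)
    (f := fun i k => ∫ x in s k, d i x ∂ν) (g := fun _ => (0 : ℝ)) hsum h
    (Eventually.of_forall fun i k => by
      have := norm_setIntegral_le_of_norm_le_const_ae' (μ := ν) (s := s k) (C := 1)
        (f := d i) (hk k).lt_top ((hd i).mono fun x hx _ => hx)
      simpa [Measure.real] using this)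
  simp only [tsum_zero] at this
  refine this.congr fun i => ?_
  rw [integral_iUnion hs hdisj (hint i)]

/-- Uniformly bounded functions whose primitives tend to zero pointwise tend to zero weakly-*. -/
lemma tendsto_integral_mul_of_primitive {d : ι → ℝ → ℝ}
    (hm : ∀ i, AEStronglyMeasurable (d i) halfVol) (hd : ∀ i, ∀ᵐ x ∂halfVol, |d i x| ≤ 1)
    (h : ∀ R, 0 ≤ R → Tendsto (fun i => ∫ x in (0 : ℝ)..R, d i x) l (𝓝 0))
    {f : ℝ → ℝ} (hf : Integrable f halfVol) :
    Tendsto (fun i => ∫ x, d i x * f x ∂halfVol) l (𝓝 0) := by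
  -- the bounded pieces `s ∩ (n, n + 1]` of a measurable set
  have hIoc : ∀ (n : ℕ) (a b : ℝ), Ioc a b ⊆ Ioc (n : ℝ) (n + 1) →
      Tendsto (fun i => ∫ x in Ioc a b, d i x ∂halfVol) l (𝓝 0) := by
    intro n a b hab
    rcases le_or_gt b a with hba | hba
    · simpa [Ioc_eq_empty_of_le hba] using tendsto_const_nhds
    have ha : 0 ≤ a := by
      have := (Ioc_subset_Ioc_iff hba).1 hab
      exact (Nat.cast_nonneg n).trans this.2
    have hsub : Ioc a b ⊆ Ici 0 := fun x hx => ha.trans hx.1.le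
    have hII : ∀ i R, 0 ≤ R → IntervalIntegrable (d i) volume 0 R := by
      intro i R hR
      rw [intervalIntegrable_iff_integrableOn_Ioc_of_le hR]
      have : IntegrableOn (d i) (Ioc 0 R) halfVol :=
        Measure.integrableOn_of_bounded (M := 1)
          ((Measure.restrict_apply_le _ _).trans_lt (by simp)).ne (hm i)
          (ae_restrict_of_ae (hd i))
      rwa [IntegrableOn, Measure.restrict_restrict measurableSet_Ioc,
        inter_eq_self_of_subset_left (Ioc_subset_Ioi_self.trans Ioi_subset_Ici_self)] at this
    have hlim := (h b (ha.trans hba.le)).sub (h a ha)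
    rw [sub_zero] at hlim
    refine hlim.congr fun i => ?_
    rw [intervalIntegral.integral_interval_sub_left (hII i b (ha.trans hba.le)) (hII i a ha),
      intervalIntegral.integral_of_le hba.le, Measure.restrict_restrict measurableSet_Ioc,
      inter_eq_self_of_subset_left hsub]
  have hfin : ∀ (n : ℕ) (s : Set ℝ), halfVol (s ∩ Ioc (n : ℝ) (n + 1)) ≠ ⊤ := fun n s =>
    ((measure_mono inter_subset_right).trans_lt
      ((Measure.restrict_apply_le _ _).trans_lt (by simp))).ne
  have hpiece : ∀ s : Set ℝ, MeasurableSet s → ∀ n : ℕ,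
      Tendsto (fun i => ∫ x in s ∩ Ioc (n : ℝ) (n + 1), d i x ∂halfVol) l (𝓝 0) := by
    intro s hs n
    induction s, hs using MeasurableSpace.induction_on_inter (borel_eq_generateFrom_Iic ℝ ▸
      (BorelSpace.measurable_eq (α := ℝ))) isPiSystem_Iic with
    | empty => simpa using tendsto_const_nhds
    | basic t ht =>
      obtain ⟨c, rfl⟩ := ht
      have : Iic c ∩ Ioc (n : ℝ) (n + 1) = Ioc (n : ℝ) (min c (n + 1)) := by
        ext x; simp only [mem_inter_iff, mem_Iic, mem_Ioc, le_min_iff]; tauto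
      rw [this]
      exact hIoc n _ _ (Ioc_subset_Ioc_right (min_le_right _ _))
    | compl t ht ih =>
      have h1 := (hIoc n n (n + 1) subset_rfl).sub ih
      rw [sub_zero] at h1
      refine h1.congr fun i => ?_
      have hi : IntegrableOn (d i) (Ioc (n : ℝ) (n + 1)) halfVol :=
        Measure.integrableOn_of_bounded (M := 1) (by simpa using hfin n univ) (hm i)
          (ae_restrict_of_ae (hd i))
      have := integral_inter_add_sdiff (μ := halfVol) ht hi
      have e1 : Ioc (n : ℝ) (n + 1) ∩ t = t ∩ Ioc (n : ℝ) (n + 1) := inter_comm _ _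
      have e2 : Ioc (n : ℝ) (n + 1) \ t = tᶜ ∩ Ioc (n : ℝ) (n + 1) := by
        rw [sdiff_eq, inter_comm]
      rw [e1, e2] at this
      linarith
    | iUnion t hdisj ht ih =>
      rw [iUnion_inter]
      refine tendsto_setIntegral_iUnion hm hd (fun k => (ht k).inter measurableSet_Ioc) ?_ ?_ ih
      · intro j k hjk
        exact (hdisj hjk).mono inter_subset_left inter_subset_left
      · rw [← iUnion_inter]; exact hfin n _
  have hset : ∀ s : Set ℝ, MeasurableSet s → halfVol s < ⊤ →
      Tendsto (fun i => ∫ x in s, d i x ∂halfVol) l (𝓝 0) := by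
    intro s hs hlt
    have hU : s ∩ Ioi 0 = ⋃ n : ℕ, s ∩ Ioc (n : ℝ) (n + 1) := by
      rw [← inter_iUnion]
      congr 1
      ext x
      simp only [mem_Ioi, mem_iUnion, mem_Ioc]
      constructor
      · intro hx
        obtain ⟨n, hn⟩ := Nat.exists_eq_add_of_le (Nat.one_le_ceil_iff.2 hx)
        refine ⟨n, ?_, ?_⟩
        · have := Nat.ceil_lt_add_one hx.le
          rw [hn] at this; push_cast at this; linarith
        · have := Nat.le_ceil x
          rw [hn] at this; push_cast at this; linarith
      · rintro ⟨n, hn, -⟩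
        exact (Nat.cast_nonneg n).trans_lt hn
    have hae : s =ᵐ[halfVol] (s ∩ Ioi 0 : Set ℝ) := by
      have : ∀ᵐ x ∂halfVol, (0 : ℝ) < x := by
        have h1 : ∀ᵐ x ∂halfVol, x ∈ Ioi (0 : ℝ) := by
          rw [halfVol, ← restrict_Ioi_eq_restrict_Ici]
          exact ae_restrict_mem measurableSet_Ioi
        exact h1
      filter_upwards [this] with x hx
      exact propext ⟨fun h => ⟨h, hx⟩, fun h => h.1⟩
    have : Tendsto (fun i => ∫ x in s ∩ Ioi 0, d i x ∂halfVol) l (𝓝 0) := by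
      rw [hU]
      refine tendsto_setIntegral_iUnion hm hd (fun k => hs.inter measurableSet_Ioc) ?_ ?_
        (hpiece s hs)
      · intro j k hjk
        refine Disjoint.mono inter_subset_right inter_subset_right ?_
        rw [Set.disjoint_left]
        intro x hx hx'
        apply hjk
        have h1 : (j : ℝ) < k + 1 := hx.1.trans_le hx'.2
        have h2 : (k : ℝ) < j + 1 := hx'.1.trans_le hx.2
        have h3 : j < k + 1 := by exact_mod_cast h1
        have h4 : k < j + 1 := by exact_mod_cast h2
        omega
      · rw [← hU]
        exact ((measure_mono inter_subset_left).trans_lt hlt).ne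
    refine this.congr fun i => ?_
    rw [setIntegral_congr_set hae]
  have hmul : ∀ i (g : ℝ → ℝ), Integrable g halfVol → Integrable (fun x => d i x * g x) halfVol :=
    fun i g hg => hg.bdd_mul (hm i) (hd i)
  refine Integrable.induction
    (P := fun g : ℝ → ℝ => Tendsto (fun i => ∫ x, d i x * g x ∂halfVol) l (𝓝 0))
    ?_ ?_ ?_ ?_ hf
  · intro c s hs hlt
    have := (hset s hs hlt).mul_const c
    rw [zero_mul] at this
    refine this.congr fun i => ?_
    rw [← integral_mul_const, ← integral_indicator hs]
    congr 1
    ext x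
    by_cases hx : x ∈ s <;> simp [hx]
  · intro f g _ hf hg h1 h2
    have := h1.add h2
    rw [add_zero] at this
    refine this.congr fun i => ?_
    rw [← integral_add (hmul i f hf) (hmul i g hg)]
    simp [mul_add]
  · rw [← isSeqClosed_iff_isClosed]
    intro u g hu hlim
    rw [mem_ofPred_eq, Metric.tendsto_nhds]
    intro ε hε
    obtain ⟨n, hn⟩ := (Metric.tendsto_atTop.1 hlim (ε / 2) (by linarith))
    have hn := hn n le_rfl
    filter_upwards [Metric.tendsto_nhds.1 (hu n) (ε / 2) (by linarith)] with i hi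
    rw [Real.dist_eq, sub_zero] at hi ⊢
    have hI : Integrable (fun x => d i x * (g x - u n x)) halfVol :=
      hmul i _ ((L1.integrable_coeFn g).sub (L1.integrable_coeFn (u n)))
    have e1 : ∫ x, d i x * g x ∂halfVol = (∫ x, d i x * u n x ∂halfVol) +
        ∫ x, d i x * (g x - u n x) ∂halfVol := by
      rw [← integral_add (hmul i _ (L1.integrable_coeFn _)) hI]
      congr 1; ext x; ring
    have e2 : |∫ x, d i x * (g x - u n x) ∂halfVol| ≤ dist (u n) g := by
      rw [dist_comm, dist_eq_norm, L1.norm_eq_integral_norm]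
      refine (norm_integral_le_integral_norm
        (fun x => d i x * (g x - u n x))).trans ?_
      refine integral_mono_ae hI.norm (L1.integrable_coeFn _).norm ?_
      filter_upwards [Lp.coeFn_sub g (u n), hd i] with x hx hx'
      rw [hx, Pi.sub_apply, norm_mul]
      exact mul_le_of_le_one_left (norm_nonneg _) hx'
    rw [e1]
    refine (abs_add_le _ _).trans_lt ?_
    linarith
  · intro f g hfg _ h1
    refine h1.congr fun i => ?_
    refine integral_congr_ae ?_
    filter_upwards [hfg] with x hx
    rw [hx]

end WeakStar

/-! ### Admissible profiles and compactness -/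

/-- The elements of `𝒞⁺`, extended to the real line by the constant `α` on `(-∞, 0]`. -/
structure IsAdm (α β : ℝ) (φ : ℝ → ℝ) : Prop extends MonoLip φ where
  left : ∀ x ≤ 0, φ x = α
  tendsto : Tendsto φ atTop (𝓝 β)

namespace IsAdm

variable {α β : ℝ} {φ : ℝ → ℝ}

lemma le_far (h : IsAdm α β φ) (x : ℝ) : φ x ≤ β := h.mono.ge_of_tendsto h.tendsto x

lemma near_le (h : IsAdm α β φ) (x : ℝ) : α ≤ φ x := by
  rcases le_total x 0 with hx | hx
  · rw [h.left x hx]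
  · rw [← h.left 0 le_rfl]; exact h.mono hx

lemma mem_Icc (h : IsAdm α β φ) (x : ℝ) : φ x ∈ Icc α β := ⟨h.near_le x, h.le_far x⟩

end IsAdm

section Limits

variable {ι : Type*}

lemma MonoLip.of_tendsto {l : Filter ι} [l.NeBot] {P : ι → ℝ → ℝ} {P₀ : ℝ → ℝ}
    (hP : ∀ i, MonoLip (P i)) (h : ∀ x, Tendsto (fun i => P i x) l (𝓝 (P₀ x))) : MonoLip P₀ :=
  ⟨fun x y hxy => le_of_tendsto_of_tendsto' (h x) (h y) fun i => (hP i).mono hxy,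
    fun x y hxy => le_of_tendsto' ((h y).sub (h x)) fun i => (hP i).sub_le x y hxy⟩

/-- Compactness of monotone 1-Lipschitz functions with a common value at the origin, for pointwise
convergence. -/
lemma exists_monoLip_limit (F : Ultrafilter ι) {P : ι → ℝ → ℝ} (hP : ∀ i, MonoLip (P i)) {c : ℝ}
    (h0 : ∀ i, P i 0 = c) :
    ∃ P₀, MonoLip P₀ ∧ ∀ x, Tendsto (fun i => P i x) F (𝓝 (P₀ x)) := by
  have : ∀ x, ∃ y, Tendsto (fun i => P i x) F (𝓝 y) := by
    intro x
    have hmem : ∀ i, P i x ∈ Icc (c - |x|) (c + |x|) := by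
      intro i
      have := (hP i).abs_sub_le x 0
      rw [h0, sub_zero, abs_le] at this
      constructor <;> linarith
    obtain ⟨y, -, hy⟩ := (isCompact_Icc (a := c - |x|) (b := c + |x|)).ultrafilter_le_nhds
      (F.map fun i => P i x) (by
        rw [le_principal_iff]
        exact Filter.mem_map.2 (univ_mem' hmem))
    exact ⟨y, hy⟩
  choose P₀ hP₀ using this
  exact ⟨P₀, MonoLip.of_tendsto hP hP₀, hP₀⟩

lemma eventually_abs_sub_le_on_Icc {l : Filter ι} {P : ι → ℝ → ℝ} {P₀ : ℝ → ℝ}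
    (hP : ∀ i, MonoLip (P i)) (hP₀ : MonoLip P₀)
    (h : ∀ x, Tendsto (fun i => P i x) l (𝓝 (P₀ x))) (R : ℝ) {ε : ℝ} (hε : 0 < ε) :
    ∀ᶠ i in l, ∀ x ∈ Icc 0 R, |P₀ x - P i x| < ε := by
  have hε3 : 0 < ε / 3 := by linarith
  have hgrid : ∀ᶠ i in l, ∀ k ∈ Finset.range (⌊R / (ε / 3)⌋₊ + 1),
      |P₀ (k * (ε / 3)) - P i (k * (ε / 3))| < ε / 3 := by
    rw [Filter.eventually_all_finset]
    intro k _
    have := Metric.tendsto_nhds.1 (h (k * (ε / 3))) (ε / 3) hε3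
    filter_upwards [this] with i hi
    rwa [dist_comm, Real.dist_eq] at hi
  filter_upwards [hgrid] with i hi x hx
  set k := ⌊x / (ε / 3)⌋₊ with hk
  have hkR : k ∈ Finset.range (⌊R / (ε / 3)⌋₊ + 1) := by
    rw [Finset.mem_range, Nat.lt_succ_iff]
    exact Nat.floor_mono (div_le_div_of_nonneg_right hx.2 hε3.le)
  have h1 : k * (ε / 3) ≤ x := by
    have := Nat.floor_le (div_nonneg hx.1 hε3.le)
    rwa [le_div_iff₀ hε3] at this
  have h2 : x < (k + 1) * (ε / 3) := by
    have := Nat.lt_floor_add_one (x / (ε / 3))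
    rwa [div_lt_iff₀ hε3] at this
  have h3 := abs_lt.1 (hi k hkR)
  have a1 := hP₀.mono h1
  have a2 := hP₀.sub_le _ _ h1
  have a3 := (hP i).mono h1
  have a4 := (hP i).sub_le _ _ h1
  rw [abs_lt]
  constructor <;> linarith [h3.1, h3.2]

/-- Compactness of the admissible profiles with a common rate of convergence at infinity, for
uniform convergence. -/
lemma exists_adm_limit (F : Ultrafilter ι) {α β M : ℝ} {φ : ι → ℝ → ℝ}
    (hφ : ∀ i, IsAdm α β (φ i))
    (hM : ∀ᶠ i in (F : Filter ι), ∀ x, 0 ≤ x → x * (β - φ i x) ≤ M) :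
    ∃ φ₀, IsAdm α β φ₀ ∧ (∀ x, 0 ≤ x → x * (β - φ₀ x) ≤ M) ∧ TendstoUniformly φ φ₀ F := by
  obtain ⟨φ₀, h₀, hlim⟩ := exists_monoLip_limit F (fun i => (hφ i).toMonoLip)
    (fun i => (hφ i).left 0 le_rfl)
  have hM₀ : ∀ x, 0 ≤ x → x * (β - φ₀ x) ≤ M := fun x hx =>
    le_of_tendsto ((tendsto_const_nhds.sub (hlim x)).const_mul x) (hM.mono fun i hi => hi x hx)
  have hle : ∀ x, φ₀ x ≤ β := fun x => le_of_tendsto' (hlim x) fun i => (hφ i).le_far x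
  have hleft : ∀ x ≤ 0, φ₀ x = α := fun x hx =>
    tendsto_nhds_unique (hlim x) (by simp [(hφ _).left x hx])
  have htend : Tendsto φ₀ atTop (𝓝 β) := by
    have h1 : Tendsto (fun x : ℝ => β - M / x) atTop (𝓝 β) := by
      have h2 : Tendsto (fun x : ℝ => M / x) atTop (𝓝 0) :=
        tendsto_const_nhds.div_atTop tendsto_id
      simpa using h2.const_sub β
    refine tendsto_of_tendsto_of_tendsto_of_le_of_le' h1 tendsto_const_nhds ?_
      (Eventually.of_forall hle)
    filter_upwards [eventually_gt_atTop 0] with x hx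
    have := hM₀ x hx.le
    rw [sub_le_comm, le_div_iff₀ hx]
    linarith
  refine ⟨φ₀, ⟨h₀, hleft, htend⟩, hM₀, ?_⟩
  rw [Metric.tendstoUniformly_iff]
  intro ε hε
  obtain ⟨R, hR, hR'⟩ : ∃ R : ℝ, 0 < R ∧ M / R < ε := by
    have h1 : Tendsto (fun x : ℝ => M / x) atTop (𝓝 0) :=
      tendsto_const_nhds.div_atTop tendsto_id
    exact ((eventually_gt_atTop 0).and (h1.eventually_lt_const hε)).exists
  have htail : ∀ ψ : ℝ → ℝ, (∀ x, 0 ≤ x → x * (β - ψ x) ≤ M) → ∀ x, R ≤ x → β - ψ x < ε := by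
    intro ψ hψ x hx
    have hx0 : 0 < x := hR.trans_le hx
    rcases le_or_gt (β - ψ x) 0 with hneg | hpos
    · linarith
    refine lt_of_le_of_lt ?_ hR'
    rw [le_div_iff₀ hR]
    nlinarith [hψ x hx0.le]
  filter_upwards [eventually_abs_sub_le_on_Icc (fun i => (hφ i).toMonoLip) h₀ hlim R hε, hM]
    with i hi hMi x
  rw [Real.dist_eq]
  rcases le_or_gt x 0 with hx | hx
  · rw [hleft x hx, (hφ i).left x hx]; simpa
  rcases le_or_gt x R with hxR | hxR
  · exact hi x ⟨hx.le, hxR⟩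
  · have a1 := htail φ₀ hM₀ x hxR.le
    have a2 := htail (φ i) hMi x hxR.le
    have a3 := hle x
    have a4 := (hφ i).le_far x
    rw [abs_lt]
    constructor <;> linarith

lemma abs_sub_le_one {a b : ℝ} (ha : a ∈ Icc (0 : ℝ) 1) (hb : b ∈ Icc (0 : ℝ) 1) :
    |a - b| ≤ 1 :=
  abs_le.2 ⟨by linarith [ha.1, hb.2], by linarith [ha.2, hb.1]⟩

/-- The derivatives of converging monotone 1-Lipschitz functions converge weakly-*. -/
lemma tendsto_integral_deriv_mul {l : Filter ι} {P : ι → ℝ → ℝ} {P₀ : ℝ → ℝ}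
    (hP : ∀ i, MonoLip (P i)) (hP₀ : MonoLip P₀)
    (h : ∀ x, Tendsto (fun i => P i x) l (𝓝 (P₀ x))) {f : ℝ → ℝ} (hf : Integrable f halfVol) :
    Tendsto (fun i => ∫ x, (deriv (P i) x - deriv P₀ x) * f x ∂halfVol) l (𝓝 0) := by
  refine tendsto_integral_mul_of_primitive (d := fun i x => deriv (P i) x - deriv P₀ x)
    (fun i => ((measurable_deriv _).sub (measurable_deriv _)).aestronglyMeasurable)
    (fun i => Eventually.of_forall fun x => ?_) (fun R hR => ?_) hf
  · exact abs_sub_le_one ((hP i).deriv_mem x) (hP₀.deriv_mem x)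
  · have : ∀ i, ∫ x in (0 : ℝ)..R, (deriv (P i) x - deriv P₀ x) =
        (P i R - P i 0) - (P₀ R - P₀ 0) := by
      intro i
      rw [intervalIntegral.integral_sub ((hP i).absolutelyContinuous 0 R).intervalIntegrable_deriv
        (hP₀.absolutelyContinuous 0 R).intervalIntegrable_deriv, (hP i).integral_deriv,
        hP₀.integral_deriv]
    simp only [this]
    simpa using ((h R).sub (h 0)).sub_const (P₀ R - P₀ 0)

lemma monoLip_primitive {w : ℝ → ℝ} (hw : Measurable w) (h01 : ∀ᵐ x, w x ∈ Icc (0 : ℝ) 1) :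
    MonoLip fun x => ∫ t in (0 : ℝ)..x, w t := by
  have hint : ∀ a b, IntervalIntegrable w volume a b := fun a b =>
    intervalIntegrable_of_bounded (C := 1) hw.aestronglyMeasurable
      (h01.mono fun x hx _ => abs_le.2 ⟨by linarith [hx.1], hx.2⟩)
  have hsub : ∀ x y, (∫ t in (0 : ℝ)..y, w t) - ∫ t in (0 : ℝ)..x, w t = ∫ t in x..y, w t :=
    fun x y => intervalIntegral.integral_interval_sub_left (hint 0 y) (hint 0 x)
  refine ⟨fun x y hxy => ?_, fun x y hxy => ?_⟩
  · rw [← sub_nonneg, hsub]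
    exact intervalIntegral.integral_nonneg_of_ae hxy (h01.mono fun x hx => hx.1)
  · rw [hsub]
    have := intervalIntegral.integral_mono_ae hxy (hint x y) (intervalIntegrable_const (c := 1))
      (h01.mono fun x hx => hx.2)
    simpa using this

/-- Weak-* compactness of the unit interval of `L^∞(0, ∞)`: the primitives of the functions converge
along the ultrafilter, and the derivative of the limit represents the weak-* limit. -/
lemma exists_weakStar_limit (F : Ultrafilter ι) {u : ι → ℝ → ℝ} (hu : ∀ i, Measurable (u i))
    (h01 : ∀ i, ∀ᵐ x ∂halfVol, u i x ∈ Icc (0 : ℝ) 1) :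
    ∃ u₀ : ℝ → ℝ, Measurable u₀ ∧ (∀ x, u₀ x ∈ Icc (0 : ℝ) 1) ∧ ∀ f, Integrable f halfVol →
      Tendsto (fun i => ∫ x, u i x * f x ∂halfVol) F (𝓝 (∫ x, u₀ x * f x ∂halfVol)) := by
  set w : ι → ℝ → ℝ := fun i => (Ici 0).indicator (u i) with hw
  have hwm : ∀ i, Measurable (w i) := fun i => (hu i).indicator measurableSet_Ici
  have hw01 : ∀ i, ∀ᵐ x, w i x ∈ Icc (0 : ℝ) 1 := by
    intro i
    have := (ae_restrict_iff' measurableSet_Ici).1 (h01 i)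
    filter_upwards [this] with x hx
    by_cases hx0 : x ∈ Ici (0 : ℝ)
    · simpa [hw, hx0] using hx hx0
    · simp [hw, hx0]
  have hwint : ∀ i a b, IntervalIntegrable (w i) volume a b := fun i a b =>
    intervalIntegrable_of_bounded (C := 1) (hwm i).aestronglyMeasurable
      ((hw01 i).mono fun x hx _ => abs_le.2 ⟨by linarith [hx.1], hx.2⟩)
  have hP : ∀ i, MonoLip fun x => ∫ t in (0 : ℝ)..x, w i t := fun i =>
    monoLip_primitive (hwm i) (hw01 i)
  obtain ⟨P₀, hP₀, hlim⟩ := exists_monoLip_limit F hP (c := 0) (by simp)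
  refine ⟨deriv P₀, measurable_deriv _, hP₀.deriv_mem, fun f hf => ?_⟩
  have hz : P₀ 0 = 0 := tendsto_nhds_unique (hlim 0) (by simp)
  have hbd : ∀ᵐ x ∂halfVol, |deriv P₀ x| ≤ 1 := Eventually.of_forall fun x =>
    abs_le.2 ⟨by linarith [(hP₀.deriv_mem x).1], (hP₀.deriv_mem x).2⟩
  have key : Tendsto (fun i => ∫ x, (w i x - deriv P₀ x) * f x ∂halfVol) F (𝓝 0) := by
    refine tendsto_integral_mul_of_primitive (d := fun i x => w i x - deriv P₀ x)
      (fun i => ((hwm i).sub (measurable_deriv _)).aestronglyMeasurable)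
      (fun i => ?_) (fun R hR => ?_) hf
    · filter_upwards [ae_restrict_of_ae (hw01 i)] with x a1
      exact abs_sub_le_one a1 (hP₀.deriv_mem x)
    · have : ∀ i, ∫ x in (0 : ℝ)..R, (w i x - deriv P₀ x) =
          (∫ x in (0 : ℝ)..R, w i x) - P₀ R := by
        intro i
        rw [intervalIntegral.integral_sub (hwint i 0 R)
          (hP₀.absolutelyContinuous 0 R).intervalIntegrable_deriv, hP₀.integral_deriv, hz, sub_zero]
      simp only [this]
      simpa using (hlim R).sub_const (P₀ R)
  have hI₀ : Integrable (fun x => deriv P₀ x * f x) halfVol :=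
    hf.bdd_mul (measurable_deriv _).aestronglyMeasurable hbd
  have key2 := key.add_const (∫ x, deriv P₀ x * f x ∂halfVol)
  rw [zero_add] at key2
  refine key2.congr fun i => ?_
  have hIi : Integrable (fun x => (w i x - deriv P₀ x) * f x) halfVol := by
    refine hf.bdd_mul (c := 1) ((hwm i).sub (measurable_deriv _)).aestronglyMeasurable ?_
    filter_upwards [ae_restrict_of_ae (hw01 i)] with x a1
    exact abs_sub_le_one a1 (hP₀.deriv_mem x)
  rw [← integral_add hIi hI₀]
  refine integral_congr_ae ?_
  filter_upwards [ae_restrict_mem measurableSet_Ici] with x hx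
  simp only [hw, indicator_of_mem hx]
  ring

end Limits

/-! ### Energy estimates -/

/-- A pair of a density with values in `[0, 1]` and an admissible profile. -/
structure IsPair (α β : ℝ) (u φ : ℝ → ℝ) : Prop where
  measurable : Measurable u
  mem : ∀ x, u x ∈ Icc (0 : ℝ) 1
  adm : IsAdm α β φ

/-- The integrand of the functional, in terms of the relative entropy. -/
def exc (β : ℝ) (u φ : ℝ → ℝ) (x : ℝ) : ℝ :=
  relEnt (u x) (φ x) + (redDens (φ x) - redDens β) + ent (deriv φ x)

/-- The two integrability conditions that define `𝒟⁺`. -/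
def InDom (β : ℝ) (u φ : ℝ → ℝ) : Prop :=
  Integrable (fun x => (u x - Real.sigmoid β) ^ 2) halfVol ∧
    Integrable (fun x => β - φ x) halfVol

lemma intervalIntegrable_of_mem {w : ℝ → ℝ} (hw : Measurable w) (h : ∀ x, w x ∈ Icc (0 : ℝ) 1)
    (a b : ℝ) : IntervalIntegrable w volume a b :=
  intervalIntegrable_of_bounded (C := 1) hw.aestronglyMeasurable
    (Eventually.of_forall fun x _ => abs_le.2 ⟨by linarith [(h x).1], (h x).2⟩)

lemma intervalIntegrable_ent {w : ℝ → ℝ} (hw : Measurable w) (h : ∀ x, w x ∈ Icc (0 : ℝ) 1)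
    (a b : ℝ) : IntervalIntegrable (fun x => ent (w x)) volume a b :=
  intervalIntegrable_of_bounded (C := Real.log 2)
    (continuous_ent.measurable.comp hw).aestronglyMeasurable
    (Eventually.of_forall fun x _ => abs_le.2 ⟨neg_log_two_le_ent _,
      (ent_nonpos (h x)).trans (Real.log_nonneg one_le_two)⟩)

lemma intervalIntegrable_relEnt {w ψ : ℝ → ℝ} (hw : Measurable w) (h : ∀ x, w x ∈ Icc (0 : ℝ) 1)
    (hψ : Continuous ψ) (a b : ℝ) : IntervalIntegrable (fun x => relEnt (w x) (ψ x)) volume a b :=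
  ((intervalIntegrable_ent hw h a b).sub
    ((intervalIntegrable_of_mem hw h a b).mul_continuousOn hψ.continuousOn)).add
    ((continuous_log_one_add_exp.comp hψ).intervalIntegrable a b)

namespace IsPair

variable {α β : ℝ} {u φ : ℝ → ℝ}

lemma intervalIntegrable_exc (h : IsPair α β u φ) (a b : ℝ) :
    IntervalIntegrable (exc β u φ) volume a b :=
  ((intervalIntegrable_relEnt h.measurable h.mem h.adm.continuous a b).add
    (((continuous_redDens.comp h.adm.continuous).sub continuous_const).intervalIntegrable a b)).add
    (intervalIntegrable_ent (measurable_deriv _) h.adm.deriv_mem a b)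

lemma intervalIntegrable_gap (h : IsPair α β u φ) (a b : ℝ) :
    IntervalIntegrable (fun x => β - φ x) volume a b :=
  (continuous_const.sub h.adm.continuous).intervalIntegrable a b

lemma gap_nonneg (h : IsPair α β u φ) (x : ℝ) : 0 ≤ β - φ x := sub_nonneg.2 (h.adm.le_far x)

/-- Young's inequality with the linear weight `-M - ε (x - X)` bounds the entropy of `φ'` from
below. -/
lemma integral_ent_deriv_ge (h : IsPair α β u φ) {X R M ε : ℝ} (hXR : X ≤ R) (hM : 0 ≤ M)
    (hε : 0 < ε) :
    -M * (β - φ X) - Real.exp (-M) / ε - ε * ∫ x in X..R, (β - φ x) ≤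
      ∫ x in X..R, ent (deriv φ x) := by
  have hd := (h.adm.absolutelyContinuous X R).intervalIntegrable_deriv
  have hlam : Continuous fun x : ℝ => -M - ε * (x - X) := by fun_prop
  have hexp : Continuous fun x : ℝ => Real.exp (-M - ε * (x - X)) := by fun_prop
  have hpt : ∀ x, (-M - ε * (x - X)) * deriv φ x - Real.exp (-M - ε * (x - X)) ≤
      ent (deriv φ x) := by
    intro x
    rw [ent_eq_relEnt _ (-M - ε * (x - X))]
    have a1 := relEnt_nonneg (h.adm.deriv_mem x) (-M - ε * (x - X))
    have a2 := log_one_add_exp_le (-M - ε * (x - X))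
    linarith
  have hmono := intervalIntegral.integral_mono_on (μ := volume) hXR
    ((hd.continuousOn_mul hlam.continuousOn).sub (hexp.intervalIntegrable X R))
    (intervalIntegrable_ent (measurable_deriv φ) h.adm.deriv_mem X R) fun x _ => hpt x
  refine le_trans ?_ hmono
  rw [intervalIntegral.integral_sub (hd.continuousOn_mul hlam.continuousOn)
    (hexp.intervalIntegrable X R)]
  have e1 : ∫ x in X..R, (-M - ε * (x - X)) * deriv φ x =
      -M * (φ R - φ X) - ε * ((R - X) * φ R - ∫ x in X..R, φ x) := by
    rw [← h.adm.integral_sub_mul_deriv, ← h.adm.integral_deriv X R,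
      ← intervalIntegral.integral_const_mul, ← intervalIntegral.integral_const_mul,
      ← intervalIntegral.integral_sub (hd.const_mul _)
      ((hd.continuousOn_mul (by fun_prop : Continuous fun x : ℝ => x - X).continuousOn).const_mul _)]
    congr 1; ext x; ring
  have e2 : ∫ x in X..R, (β - φ x) = (R - X) * β - ∫ x in X..R, φ x := by
    rw [intervalIntegral.integral_sub intervalIntegrable_const
      (h.adm.continuous.intervalIntegrable X R)]
    simp
  have e3 : ∫ x in X..R, Real.exp (-M - ε * (x - X)) =
      -Real.exp (-M - ε * (R - X)) / ε - -Real.exp (-M - ε * (X - X)) / ε := by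
    refine intervalIntegral.integral_eq_sub_of_hasDerivAt
      (f := fun x => -Real.exp (-M - ε * (x - X)) / ε) (fun x _ => ?_)
      (hexp.intervalIntegrable X R)
    have h1 : HasDerivAt (fun x : ℝ => -M - ε * (x - X)) (-ε) x := by
      simpa using (((hasDerivAt_id x).sub_const X).const_mul ε).const_sub (-M)
    refine (h1.exp.neg.div_const ε).congr_deriv ?_
    rw [mul_neg, neg_neg, mul_div_cancel_right₀ _ hε.ne']
  rw [e1, e2, e3, sub_self, mul_zero, sub_zero]
  have h1 := Real.exp_pos (-M - ε * (R - X))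
  have h2 : 0 ≤ Real.exp (-M - ε * (R - X)) / ε := by positivity
  have h3 := h.gap_nonneg R
  have h4 : 0 ≤ M * (β - φ R) := mul_nonneg hM h3
  have h5 : 0 ≤ ε * ((R - X) * (β - φ R)) :=
    mul_nonneg hε.le (mul_nonneg (sub_nonneg.2 hXR) h3)
  rw [neg_div, neg_div]
  nlinarith

lemma intervalIntegrable_sq (h : IsPair α β u φ) {ψ : ℝ → ℝ} (hψ : Continuous ψ) (a b : ℝ) :
    IntervalIntegrable (fun x => (u x - ψ x) ^ 2) volume a b := by
  have h1 := intervalIntegrable_of_mem h.measurable h.mem a b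
  have h2 : IntervalIntegrable (fun x => u x ^ 2) volume a b :=
    intervalIntegrable_of_mem (h.measurable.pow_const 2)
      (fun x => ⟨sq_nonneg _, pow_le_one₀ (h.mem x).1 (h.mem x).2⟩) a b
  have h3 := (h1.mul_continuousOn hψ.continuousOn).const_mul 2
  have h4 : IntervalIntegrable (fun x => ψ x ^ 2) volume a b :=
    (hψ.pow 2).intervalIntegrable a b
  have e : (fun x => (u x - ψ x) ^ 2) = fun x => u x ^ 2 - 2 * (u x * ψ x) + ψ x ^ 2 := by
    ext x; ring
  rw [e]
  exact (h2.sub h3).add h4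

/-- The basic lower bound on an interval. -/
lemma integral_exc_ge (h : IsPair α β u φ) {κ : ℝ}
    (hκ : ∀ y ∈ Icc α β, κ * (β - y) ≤ redDens y - redDens β) {X R M ε : ℝ} (hXR : X ≤ R)
    (hM : 0 ≤ M) (hε : 0 < ε) :
    (∫ x in X..R, (u x - Real.sigmoid (φ x)) ^ 2 / 2) + (κ - ε) * (∫ x in X..R, (β - φ x))
      - M * (β - φ X) - Real.exp (-M) / ε ≤ ∫ x in X..R, exc β u φ x := by
  have hσ : Continuous fun x => Real.sigmoid (φ x) :=
    continuous_sigmoid.comp h.adm.continuous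
  have i1 := (h.intervalIntegrable_sq hσ X R).div_const 2
  have i2 := (h.intervalIntegrable_gap X R).const_mul κ
  have i3 := intervalIntegrable_ent (measurable_deriv φ) h.adm.deriv_mem X R
  have hmono := intervalIntegral.integral_mono_on (μ := volume) hXR ((i1.add i2).add i3)
    (h.intervalIntegrable_exc X R) fun x _ => by
      have a1 := sq_le_relEnt (h.mem x) (φ x)
      have a2 := hκ _ (h.adm.mem_Icc x)
      simp only [exc]
      gcongr
  rw [intervalIntegral.integral_add (i1.add i2) i3, intervalIntegral.integral_add i1 i2,
    intervalIntegral.integral_const_mul] at hmono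
  have := h.integral_ent_deriv_ge hXR hM hε
  linarith

lemma sq_sub_le (h : IsPair α β u φ) (x : ℝ) :
    (Real.sigmoid β - Real.sigmoid (φ x)) ^ 2 ≤ β - φ x := by
  have h1 := sigmoid_sub_le (h.adm.le_far x)
  have h2 := Real.sigmoid_monotone (h.adm.le_far x)
  have h3 := Real.sigmoid_lt_one β
  have h4 := Real.sigmoid_pos (φ x)
  nlinarith

/-- Coercivity on bounded intervals, with constants independent of the interval. -/
lemma integral_exc_coercive (h : IsPair α β u φ) {κ : ℝ} (hκ0 : 0 < κ)
    (hκ : ∀ y ∈ Icc α β, κ * (β - y) ≤ redDens y - redDens β) {R : ℝ} (hR : 0 ≤ R) :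
    min (1 / 4) (κ / 6) *
      (∫ x in (0 : ℝ)..R, ((u x - Real.sigmoid β) ^ 2 + (β - φ x))) - 2 / κ ≤
      ∫ x in (0 : ℝ)..R, exc β u φ x := by
  have hσ : Continuous fun x => Real.sigmoid (φ x) :=
    continuous_sigmoid.comp h.adm.continuous
  have i1 := (h.intervalIntegrable_sq hσ 0 R).div_const 2
  have i2 := (h.intervalIntegrable_gap 0 R)
  have i3 := h.intervalIntegrable_sq (continuous_const (y := Real.sigmoid β)) 0 R
  have hmain := h.integral_exc_ge hκ hR le_rfl (half_pos hκ0)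
  have hmono := intervalIntegral.integral_mono_on (μ := volume) hR
    ((i3.add i2).const_mul (min (1 / 4) (κ / 6))) (i1.add (i2.const_mul (κ - κ / 2))) fun x _ => by
      have a1 := h.sq_sub_le x
      have a2 := h.gap_nonneg x
      have a3 : (u x - Real.sigmoid β) ^ 2 ≤ 2 * (u x - Real.sigmoid (φ x)) ^ 2 +
          2 * (Real.sigmoid β - Real.sigmoid (φ x)) ^ 2 := by
        nlinarith [sq_nonneg ((u x - Real.sigmoid (φ x)) + (Real.sigmoid β - Real.sigmoid (φ x)))]
      have k0 : 0 ≤ min (1 / 4) (κ / 6) := by positivity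
      have k1 := min_le_left (1 / 4) (κ / 6)
      have k2 := min_le_right (1 / 4) (κ / 6)
      calc min (1 / 4) (κ / 6) * ((u x - Real.sigmoid β) ^ 2 + (β - φ x))
          ≤ min (1 / 4) (κ / 6) * (2 * (u x - Real.sigmoid (φ x)) ^ 2 + 3 * (β - φ x)) := by
            refine mul_le_mul_of_nonneg_left ?_ k0; linarith
        _ = min (1 / 4) (κ / 6) * (2 * (u x - Real.sigmoid (φ x)) ^ 2) +
            min (1 / 4) (κ / 6) * (3 * (β - φ x)) := by ring
        _ ≤ 1 / 4 * (2 * (u x - Real.sigmoid (φ x)) ^ 2) + κ / 6 * (3 * (β - φ x)) := by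
            gcongr
        _ = (u x - Real.sigmoid (φ x)) ^ 2 / 2 + (κ - κ / 2) * (β - φ x) := by ring
  rw [intervalIntegral.integral_const_mul, intervalIntegral.integral_add i1
    (i2.const_mul _), intervalIntegral.integral_const_mul] at hmono
  simp only [neg_zero, Real.exp_zero, zero_mul, sub_zero] at hmain
  have : 1 / (κ / 2) = 2 / κ := by field_simp
  rw [this] at hmain
  linarith

/-- The pointwise upper bound. -/
lemma exc_le (h : IsPair α β u φ) (hαβ : -β < α) (x : ℝ) :
    exc β u φ x ≤ (2 / (Real.sigmoid β * (1 - Real.sigmoid β)) + 1) *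
      ((u x - Real.sigmoid β) ^ 2 + (β - φ x)) := by
  have hm : 0 < Real.sigmoid β * (1 - Real.sigmoid β) :=
    mul_pos (Real.sigmoid_pos β) (one_sub_sigmoid_pos β)
  have hmle : Real.sigmoid β * (1 - Real.sigmoid β) ≤
      Real.sigmoid (φ x) * (1 - Real.sigmoid (φ x)) := by
    rcases (h.adm.le_far x).eq_or_lt with heq | hlt
    · rw [heq]
    · exact (sigmoid_mul_lt (hαβ.trans_le (h.adm.near_le x)) hlt).le
  have a1 := relEnt_le (h.mem x) (φ x)
  have a2 := redDens_sub_le (h.adm.le_far x)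
  have a3 := ent_nonpos (h.adm.deriv_mem x)
  have a4 := h.sq_sub_le x
  have a5 := h.gap_nonneg x
  have a6 : (u x - Real.sigmoid (φ x)) ^ 2 ≤
      2 * ((u x - Real.sigmoid β) ^ 2 + (β - φ x)) := by
    nlinarith [sq_nonneg ((u x - Real.sigmoid β) - (Real.sigmoid β - Real.sigmoid (φ x)))]
  have a7 : (u x - Real.sigmoid (φ x)) ^ 2 /
      (Real.sigmoid (φ x) * (1 - Real.sigmoid (φ x))) ≤
      2 * ((u x - Real.sigmoid β) ^ 2 + (β - φ x)) / (Real.sigmoid β * (1 - Real.sigmoid β)) := by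
    gcongr
  have a8 : (2 / (Real.sigmoid β * (1 - Real.sigmoid β)) + 1) *
      ((u x - Real.sigmoid β) ^ 2 + (β - φ x)) =
      2 * ((u x - Real.sigmoid β) ^ 2 + (β - φ x)) / (Real.sigmoid β * (1 - Real.sigmoid β)) +
      ((u x - Real.sigmoid β) ^ 2 + (β - φ x)) := by ring
  rw [a8, exc]
  linarith [sq_nonneg (u x - Real.sigmoid β)]

lemma measurable_exc (h : IsPair α β u φ) : Measurable (exc β u φ) := by
  have h1 := h.measurable
  have h2 := h.adm.continuous.measurable
  have h3 := measurable_deriv φ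
  have h4 : Measurable fun x => relEnt (u x) (φ x) :=
    ((continuous_ent.measurable.comp h1).sub (h1.mul h2)).add
      (continuous_log_one_add_exp.measurable.comp h2)
  exact (h4.add ((continuous_redDens.measurable.comp h2).sub_const _)).add
    (continuous_ent.measurable.comp h3)

lemma integrable_ent_deriv (h : IsPair α β u φ) (hd : InDom β u φ) :
    Integrable (fun x => ent (deriv φ x)) halfVol := by
  rw [halfVol, ← restrict_Ioi_eq_restrict_Ici]
  refine integrableOn_Ioi_of_intervalIntegral_norm_bounded
    (1 + ∫ x, (β - φ x) ∂halfVol) 0 (b := id) (l := atTop) (fun R => ?_) tendsto_id ?_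
  · exact (intervalIntegrable_ent (measurable_deriv φ) h.adm.deriv_mem 0 R).1
  · filter_upwards [eventually_ge_atTop 0] with R hR
    have e1 : ∫ x in (0 : ℝ)..R, ‖ent (deriv φ x)‖ = -∫ x in (0 : ℝ)..R, ent (deriv φ x) := by
      rw [← intervalIntegral.integral_neg]
      congr 1; ext x
      exact abs_of_nonpos (ent_nonpos (h.adm.deriv_mem x))
    have e2 := h.integral_ent_deriv_ge (M := 0) (ε := 1) hR le_rfl one_pos
    have e3 : ∫ x in (0 : ℝ)..R, (β - φ x) ≤ ∫ x, (β - φ x) ∂halfVol := by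
      rw [intervalIntegral.integral_of_le hR]
      refine setIntegral_mono_set hd.2 (Eventually.of_forall h.gap_nonneg) ?_
      exact (Ioc_subset_Ioi_self.trans Ioi_subset_Ici_self).eventuallyLE
    simp only [id]
    rw [e1]
    simp only [neg_zero, Real.exp_zero, zero_mul, div_one, one_mul] at e2
    linarith

lemma integrable_exc (h : IsPair α β u φ) (hαβ : -β < α) (hd : InDom β u φ) :
    Integrable (exc β u φ) halfVol := by
  have hent := h.integrable_ent_deriv hd
  have hdom := (hd.1.add hd.2).const_mul (2 / (Real.sigmoid β * (1 - Real.sigmoid β)) + 1)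
  refine (hdom.add hent.norm).mono' h.measurable_exc.aestronglyMeasurable
    (Eventually.of_forall fun x => ?_)
  have a1 := h.exc_le hαβ x
  have a2 := relEnt_nonneg (h.mem x) (φ x)
  have a3 : 0 ≤ redDens (φ x) - redDens β := by
    rcases (h.adm.le_far x).eq_or_lt with heq | hlt
    · rw [heq, sub_self]
    · exact sub_nonneg.2 (redDens_lt (hαβ.trans_le (h.adm.near_le x)) hlt).le
  have a4 := neg_abs_le (ent (deriv φ x))
  have a5 := abs_nonneg (ent (deriv φ x))
  have hm : 0 < Real.sigmoid β * (1 - Real.sigmoid β) :=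
    mul_pos (Real.sigmoid_pos β) (one_sub_sigmoid_pos β)
  have a6 := h.gap_nonneg x
  have a7 : 0 ≤ (2 / (Real.sigmoid β * (1 - Real.sigmoid β)) + 1) *
      ((u x - Real.sigmoid β) ^ 2 + (β - φ x)) := by positivity
  simp only [Pi.add_apply, Real.norm_eq_abs]
  rw [abs_le]
  refine ⟨?_, by linarith⟩
  unfold exc
  linarith

lemma tendsto_integral_exc (h : IsPair α β u φ) (hαβ : -β < α) (hd : InDom β u φ) :
    Tendsto (fun R => ∫ x in (0 : ℝ)..R, exc β u φ x) atTop (𝓝 (∫ x, exc β u φ x ∂halfVol)) := by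
  have hi := h.integrable_exc hαβ hd
  rw [halfVol, ← restrict_Ioi_eq_restrict_Ici] at hi ⊢
  exact intervalIntegral_tendsto_integral_Ioi 0 hi tendsto_id

/-- The energy beyond `X` is at least a quantity that is small when `φ X` is close to its limit. -/
lemma tail_ge (h : IsPair α β u φ) {κ : ℝ} (hκ0 : 0 < κ)
    (hκ : ∀ y ∈ Icc α β, κ * (β - y) ≤ redDens y - redDens β) (hαβ : -β < α) (hd : InDom β u φ)
    {M : ℝ} (hM : 0 ≤ M) (X : ℝ) :
    (∫ x in (0 : ℝ)..X, exc β u φ x) - M * (β - φ X) - Real.exp (-M) / κ ≤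
      ∫ x, exc β u φ x ∂halfVol := by
  refine ge_of_tendsto (h.tendsto_integral_exc hαβ hd) ?_
  filter_upwards [eventually_ge_atTop X] with R hR
  have h1 := h.integral_exc_ge hκ hR hM hκ0
  have h2 : 0 ≤ ∫ x in X..R, (u x - Real.sigmoid (φ x)) ^ 2 / 2 :=
    intervalIntegral.integral_nonneg hR fun x _ => by positivity
  have h3 := intervalIntegral.integral_add_adjacent_intervals (h.intervalIntegrable_exc 0 X)
    (h.intervalIntegrable_exc X R)
  rw [sub_self, zero_mul, add_zero] at h1
  linarith

/-- A pair whose energy on bounded intervals does not tend to infinity belongs to `𝒟⁺`. -/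
lemma inDom_of_frequently_le (h : IsPair α β u φ) {κ : ℝ} (hκ0 : 0 < κ)
    (hκ : ∀ y ∈ Icc α β, κ * (β - y) ≤ redDens y - redDens β) {C : ℝ}
    (hC : ∃ᶠ R in atTop, ∫ x in (0 : ℝ)..R, exc β u φ x ≤ C) : InDom β u φ := by
  set k := min (1 / 4) (κ / 6) with hk
  have hk0 : 0 < k := by positivity
  have i2 := h.intervalIntegrable_gap
  have i3 := h.intervalIntegrable_sq (continuous_const (y := Real.sigmoid β))
  have hnn : ∀ x, 0 ≤ (u x - Real.sigmoid β) ^ 2 + (β - φ x) := fun x =>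
    add_nonneg (sq_nonneg _) (h.gap_nonneg x)
  have hbd : ∀ R, 0 ≤ R →
      ∫ x in (0 : ℝ)..R, ((u x - Real.sigmoid β) ^ 2 + (β - φ x)) ≤ (C + 2 / κ) / k := by
    intro R hR
    obtain ⟨S, hS, hRS⟩ := (hC.and_eventually (eventually_ge_atTop R)).exists
    have h1 := h.integral_exc_coercive hκ0 hκ (hR.trans hRS)
    have h2 : ∫ x in (0 : ℝ)..R, ((u x - Real.sigmoid β) ^ 2 + (β - φ x)) ≤
        ∫ x in (0 : ℝ)..S, ((u x - Real.sigmoid β) ^ 2 + (β - φ x)) :=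
      intervalIntegral.integral_mono_interval le_rfl hR hRS (Eventually.of_forall hnn)
        ((i3 0 S).add (i2 0 S))
    refine h2.trans ?_
    rw [le_div_iff₀ hk0]
    linarith
  have hint : Integrable (fun x => (u x - Real.sigmoid β) ^ 2 + (β - φ x)) halfVol := by
    rw [halfVol, ← restrict_Ioi_eq_restrict_Ici]
    refine integrableOn_Ioi_of_intervalIntegral_norm_bounded
      ((C + 2 / κ) / k) 0 (b := id) (l := atTop) (fun R => ?_) tendsto_id ?_
    · exact ((i3 0 R).add (i2 0 R)).1
    · filter_upwards [eventually_ge_atTop 0] with R hR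
      simp only [id, Real.norm_eq_abs, abs_of_nonneg (hnn _)]
      exact hbd R hR
  refine ⟨hint.mono' ?_ (Eventually.of_forall fun x => ?_),
    hint.mono' ?_ (Eventually.of_forall fun x => ?_)⟩
  · exact ((h.measurable.sub_const _).pow_const 2).aestronglyMeasurable
  · rw [Real.norm_eq_abs, abs_of_nonneg (sq_nonneg _)]
    linarith [h.gap_nonneg x]
  · exact (continuous_const.sub h.adm.continuous).aestronglyMeasurable
  · rw [Real.norm_eq_abs, abs_of_nonneg (h.gap_nonneg x)]
    linarith [sq_nonneg (u x - Real.sigmoid β)]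

lemma integral_exc_le (h : IsPair α β u φ) (hαβ : -β < α) (hd : InDom β u φ) :
    ∫ x, exc β u φ x ∂halfVol ≤ (2 / (Real.sigmoid β * (1 - Real.sigmoid β)) + 1) *
      ((∫ x, (u x - Real.sigmoid β) ^ 2 ∂halfVol) + ∫ x, (β - φ x) ∂halfVol) := by
  rw [← integral_add hd.1 hd.2, ← integral_const_mul]
  exact integral_mono (h.integrable_exc hαβ hd) ((hd.1.add hd.2).const_mul _) (h.exc_le hαβ)

lemma le_integral_exc (h : IsPair α β u φ) {κ : ℝ} (hκ0 : 0 < κ)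
    (hκ : ∀ y ∈ Icc α β, κ * (β - y) ≤ redDens y - redDens β) (hαβ : -β < α) (hd : InDom β u φ) :
    min (1 / 4) (κ / 6) *
      ((∫ x, (u x - Real.sigmoid β) ^ 2 ∂halfVol) + ∫ x, (β - φ x) ∂halfVol) - 2 / κ ≤
      ∫ x, exc β u φ x ∂halfVol := by
  have h1 : Tendsto (fun R => ∫ x in (0 : ℝ)..R, ((u x - Real.sigmoid β) ^ 2 + (β - φ x))) atTop
      (𝓝 (∫ x, ((u x - Real.sigmoid β) ^ 2 + (β - φ x)) ∂halfVol)) := by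
    have hi := hd.1.add hd.2
    rw [halfVol, ← restrict_Ioi_eq_restrict_Ici] at hi ⊢
    exact intervalIntegral_tendsto_integral_Ioi 0 hi tendsto_id
  rw [← integral_add hd.1 hd.2]
  refine le_of_tendsto_of_tendsto ((h1.const_mul _).sub_const _)
    (h.tendsto_integral_exc hαβ hd) ?_
  filter_upwards [eventually_ge_atTop 0] with R hR
  exact h.integral_exc_coercive hκ0 hκ hR

end IsPair

/-! ### Calibration by the field of stationary slopes -/

/-- The slope `φ'` of the stationary solution with flux `J`, as a function of the value of `φ`. -/
def speed (J y : ℝ) : ℝ := 1 - J / (Real.sigmoid y * (1 - Real.sigmoid y))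

lemma sigmoid_var_pos (y : ℝ) : 0 < Real.sigmoid y * (1 - Real.sigmoid y) :=
  mul_pos (Real.sigmoid_pos y) (one_sub_sigmoid_pos y)

@[fun_prop]
lemma continuous_speed (J : ℝ) : Continuous (speed J) := by
  unfold speed
  have : Continuous Real.sigmoid := continuous_sigmoid
  exact continuous_const.sub (continuous_const.div (by fun_prop) fun y => (sigmoid_var_pos y).ne')

lemma speed_lt_one {J : ℝ} (hJ : 0 < J) (y : ℝ) : speed J y < 1 := by
  have := div_pos hJ (sigmoid_var_pos y)
  unfold speed; linarith

lemma speed_pos_iff {J y : ℝ} : 0 < speed J y ↔ J < Real.sigmoid y * (1 - Real.sigmoid y) := by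
  rw [speed, sub_pos, div_lt_one (sigmoid_var_pos y)]

lemma sigmoid_pot_speed {J y : ℝ} (hJ : 0 < J) (h : 0 < speed J y) :
    Real.sigmoid (pot (speed J y)) = speed J y := sigmoid_pot h (speed_lt_one hJ y)

/-- With the multiplier `pot (speed J y)` the Legendre gap of the entropy accounts exactly for the
reduced density. -/
lemma ent_add_redDens {J y : ℝ} (hJ : 0 < J) (h : 0 < speed J y) (p : ℝ) :
    ent p + redDens y = relEnt p (pot (speed J y)) + p * pot (speed J y) + Real.log J := by
  have h1 : Real.log (1 + Real.exp (pot (speed J y))) = redDens y - Real.log J := by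
    have h2 := log_one_sub_sigmoid (pot (speed J y))
    rw [sigmoid_pot_speed hJ h, speed, sub_sub_cancel, ← exp_redDens,
      Real.log_div hJ.ne' (Real.exp_pos _).ne', Real.log_exp] at h2
    rw [speed, ← exp_redDens]
    linarith
  rw [ent_eq_relEnt p (pot (speed J y)), h1]
  ring

/-- The nonnegative part of the energy density that remains after calibration: it vanishes exactly
where `u` and `φ'` have the stationary values. -/
def defect (J : ℝ) (u φ : ℝ → ℝ) (x : ℝ) : ℝ :=
  relEnt (u x) (φ x) + relEnt (deriv φ x) (pot (speed J (φ x)))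

lemma continuousOn_pot_speed {J : ℝ} (hJ : 0 < J) {s : Set ℝ} (hs : ∀ y ∈ s, 0 < speed J y) :
    ContinuousOn (fun y => pot (speed J y)) s := by
  unfold pot
  refine ContinuousOn.log (ContinuousOn.div (by fun_prop) (by fun_prop) fun y hy => ?_)
    fun y hy => ?_
  · linarith [speed_lt_one hJ y]
  · exact (div_pos (hs y hy) (by linarith [speed_lt_one hJ y])).ne'

namespace IsPair

variable {α β J : ℝ} {u φ : ℝ → ℝ}

lemma defect_nonneg (h : IsPair α β u φ) (x : ℝ) : 0 ≤ defect J u φ x :=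
  add_nonneg (relEnt_nonneg (h.mem x) _) (relEnt_nonneg (h.adm.deriv_mem x) _)

lemma mem_Icc_of_mem (h : IsPair α β u φ) {X x : ℝ} (hx : x ≤ X) :
    φ x ∈ Icc α (φ X) := ⟨h.adm.near_le x, h.adm.mono hx⟩

/-- A continuous multiplier on the whole line that agrees with `pot ∘ speed J` on `[α, φ X]`. -/
lemma exists_continuous_multiplier (h : IsPair α β u φ) (hJ : 0 < J) {X : ℝ}
    (hs : ∀ y ∈ Icc α (φ X), 0 < speed J y) :
    ∃ Λ : ℝ → ℝ, Continuous Λ ∧ ∀ y ∈ Icc α (φ X), Λ y = pot (speed J y) := by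
  have hle : α ≤ φ X := h.adm.near_le X
  refine ⟨IccExtend hle ((Icc α (φ X)).domRestrict fun y => pot (speed J y)), ?_, fun y hy => ?_⟩
  · exact (continuousOn_iff_continuous_domRestrict.1 (continuousOn_pot_speed hJ hs)).Icc_extend'
  · rw [IccExtend_of_mem _ _ hy]; rfl

lemma intervalIntegrable_defect (h : IsPair α β u φ) (hJ : 0 < J) {X : ℝ} (hX : 0 ≤ X)
    (hs : ∀ y ∈ Icc α (φ X), 0 < speed J y) :
    IntervalIntegrable (defect J u φ) volume 0 X := by
  obtain ⟨Λ, hΛ, hΛe⟩ := h.exists_continuous_multiplier hJ hs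
  have hi := (intervalIntegrable_relEnt h.measurable h.mem h.adm.continuous 0 X).add
    (intervalIntegrable_relEnt (measurable_deriv φ) h.adm.deriv_mem
      (hΛ.comp h.adm.continuous) 0 X)
  refine hi.congr fun x hx => ?_
  rw [uIoc_of_le hX] at hx
  simp only [defect, Function.comp, hΛe _ (h.mem_Icc_of_mem hx.2)]

/-- The energy of a pair on `[0, X]` in terms of the defect. -/
lemma integral_exc_eq (h : IsPair α β u φ) (hJ : 0 < J) {X : ℝ} (hX : 0 ≤ X)
    (hs : ∀ y ∈ Icc α (φ X), 0 < speed J y) :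
    ∫ x in (0 : ℝ)..X, exc β u φ x = (∫ x in (0 : ℝ)..X, defect J u φ x) +
      (∫ y in α..φ X, pot (speed J y)) + (Real.log J - redDens β) * X := by
  obtain ⟨Λ, hΛ, hΛe⟩ := h.exists_continuous_multiplier hJ hs
  have hd := (h.adm.absolutelyContinuous 0 X).intervalIntegrable_deriv
  have hΛφ : Continuous fun x => Λ (φ x) := hΛ.comp h.adm.continuous
  have i1 := h.intervalIntegrable_defect hJ hX hs
  have i2 := hd.continuousOn_mul hΛφ.continuousOn
  have hφ0 : φ 0 = α := h.adm.left 0 le_rfl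
  have e1 : ∫ x in (0 : ℝ)..X, exc β u φ x =
      ∫ x in (0 : ℝ)..X, (defect J u φ x + Λ (φ x) * deriv φ x + (Real.log J - redDens β)) := by
    refine intervalIntegral.integral_congr fun x hx => ?_
    rw [uIcc_of_le hX] at hx
    have hy := h.mem_Icc_of_mem hx.2
    have := ent_add_redDens hJ (hs _ hy) (deriv φ x)
    simp only [exc, defect, hΛe _ hy]
    linarith
  have e2 : ∫ y in α..φ X, Λ y = ∫ y in α..φ X, pot (speed J y) := by
    refine intervalIntegral.integral_congr fun y hy => ?_
    rw [uIcc_of_le (h.adm.near_le X)] at hy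
    exact hΛe y hy
  rw [e1, intervalIntegral.integral_add (i1.add i2) intervalIntegrable_const,
    intervalIntegral.integral_add i1 i2, h.adm.integral_comp_mul_deriv hΛ, hφ0, e2]
  simp only [intervalIntegral.integral_const, sub_zero, smul_eq_mul]
  ring

/-- A pair without defect on `[0, X]` satisfies the stationary equations there. -/
lemma ae_eq_of_integral_defect_le (h : IsPair α β u φ) (hJ : 0 < J) {X : ℝ} (hX : 0 ≤ X)
    (hs : ∀ y ∈ Icc α (φ X), 0 < speed J y) (h0 : ∫ x in (0 : ℝ)..X, defect J u φ x ≤ 0) :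
    ∀ᵐ x, x ∈ Ioc 0 X → u x = Real.sigmoid (φ x) ∧ deriv φ x = speed J (φ x) := by
  have hz : ∫ x in (0 : ℝ)..X, defect J u φ x = 0 :=
    le_antisymm h0 (intervalIntegral.integral_nonneg hX fun x _ => h.defect_nonneg x)
  rw [intervalIntegral.integral_eq_zero_iff_of_le_of_nonneg_ae hX
    (Eventually.of_forall h.defect_nonneg) (h.intervalIntegrable_defect hJ hX hs)] at hz
  have := (ae_restrict_iff' measurableSet_Ioc).1 hz
  filter_upwards [this] with x hx hxX
  have h1 : defect J u φ x = 0 := hx hxX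
  have a1 := relEnt_nonneg (h.mem x) (φ x)
  have a2 := relEnt_nonneg (h.adm.deriv_mem x) (pot (speed J (φ x)))
  unfold defect at h1
  refine ⟨eq_sigmoid_of_relEnt_le (h.mem x) (by linarith), ?_⟩
  rw [eq_sigmoid_of_relEnt_le (h.adm.deriv_mem x)
    (by linarith : relEnt (deriv φ x) (pot (speed J (φ x))) ≤ 0),
    sigmoid_pot_speed hJ (hs _ (h.mem_Icc_of_mem hxX.2))]

/-- A pair that satisfies the stationary equations has no defect. -/
lemma integral_defect_eq_zero (h : IsPair α β u φ) (hJ : 0 < J) {X : ℝ} (hX : 0 ≤ X)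
    (hs : ∀ y ∈ Icc α (φ X), 0 < speed J y)
    (hst : ∀ᵐ x, x ∈ Ioc 0 X → u x = Real.sigmoid (φ x) ∧ deriv φ x = speed J (φ x)) :
    ∫ x in (0 : ℝ)..X, defect J u φ x = 0 := by
  rw [intervalIntegral.integral_zero_ae]
  filter_upwards [hst] with x hx hxX
  rw [uIoc_of_le hX] at hxX
  obtain ⟨h1, h2⟩ := hx hxX
  have h3 := sigmoid_pot_speed hJ (hs _ (h.mem_Icc_of_mem hxX.2))
  have h4 := relEnt_sigmoid (pot (speed J (φ x)))
  rw [h3] at h4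
  rw [defect, h1, relEnt_sigmoid, h2, h4, add_zero]

end IsPair

/-! ### The stationary equation -/

/-- Integration of a scalar linear equation with zero initial value: the solution can return to zero
only if the inhomogeneity vanishes, and then it is zero throughout. -/
lemma linear_ode {w a : ℝ → ℝ} {c X : ℝ} (hX : 0 < X) (hw : ContinuousOn w (Icc 0 X))
    (ha : ContinuousOn a (Icc 0 X)) (hd : ∀ x ∈ Ioo 0 X, HasDerivAt w (a x * w x + c) x)
    (h0 : w 0 = 0) : (w X = 0 → c = 0) ∧ (c = 0 → ∀ x ∈ Icc 0 X, w x = 0) := by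
  set a' : ℝ → ℝ := IccExtend hX.le ((Icc 0 X).domRestrict a) with ha'
  have hac : Continuous a' := (continuousOn_iff_continuous_domRestrict.1 ha).Icc_extend'
  have hae : ∀ x ∈ Icc 0 X, a' x = a x := fun x hx => by
    rw [ha', IccExtend_of_mem _ _ hx]; rfl
  set E : ℝ → ℝ := fun x => Real.exp (-∫ t in (0 : ℝ)..x, a' t) with hE
  have hEd : ∀ x, HasDerivAt E (E x * -a' x) x := fun x =>
    (intervalIntegral.integral_hasDerivAt_right (hac.intervalIntegrable _ _)
      (hac.stronglyMeasurableAtFilter _ _) hac.continuousAt).neg.exp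
  have hEc : Continuous E := continuous_iff_continuousAt.2 fun x => (hEd x).continuousAt
  have hEp : ∀ x, 0 < E x := fun x => Real.exp_pos _
  have hfc : ContinuousOn (fun x => w x * E x) (Icc 0 X) := hw.mul hEc.continuousOn
  have hfd : ∀ x ∈ Ioo 0 X, HasDerivAt (fun x => w x * E x) (c * E x) x := by
    intro x hx
    refine ((hd x hx).mul (hEd x)).congr_deriv ?_
    rw [hae x (Ioo_subset_Icc_self hx)]
    ring
  constructor
  · intro hwX
    obtain ⟨x, -, hx⟩ := exists_hasDerivAt_eq_zero hX hfc (by simp [h0, hwX]) hfd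
    exact (mul_eq_zero.1 hx).resolve_right (hEp x).ne'
  · intro hc x hx
    rcases hx.1.eq_or_lt with rfl | hx0
    · exact h0
    obtain ⟨y, -, hy⟩ := exists_hasDerivAt_eq_slope (fun x => w x * E x) (fun x => c * E x) hx0
      (hfc.mono (Icc_subset_Icc_right hx.2)) fun y hy => hfd y (Ioo_subset_Ioo_right hx.2 hy)
    rw [hc, zero_mul, h0, zero_mul, sub_zero, sub_zero, eq_comm, div_eq_zero_iff] at hy
    exact (mul_eq_zero.1 (hy.resolve_right hx0.ne')).resolve_right (hEp x).ne'

/-- Two solutions of `v' = v (1 - v) - J` with the same initial value: their values at a later time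
agree only if the fluxes do, and then the solutions agree. -/
lemma riccati_unique {v₁ v₂ : ℝ → ℝ} {J₁ J₂ X : ℝ} (hX : 0 < X) (h₁ : ContinuousOn v₁ (Icc 0 X))
    (h₂ : ContinuousOn v₂ (Icc 0 X))
    (hd₁ : ∀ x ∈ Ioo 0 X, HasDerivAt v₁ (v₁ x * (1 - v₁ x) - J₁) x)
    (hd₂ : ∀ x ∈ Ioo 0 X, HasDerivAt v₂ (v₂ x * (1 - v₂ x) - J₂) x) (h0 : v₁ 0 = v₂ 0) :
    (v₁ X = v₂ X → J₁ = J₂) ∧ (J₁ = J₂ → ∀ x ∈ Icc 0 X, v₁ x = v₂ x) := by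
  have := linear_ode (w := fun x => v₁ x - v₂ x) (a := fun x => 1 - v₁ x - v₂ x) (c := J₂ - J₁)
    hX (h₁.sub h₂) ((continuousOn_const.sub h₁).sub h₂)
    (fun x hx => ((hd₁ x hx).sub (hd₂ x hx)).congr_deriv (by ring)) (by simp [h0])
  refine ⟨fun h => ?_, fun h x hx => ?_⟩
  · linarith [this.1 (by simp [h])]
  · linarith [this.2 (by linarith) x hx]

/-- The density of a profile that has the stationary slope almost everywhere solves the Riccati
equation in the classical sense. -/
lemma IsAdm.hasDerivAt_sigmoid_comp {α β J X : ℝ} {φ : ℝ → ℝ} (h : IsAdm α β φ)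
    (hd : ∀ᵐ x, x ∈ Ioc 0 X → deriv φ x = speed J (φ x)) {x : ℝ} (hx : x ∈ Ioo 0 X) :
    HasDerivAt (fun x => Real.sigmoid (φ x))
      (Real.sigmoid (φ x) * (1 - Real.sigmoid (φ x)) - J) x := by
  have hc : Continuous fun x => speed J (φ x) := (continuous_speed J).comp h.continuous
  have hI : HasDerivAt (fun x => α + ∫ t in (0 : ℝ)..x, speed J (φ t)) (speed J (φ x)) x :=
    (intervalIntegral.integral_hasDerivAt_right (hc.intervalIntegrable _ _)
      (hc.stronglyMeasurableAtFilter _ _) hc.continuousAt).const_add α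
  have heq : φ =ᶠ[𝓝 x] fun x => α + ∫ t in (0 : ℝ)..x, speed J (φ t) := by
    filter_upwards [Ioo_mem_nhds hx.1 hx.2] with y hy
    have h1 : ∫ t in (0 : ℝ)..y, speed J (φ t) = ∫ t in (0 : ℝ)..y, deriv φ t := by
      refine intervalIntegral.integral_congr_ae ?_
      filter_upwards [hd] with t ht hty
      rw [uIoc_of_le hy.1.le] at hty
      exact (ht ⟨hty.1, hty.2.trans hy.2.le⟩).symm
    rw [h1, h.integral_deriv, h.left 0 le_rfl]
    ring
  refine ((Real.hasDerivAt_sigmoid (φ x)).comp x (hI.congr_of_eventuallyEq heq)).congr_deriv ?_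
  have := (sigmoid_var_pos (φ x)).ne'
  rw [speed, mul_sub, mul_one, mul_div_cancel₀ _ this]

/-! ### Stationary profiles -/

lemma tanh_eq_sigmoid (z : ℝ) : Real.tanh z = 2 * Real.sigmoid (2 * z) - 1 := by
  rw [Real.tanh_eq, sigmoid_eq, two_mul z, Real.exp_add, Real.exp_neg]
  have := Real.exp_pos z
  field_simp
  ring

lemma hasDerivAt_tanh (z : ℝ) : HasDerivAt Real.tanh (1 - Real.tanh z ^ 2) z := by
  have h : Real.tanh = fun z => 2 * Real.sigmoid (2 * z) - 1 := funext tanh_eq_sigmoid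
  have h2 : HasDerivAt (fun z : ℝ => 2 * z) 2 z := by simpa using (hasDerivAt_id z).const_mul 2
  have h3 := (((Real.hasDerivAt_sigmoid (2 * z)).comp z h2).const_mul 2).sub_const 1
  rw [tanh_eq_sigmoid]
  rw [h]
  refine h3.congr_deriv ?_
  ring

lemma continuous_tanh : Continuous Real.tanh :=
  continuous_iff_continuousAt.2 fun z => (hasDerivAt_tanh z).continuousAt

lemma strictMono_tanh : StrictMono Real.tanh := by
  intro x y hxy
  rw [tanh_eq_sigmoid, tanh_eq_sigmoid]
  linarith [Real.sigmoid_strictMono (by linarith : 2 * x < 2 * y)]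

lemma abs_tanh_lt_one (z : ℝ) : |Real.tanh z| < 1 :=
  abs_lt.2 ⟨Real.neg_one_lt_tanh z, Real.tanh_lt_one z⟩

lemma tendsto_tanh_atTop : Tendsto Real.tanh atTop (𝓝 1) := by
  have h : Real.tanh = fun z => 2 * Real.sigmoid (2 * z) - 1 := funext tanh_eq_sigmoid
  rw [h]
  have := ((Real.tendsto_sigmoid_atTop.comp
    (tendsto_id.const_mul_atTop (two_pos : (0 : ℝ) < 2))).const_mul 2).sub_const 1
  norm_num at this
  exact this

lemma artanh_neg_eq {x : ℝ} (hx : x ∈ Ioo (-1 : ℝ) 1) : Real.artanh (-x) = -Real.artanh x := by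
  apply Real.tanh_injective
  rw [Real.tanh_neg, Real.tanh_artanh hx, Real.tanh_artanh ⟨by linarith [hx.2], by linarith [hx.1]⟩]

/-- The solution of `v' = v (1 - v) - (1 / 4 - A ^ 2)` with `v 0 = a`, for `|a - 1 / 2| < A`. -/
def wave (A a x : ℝ) : ℝ := 1 / 2 + A * Real.tanh (A * x + Real.artanh ((a - 1 / 2) / A))

/-- The chemical potential of `wave`. -/
def wavePot (A a x : ℝ) : ℝ := pot (wave A a x)

section Wave

variable {A a : ℝ}

lemma div_mem_Ioo (ha : |a - 1 / 2| < A) : (a - 1 / 2) / A ∈ Ioo (-1 : ℝ) 1 := by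
  have hA : 0 < A := (abs_nonneg _).trans_lt ha
  rw [abs_lt] at ha
  constructor
  · rw [lt_div_iff₀ hA]; linarith
  · rw [div_lt_one hA]; linarith

lemma wave_zero (ha : |a - 1 / 2| < A) : wave A a 0 = a := by
  have hA : 0 < A := (abs_nonneg _).trans_lt ha
  rw [wave, mul_zero, zero_add, Real.tanh_artanh (div_mem_Ioo ha), mul_div_cancel₀ _ hA.ne']
  ring

lemma hasDerivAt_wave (x : ℝ) :
    HasDerivAt (wave A a) (wave A a x * (1 - wave A a x) - (1 / 4 - A ^ 2)) x := by
  have h1 : HasDerivAt (fun x : ℝ => A * x + Real.artanh ((a - 1 / 2) / A)) A x := by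
    simpa using ((hasDerivAt_id x).const_mul A).add_const (Real.artanh ((a - 1 / 2) / A))
  have h2 := (((hasDerivAt_tanh _).comp x h1).const_mul A).const_add (1 / 2)
  refine h2.congr_deriv ?_
  rw [wave]
  ring

lemma continuous_wave : Continuous (wave A a) :=
  continuous_iff_continuousAt.2 fun z => (hasDerivAt_wave z).continuousAt

lemma abs_wave_sub_lt (hA : 0 < A) (x : ℝ) : |wave A a x - 1 / 2| < A := by
  rw [wave, add_sub_cancel_left, abs_mul, abs_of_pos hA]
  exact mul_lt_of_lt_one_right hA (abs_tanh_lt_one _)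

lemma wave_pos (hA : 0 < A) (hA2 : A ≤ 1 / 2) (x : ℝ) : 0 < wave A a x := by
  linarith [(abs_lt.1 (abs_wave_sub_lt (a := a) hA x)).1]

lemma wave_lt_one (hA : 0 < A) (hA2 : A ≤ 1 / 2) (x : ℝ) : wave A a x < 1 := by
  linarith [(abs_lt.1 (abs_wave_sub_lt (a := a) hA x)).2]

lemma strictMono_wave (hA : 0 < A) : StrictMono (wave A a) := by
  intro x y hxy
  have := strictMono_tanh (by nlinarith : A * x + Real.artanh ((a - 1 / 2) / A) <
    A * y + Real.artanh ((a - 1 / 2) / A))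
  unfold wave
  nlinarith

lemma tendsto_wave (hA : 0 < A) : Tendsto (wave A a) atTop (𝓝 (1 / 2 + A)) := by
  have h1 : Tendsto (fun x : ℝ => A * x + Real.artanh ((a - 1 / 2) / A)) atTop atTop :=
    tendsto_atTop_add_const_right _ _ (tendsto_id.const_mul_atTop hA)
  have h2 := ((tendsto_tanh_atTop.comp h1).const_mul A).const_add (1 / 2)
  rwa [mul_one] at h2

lemma sigmoid_wavePot (hA : 0 < A) (hA2 : A ≤ 1 / 2) (x : ℝ) :
    Real.sigmoid (wavePot A a x) = wave A a x :=
  sigmoid_pot (wave_pos hA hA2 x) (wave_lt_one hA hA2 x)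

lemma hasDerivAt_pot {v : ℝ} (h0 : 0 < v) (h1 : v < 1) : HasDerivAt pot (1 / (v * (1 - v))) v := by
  have h2 : 0 < 1 - v := by linarith
  have hd : HasDerivAt (fun v : ℝ => v / (1 - v)) ((1 * (1 - v) - v * (-1)) / (1 - v) ^ 2) v :=
    (hasDerivAt_id v).div ((hasDerivAt_id v).const_sub 1) h2.ne'
  refine (hd.log (div_pos h0 h2).ne').congr_deriv ?_
  field_simp
  ring

lemma hasDerivAt_wavePot (hA : 0 < A) (hA2 : A ≤ 1 / 2) (x : ℝ) :
    HasDerivAt (wavePot A a) (speed (1 / 4 - A ^ 2) (wavePot A a x)) x := by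
  have h0 := wave_pos (a := a) hA hA2 x
  have h1 := wave_lt_one (a := a) hA hA2 x
  refine ((hasDerivAt_pot h0 h1).comp x (hasDerivAt_wave x)).congr_deriv ?_
  have h2 : 0 < 1 - wave A a x := by linarith
  rw [speed, sigmoid_wavePot hA hA2]
  field_simp

lemma speed_wavePot_mem (hA : 0 < A) (hA2 : A ≤ 1 / 2) (x : ℝ) :
    speed (1 / 4 - A ^ 2) (wavePot A a x) ∈ Icc (0 : ℝ) 1 := by
  have h3 := abs_lt.1 (abs_wave_sub_lt (a := a) hA x)
  constructor
  · refine (speed_pos_iff.2 ?_).le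
    rw [sigmoid_wavePot hA hA2]
    nlinarith
  · have : 0 ≤ (1 / 4 - A ^ 2) / (Real.sigmoid (wavePot A a x) *
        (1 - Real.sigmoid (wavePot A a x))) :=
      div_nonneg (by nlinarith) (sigmoid_var_pos _).le
    unfold speed; linarith

lemma monoLip_wavePot (hA : 0 < A) (hA2 : A ≤ 1 / 2) : MonoLip (wavePot A a) := by
  have hd := hasDerivAt_wavePot (a := a) hA hA2
  have hs := speed_wavePot_mem (a := a) hA hA2
  refine ⟨monotone_of_deriv_nonneg (fun x => (hd x).differentiableAt) fun x => ?_,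
    fun x y hxy => ?_⟩
  · rw [(hd x).deriv]; exact (hs x).1
  · have : Monotone fun x => x - wavePot A a x := by
      refine monotone_of_deriv_nonneg
        (fun x => ((hasDerivAt_id x).sub (hd x)).differentiableAt) fun x => ?_
      have h1 := ((hasDerivAt_id x).sub (hd x)).deriv
      have h2 : (id - wavePot A a) = fun x => x - wavePot A a x := rfl
      rw [h2] at h1
      rw [h1]
      linarith [(hs x).2]
    have := this hxy
    simp only at this
    linarith

end Wave

lemma MonoLip.comp {f g : ℝ → ℝ} (hf : MonoLip f) (hg : MonoLip g) :
    MonoLip fun x => f (g x) :=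
  ⟨hf.mono.comp hg.mono, fun _ _ hxy =>
    (hf.sub_le _ _ (hg.mono hxy)).trans (hg.sub_le _ _ hxy)⟩

lemma monoLip_id : MonoLip fun x => x := ⟨fun _ _ h => h, fun _ _ _ => le_rfl⟩

lemma monoLip_const (c : ℝ) : MonoLip fun _ => c :=
  ⟨fun _ _ _ => le_rfl, fun _ _ h => by linarith⟩

lemma monoLip_min_const (c : ℝ) : MonoLip fun x => min x c := by
  refine ⟨fun _ _ hxy => min_le_min_right c hxy, fun x y hxy => ?_⟩
  rcases le_total x c with h | h
  · rw [min_eq_left h]; linarith [min_le_left y c]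
  · rw [min_eq_right h]; linarith [min_le_right y c]

section Pairs

variable {A a b : ℝ}

/-- The standing assumptions on the boundary data for the half-line `[0, ∞)`. -/
structure Data (a b : ℝ) : Prop where
  pos : 0 < a
  lt : a < b
  lt_one : b < 1
  one_lt : 1 < a + b

namespace Data

lemma abs_sub_lt (h : Data a b) : |a - 1 / 2| < b - 1 / 2 := by
  rw [abs_lt]; constructor <;> linarith [h.lt, h.one_lt]

lemma half_lt (h : Data a b) : 0 < b - 1 / 2 := (abs_nonneg _).trans_lt h.abs_sub_lt

lemma far_pos (h : Data a b) : 0 < b := h.pos.trans h.lt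

lemma near_lt_one (h : Data a b) : a < 1 := h.lt.trans h.lt_one

lemma pot_lt (h : Data a b) : pot a < pot b := pot_lt_pot h.pos h.lt h.lt_one

lemma neg_pot_lt (h : Data a b) : -pot b < pot a := by
  rw [← pot_one_sub]
  exact pot_lt_pot (by linarith [h.lt_one]) (by linarith [h.one_lt]) h.near_lt_one

lemma sigmoid_far (h : Data a b) : Real.sigmoid (pot b) = b := sigmoid_pot h.far_pos h.lt_one

lemma sigmoid_near (h : Data a b) : Real.sigmoid (pot a) = a := sigmoid_pot h.pos h.near_lt_one

end Data

/-- The stationary profile on the whole half-line, constant on `(-∞, 0]`. -/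
def profInf (a b x : ℝ) : ℝ := wavePot (b - 1 / 2) a (max x 0)

/-- The stationary density on the whole half-line, constant on `(-∞, 0]`. -/
def densInf (a b x : ℝ) : ℝ := wave (b - 1 / 2) a (max x 0)

lemma isPair_inf (h : Data a b) : IsPair (pot a) (pot b) (densInf a b) (profInf a b) := by
  have hA := h.half_lt
  have hA2 : b - 1 / 2 ≤ 1 / 2 := by linarith [h.lt_one]
  refine ⟨(continuous_wave.comp (by fun_prop)).measurable,
    fun x => ⟨(wave_pos hA hA2 _).le, (wave_lt_one hA hA2 _).le⟩, ?_, fun x hx => ?_, ?_⟩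
  · exact (monoLip_wavePot hA hA2).comp (monoLip_max monoLip_id (monoLip_const 0))
  · rw [profInf, max_eq_right hx, wavePot, wave_zero h.abs_sub_lt]
  · have h1 : Tendsto (wavePot (b - 1 / 2) a) atTop (𝓝 (pot b)) := by
      have h2 := tendsto_wave (a := a) hA
      rw [add_sub_cancel] at h2
      exact (hasDerivAt_pot h.far_pos h.lt_one).continuousAt.tendsto.comp h2
    refine h1.congr' ?_
    filter_upwards [eventually_ge_atTop 0] with x hx
    rw [profInf, max_eq_left hx]

lemma sigmoid_profInf (h : Data a b) (x : ℝ) :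
    Real.sigmoid (profInf a b x) = densInf a b x :=
  sigmoid_wavePot h.half_lt (by linarith [h.lt_one]) _

lemma deriv_profInf (h : Data a b) {x : ℝ} (hx : 0 < x) :
    deriv (profInf a b) x = speed (b * (1 - b)) (profInf a b x) := by
  have hd := hasDerivAt_wavePot (a := a) h.half_lt (by linarith [h.lt_one]) x
  have heq : profInf a b =ᶠ[𝓝 x] wavePot (b - 1 / 2) a := by
    filter_upwards [Ioi_mem_nhds hx] with y hy
    rw [profInf, max_eq_left (le_of_lt hy)]
  rw [(hd.congr_of_eventuallyEq heq).deriv, heq.eq_of_nhds]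
  congr 1
  ring

lemma strictMonoOn_profInf (h : Data a b) : StrictMonoOn (profInf a b) (Ici 0) := by
  intro x hx y hy hxy
  rw [← Real.sigmoid_lt_iff, sigmoid_profInf h, sigmoid_profInf h, densInf, densInf,
    max_eq_left hx, max_eq_left hy]
  exact strictMono_wave h.half_lt hxy

lemma profInf_lt (h : Data a b) (x : ℝ) : profInf a b x < pot b := by
  have h1 := abs_lt.1 (abs_wave_sub_lt (a := a) h.half_lt (max x 0))
  rw [← Real.sigmoid_lt_iff, sigmoid_profInf h, h.sigmoid_far, densInf]
  linarith [h1.2]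

/-- The stationary profile on `[0, ℓ]`, constant outside. -/
def profFin (A a ℓ x : ℝ) : ℝ := wavePot A a (min (max x 0) ℓ)

/-- The stationary density on `[0, ℓ]`, constant outside. -/
def densFin (A a ℓ x : ℝ) : ℝ := wave A a (min (max x 0) ℓ)

lemma wave_half_eq (ha0 : 0 < a) (ha1 : a < 1) (x : ℝ) : wavePot (1 / 2) a x = pot a + x := by
  have ha : |a - 1 / 2| < 1 / 2 := by rw [abs_lt]; constructor <;> linarith
  have hd : ∀ x, HasDerivAt (fun x => wavePot (1 / 2) a x - x) 0 x := by
    intro x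
    refine ((hasDerivAt_wavePot (a := a) (half_pos one_pos) le_rfl x).sub
      (hasDerivAt_id x)).congr_deriv ?_
    norm_num [speed]
  have := is_const_of_deriv_eq_zero (fun x => (hd x).differentiableAt) (fun x => (hd x).deriv) x 0
  simp only [wavePot, wave_zero ha, sub_zero] at this ⊢
  linarith

lemma continuousOn_artanh : ContinuousOn Real.artanh (Ioo (-1) 1) := by
  unfold Real.artanh
  have h : ∀ x ∈ Ioo (-1 : ℝ) 1, 0 < (1 + x) / (1 - x) := fun x hx =>
    div_pos (by linarith [hx.1]) (by linarith [hx.2])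
  refine ContinuousOn.log (ContinuousOn.sqrt (ContinuousOn.div (by fun_prop) (by fun_prop)
    fun x hx => ?_)) fun x hx => (Real.sqrt_pos.2 (h x hx)).ne'
  linarith [hx.2]

/-- Shooting in the amplitude: for every `ℓ > pot b - pot a` some stationary profile goes from `a`
to `b` on `[0, ℓ]`. At the amplitude `b - 1 / 2` the profile stays below `b`, and at the amplitude
`1 / 2` its potential has slope `1`. -/
lemma exists_wave_eq (h : Data a b) {ℓ : ℝ} (hℓ : pot b - pot a < ℓ) :
    ∃ A, b - 1 / 2 < A ∧ A < 1 / 2 ∧ wave A a ℓ = b := by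
  have hle : b - 1 / 2 ≤ 1 / 2 := by linarith [h.lt_one]
  have hlow : wave (b - 1 / 2) a ℓ < b := by
    linarith [(abs_lt.1 (abs_wave_sub_lt (a := a) h.half_lt ℓ)).2]
  have hhigh : b < wave (1 / 2) a ℓ := by
    have h1 : pot b < wavePot (1 / 2) a ℓ := by
      rw [wave_half_eq h.pos h.near_lt_one]; linarith
    rwa [← Real.sigmoid_lt_iff, sigmoid_wavePot (half_pos one_pos) le_rfl, h.sigmoid_far] at h1
  have hc : ContinuousOn (fun A => wave A a ℓ) (Icc (b - 1 / 2) (1 / 2)) := by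
    unfold wave
    have h1 : ContinuousOn (fun A => Real.artanh ((a - 1 / 2) / A)) (Icc (b - 1 / 2) (1 / 2)) := by
      refine continuousOn_artanh.comp (continuousOn_const.div continuousOn_id fun A hA => ?_)
        fun A hA => div_mem_Ioo (h.abs_sub_lt.trans_le hA.1)
      exact (h.half_lt.trans_le hA.1).ne'
    exact continuousOn_const.add (continuousOn_id.mul
      (continuous_tanh.comp_continuousOn ((continuousOn_id.mul continuousOn_const).add h1)))
  obtain ⟨A, hA, hAb⟩ := intermediate_value_Icc hle hc ⟨hlow.le, hhigh.le⟩
  refine ⟨A, hA.1.lt_of_ne ?_, hA.2.lt_of_ne ?_, hAb⟩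
  · rintro rfl; exact hlow.ne hAb
  · rintro rfl; exact hhigh.ne' hAb

section Fin

variable {ℓ : ℝ}

lemma isPair_fin (h : Data a b) (hA1 : b - 1 / 2 < A) (hA2 : A < 1 / 2) (hℓ : 0 < ℓ)
    (hw : wave A a ℓ = b) : IsPair (pot a) (pot b) (densFin A a ℓ) (profFin A a ℓ) := by
  have hA : 0 < A := h.half_lt.trans hA1
  refine ⟨(continuous_wave.comp (by fun_prop)).measurable,
    fun x => ⟨(wave_pos hA hA2.le _).le, (wave_lt_one hA hA2.le _).le⟩, ?_, fun x hx => ?_, ?_⟩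
  · exact (monoLip_wavePot hA hA2.le).comp
      ((monoLip_min_const ℓ).comp (monoLip_max monoLip_id (monoLip_const 0)))
  · rw [profFin, max_eq_right hx, min_eq_left hℓ.le, wavePot,
      wave_zero (h.abs_sub_lt.trans hA1)]
  · refine tendsto_const_nhds.congr' ?_
    filter_upwards [eventually_ge_atTop ℓ] with x hx
    rw [profFin, max_eq_left (hℓ.le.trans hx), min_eq_right hx, wavePot, hw]

lemma profFin_of_ge (hℓ : 0 < ℓ) (hw : wave A a ℓ = b) {x : ℝ} (hx : ℓ ≤ x) :
    profFin A a ℓ x = pot b := by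
  rw [profFin, max_eq_left (hℓ.le.trans hx), min_eq_right hx, wavePot, hw]

lemma densFin_of_ge (hℓ : 0 < ℓ) (hw : wave A a ℓ = b) {x : ℝ} (hx : ℓ ≤ x) :
    densFin A a ℓ x = b := by
  rw [densFin, max_eq_left (hℓ.le.trans hx), min_eq_right hx, hw]

lemma densFin_of_mem {x : ℝ} (hx : x ∈ Icc 0 ℓ) : densFin A a ℓ x = wave A a x := by
  rw [densFin, max_eq_left hx.1, min_eq_left hx.2]

lemma sigmoid_profFin (h : Data a b) (hA1 : b - 1 / 2 < A) (hA2 : A < 1 / 2) (x : ℝ) :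
    Real.sigmoid (profFin A a ℓ x) = densFin A a ℓ x :=
  sigmoid_wavePot (h.half_lt.trans hA1) hA2.le _

lemma deriv_profFin (h : Data a b) (hA1 : b - 1 / 2 < A) (hA2 : A < 1 / 2) {x : ℝ}
    (hx : x ∈ Ioo 0 ℓ) : deriv (profFin A a ℓ) x = speed (1 / 4 - A ^ 2) (profFin A a ℓ x) := by
  have hd := hasDerivAt_wavePot (a := a) (h.half_lt.trans hA1) hA2.le x
  have heq : profFin A a ℓ =ᶠ[𝓝 x] wavePot A a := by
    filter_upwards [Ioo_mem_nhds hx.1 hx.2] with y hy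
    rw [profFin, max_eq_left hy.1.le, min_eq_left hy.2.le]
  rw [(hd.congr_of_eventuallyEq heq).deriv, heq.eq_of_nhds]

end Fin

end Pairs

/-! ### Minimality and uniqueness of the stationary pairs -/

section Infinite

variable {a b : ℝ} {u φ : ℝ → ℝ}

namespace Data

lemma var_pos (h : Data a b) : 0 < b * (1 - b) := mul_pos h.far_pos (by linarith [h.lt_one])

lemma speed_pos (h : Data a b) {y₁ : ℝ} (hy₁ : y₁ < pot b) :
    ∀ y ∈ Icc (pot a) y₁, 0 < speed (b * (1 - b)) y := by
  intro y hy
  rw [speed_pos_iff]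
  have := sigmoid_mul_lt (h.neg_pot_lt.trans_le hy.1) (hy.2.trans_lt hy₁)
  rwa [h.sigmoid_far] at this

lemma log_var (h : Data a b) : Real.log (b * (1 - b)) - redDens (pot b) = 0 := by
  have := exp_redDens (pot b)
  rw [h.sigmoid_far] at this
  rw [← this, Real.log_exp, sub_self]

end Data

lemma exists_eq_of_adm {α β y : ℝ} (hφ : IsAdm α β φ) (h1 : α ≤ y) (h2 : y < β) :
    ∃ X, 0 ≤ X ∧ φ X = y := by
  obtain ⟨R, hR, hR0⟩ := ((hφ.tendsto.eventually_const_lt h2).and (eventually_ge_atTop 0)).exists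
  obtain ⟨X, hX, hXy⟩ := intermediate_value_Icc hR0 hφ.continuous.continuousOn
    ⟨(hφ.left 0 le_rfl).le.trans h1, hR.le⟩
  exact ⟨X, hX.1, hXy⟩

lemma integral_exc_inf (h : Data a b) {Y : ℝ} (hY : 0 ≤ Y) :
    ∫ x in (0 : ℝ)..Y, exc (pot b) (densInf a b) (profInf a b) x =
      ∫ y in pot a..profInf a b Y, pot (speed (b * (1 - b)) y) := by
  have hs := h.speed_pos (profInf_lt h Y)
  rw [(isPair_inf h).integral_exc_eq h.var_pos hY hs, h.log_var,
    (isPair_inf h).integral_defect_eq_zero h.var_pos hY hs]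
  · ring
  · exact Eventually.of_forall fun x hx => ⟨(sigmoid_profInf h x).symm, deriv_profInf h hx.1⟩

lemma inDom_inf (h : Data a b) : InDom (pot b) (densInf a b) (profInf a b) := by
  obtain ⟨κ, hκ0, hκ⟩ := exists_redDens_ge h.neg_pot_lt h.pot_lt
  refine (isPair_inf h).inDom_of_frequently_le hκ0 hκ
    (C := |pot (1 - 4 * (b * (1 - b)))| * (pot b - pot a)) (Eventually.frequently ?_)
  filter_upwards [eventually_ge_atTop 0] with Y hY
  rw [integral_exc_inf h hY]
  have hs := h.speed_pos (profInf_lt h Y)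
  have hle := (isPair_inf h).adm.near_le Y
  have h4 : 0 < 1 - 4 * (b * (1 - b)) := by nlinarith [h.half_lt]
  -- the multiplier is bounded above because the slope is at most `1 - 4 b (1 - b) < 1`
  have hbd : ∀ y ∈ Icc (pot a) (profInf a b Y),
      pot (speed (b * (1 - b)) y) ≤ |pot (1 - 4 * (b * (1 - b)))| := by
    intro y hy
    refine le_trans ?_ (le_abs_self _)
    have hle4 : speed (b * (1 - b)) y ≤ 1 - 4 * (b * (1 - b)) := by
      unfold speed
      have h5 : 4 * (b * (1 - b)) ≤ b * (1 - b) / (Real.sigmoid y * (1 - Real.sigmoid y)) := by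
        rw [le_div_iff₀ (sigmoid_var_pos y)]
        nlinarith [sq_nonneg (Real.sigmoid y - 1 / 2), h.var_pos]
      linarith
    rcases hle4.eq_or_lt with heq | hlt
    · rw [heq]
    · exact (pot_lt_pot (hs y hy) hlt (by linarith [h.var_pos])).le
  have hi : IntervalIntegrable (fun y => pot (speed (b * (1 - b)) y)) volume (pot a)
      (profInf a b Y) := by
    refine ContinuousOn.intervalIntegrable ?_
    rw [uIcc_of_le hle]
    exact continuousOn_pot_speed h.var_pos hs
  refine (intervalIntegral.integral_mono_on hle hi intervalIntegrable_const hbd).trans ?_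
  rw [intervalIntegral.integral_const, smul_eq_mul, mul_comm]
  exact mul_le_mul_of_nonneg_left (by linarith [(isPair_inf h).adm.le_far Y]) (abs_nonneg _)

/-- The comparison with the stationary pair: the stretch of `φ` up to the level `profInf a b Y₀`
costs at least as much as the same stretch of the stationary profile, and what is left beyond high
levels is negligible. -/
lemma integral_exc_inf_add_defect_le (h : Data a b) (hp : IsPair (pot a) (pot b) u φ)
    (hd : InDom (pot b) u φ) {X₀ Y₀ : ℝ} (hX₀ : 0 ≤ X₀) (hY₀ : 0 ≤ Y₀)
    (hXY : φ X₀ = profInf a b Y₀) :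
    (∫ x, exc (pot b) (densInf a b) (profInf a b) x ∂halfVol) +
      (∫ x in (0 : ℝ)..X₀, defect (b * (1 - b)) u φ x) ≤ ∫ x, exc (pot b) u φ x ∂halfVol := by
  obtain ⟨κ, hκ0, hκ⟩ := exists_redDens_ge h.neg_pot_lt h.pot_lt
  have hpi := isPair_inf h
  have hstep : ∀ M, 0 ≤ M → ∀ Y, Y₀ < Y →
      (∫ x in (0 : ℝ)..Y, exc (pot b) (densInf a b) (profInf a b) x) +
      (∫ x in (0 : ℝ)..X₀, defect (b * (1 - b)) u φ x) - M * (pot b - profInf a b Y)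
      - Real.exp (-M) / κ ≤ ∫ x, exc (pot b) u φ x ∂halfVol := by
    intro M hM Y hY
    have hY0 : 0 ≤ Y := hY₀.trans hY.le
    obtain ⟨X, hX, hXe⟩ := exists_eq_of_adm hp.adm (hpi.adm.near_le Y) (profInf_lt h Y)
    have hXX : X₀ ≤ X := by
      by_contra hlt
      have h1 := hp.adm.mono (not_le.1 hlt).le
      have h2 := strictMonoOn_profInf h hY₀ hY0 hY
      rw [hXY, hXe] at h1
      exact absurd h1 (not_le.2 h2)
    have hs : ∀ y ∈ Icc (pot a) (φ X), 0 < speed (b * (1 - b)) y := by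
      rw [hXe]; exact h.speed_pos (profInf_lt h Y)
    have h1 := hp.tail_ge hκ0 hκ h.neg_pot_lt hd hM X
    rw [hp.integral_exc_eq h.var_pos hX hs, h.log_var, hXe, ← integral_exc_inf h hY0] at h1
    have h2 : ∫ x in (0 : ℝ)..X₀, defect (b * (1 - b)) u φ x ≤
        ∫ x in (0 : ℝ)..X, defect (b * (1 - b)) u φ x :=
      intervalIntegral.integral_mono_interval le_rfl hX₀ hXX
        (Eventually.of_forall hp.defect_nonneg) (hp.intervalIntegrable_defect h.var_pos hX hs)
    linarith
  have hstep2 : ∀ M, 0 ≤ M →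
      (∫ x, exc (pot b) (densInf a b) (profInf a b) x ∂halfVol) +
      (∫ x in (0 : ℝ)..X₀, defect (b * (1 - b)) u φ x) - Real.exp (-M) / κ ≤
      ∫ x, exc (pot b) u φ x ∂halfVol := by
    intro M hM
    have hlim := (((hpi.tendsto_integral_exc h.neg_pot_lt (inDom_inf h)).add_const
      (∫ x in (0 : ℝ)..X₀, defect (b * (1 - b)) u φ x)).sub
      ((hpi.adm.tendsto.const_sub (pot b)).const_mul M)).sub_const (Real.exp (-M) / κ)
    rw [sub_self, mul_zero, sub_zero] at hlim
    refine le_of_tendsto hlim ?_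
    filter_upwards [eventually_gt_atTop Y₀] with Y hY
    exact hstep M hM Y hY
  have hexp : Tendsto (fun M : ℝ => Real.exp (-M) / κ) atTop (𝓝 0) := by
    simpa using (Real.tendsto_exp_neg_atTop_nhds_zero).div_const κ
  have hlim := hexp.const_sub ((∫ x, exc (pot b) (densInf a b) (profInf a b) x ∂halfVol) +
      (∫ x in (0 : ℝ)..X₀, defect (b * (1 - b)) u φ x))
  rw [sub_zero] at hlim
  refine le_of_tendsto hlim ?_
  filter_upwards [eventually_ge_atTop 0] with M hM
  exact hstep2 M hM

lemma integral_exc_inf_le (h : Data a b) (hp : IsPair (pot a) (pot b) u φ)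
    (hd : InDom (pot b) u φ) :
    ∫ x, exc (pot b) (densInf a b) (profInf a b) x ∂halfVol ≤ ∫ x, exc (pot b) u φ x ∂halfVol := by
  have := integral_exc_inf_add_defect_le h hp hd le_rfl le_rfl
    ((hp.adm.left 0 le_rfl).trans ((isPair_inf h).adm.left 0 le_rfl).symm)
  simpa using this

lemma eq_inf_of_integral_exc_le (h : Data a b) (hp : IsPair (pot a) (pot b) u φ)
    (hd : InDom (pot b) u φ) (hle : ∫ x, exc (pot b) u φ x ∂halfVol ≤
      ∫ x, exc (pot b) (densInf a b) (profInf a b) x ∂halfVol) :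
    u =ᵐ[halfVol] densInf a b ∧ φ = profInf a b := by
  have hpi := isPair_inf h
  have hst : ∀ Y, 0 ≤ Y → φ Y = profInf a b Y ∧
      ∀ᵐ x, x ∈ Ioc 0 Y → u x = Real.sigmoid (φ x) := by
    intro Y hY
    obtain ⟨X, hX, hXe⟩ := exists_eq_of_adm hp.adm (hpi.adm.near_le Y) (profInf_lt h Y)
    have h1 := integral_exc_inf_add_defect_le h hp hd hX hY hXe
    have hs : ∀ y ∈ Icc (pot a) (φ X), 0 < speed (b * (1 - b)) y := by
      rw [hXe]; exact h.speed_pos (profInf_lt h Y)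
    have h2 := hp.ae_eq_of_integral_defect_le h.var_pos hX hs (by linarith)
    have hXY : X = Y := by
      rcases hX.eq_or_lt with h0 | hX0
      · rcases hY.eq_or_lt with h0' | hY0
        · rw [← h0, ← h0']
        · exfalso
          have h3 := strictMonoOn_profInf h (mem_Ici.2 le_rfl) hY hY0
          rw [← hXe, ← h0, hp.adm.left 0 le_rfl, hpi.adm.left 0 le_rfl] at h3
          exact lt_irrefl _ h3
      have h3 := (riccati_unique (v₁ := fun x => Real.sigmoid (φ x))
        (v₂ := fun x => Real.sigmoid (profInf a b x)) hX0
        (continuous_sigmoid.comp hp.adm.continuous).continuousOn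
        (continuous_sigmoid.comp hpi.adm.continuous).continuousOn
        (fun x hx => hp.adm.hasDerivAt_sigmoid_comp (h2.mono fun x hx hxX => (hx hxX).2) hx)
        (fun x hx => hpi.adm.hasDerivAt_sigmoid_comp
          (Eventually.of_forall fun x hx => deriv_profInf h hx.1) hx)
        (by simp only [hp.adm.left 0 le_rfl, hpi.adm.left 0 le_rfl])).2 rfl X ⟨hX, le_rfl⟩
      have h4 := Real.sigmoid_injective h3
      rw [hXe] at h4
      exact ((strictMonoOn_profInf h).injOn hY hX h4).symm
    rw [hXY] at hXe h2
    exact ⟨hXe, h2.mono fun x hx hxX => (hx hxX).1⟩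
  have hφ : φ = profInf a b := by
    ext x
    rcases le_total x 0 with hx | hx
    · rw [hp.adm.left x hx, hpi.adm.left x hx]
    · exact (hst x hx).1
  refine ⟨?_, hφ⟩
  rw [halfVol, ← restrict_Ioi_eq_restrict_Ici]
  refine (ae_restrict_iff' measurableSet_Ioi).2 ?_
  have hall : ∀ᵐ x, ∀ n : ℕ, x ∈ Ioc (0 : ℝ) n → u x = Real.sigmoid (φ x) :=
    ae_all_iff.2 fun n => (hst n n.cast_nonneg).2
  filter_upwards [hall] with x hx hx0
  obtain ⟨n, hn⟩ := exists_nat_ge x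
  rw [hx n ⟨hx0, hn⟩, hφ, sigmoid_profInf h]

end Infinite

section Finite

variable {A a b ℓ : ℝ} {u φ : ℝ → ℝ}

/-- The condition defining the domain of the functional on `(0, ℓ)`. -/
def InBdd (b ℓ : ℝ) (u φ : ℝ → ℝ) : Prop :=
  (∀ x, ℓ ≤ x → φ x = pot b) ∧ ∀ᵐ x, ℓ ≤ x → u x = b

lemma inBdd_fin (hℓ : 0 < ℓ) (hw : wave A a ℓ = b) :
    InBdd b ℓ (densFin A a ℓ) (profFin A a ℓ) :=
  ⟨fun _ hx => profFin_of_ge hℓ hw hx, Eventually.of_forall fun _ hx => densFin_of_ge hℓ hw hx⟩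

lemma flux_pos (h : Data a b) (hA1 : b - 1 / 2 < A) (hA2 : A < 1 / 2) : 0 < 1 / 4 - A ^ 2 := by
  nlinarith [h.half_lt]

lemma speed_fin_pos (h : Data a b) (hA1 : b - 1 / 2 < A) :
    ∀ y ∈ Icc (pot a) (pot b), 0 < speed (1 / 4 - A ^ 2) y := by
  intro y hy
  rw [speed_pos_iff]
  have h1 := Real.sigmoid_monotone hy.1
  have h2 := Real.sigmoid_monotone hy.2
  rw [h.sigmoid_near] at h1
  rw [h.sigmoid_far] at h2
  have h3 := h.one_lt
  nlinarith

/-- The energy on `(0, ℓ)` exceeds that of the stationary pair by exactly the defect. -/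
lemma integral_exc_fin_add_defect (h : Data a b) (hA1 : b - 1 / 2 < A) (hA2 : A < 1 / 2)
    (hℓ : 0 < ℓ) (hw : wave A a ℓ = b) (hp : IsPair (pot a) (pot b) u φ) (hb : InBdd b ℓ u φ) :
    (∫ x in (0 : ℝ)..ℓ, exc (pot b) (densFin A a ℓ) (profFin A a ℓ) x) +
      (∫ x in (0 : ℝ)..ℓ, defect (1 / 4 - A ^ 2) u φ x) = ∫ x in (0 : ℝ)..ℓ, exc (pot b) u φ x := by
  have hJ := flux_pos h hA1 hA2
  have hpi := isPair_fin h hA1 hA2 hℓ hw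
  have hs := speed_fin_pos h hA1
  have e1 := hb.1 ℓ le_rfl
  have e2 := profFin_of_ge hℓ hw le_rfl
  rw [hp.integral_exc_eq hJ hℓ.le (by rwa [e1]), hpi.integral_exc_eq hJ hℓ.le (by rwa [e2]), e1, e2,
    hpi.integral_defect_eq_zero hJ hℓ.le (by rwa [e2])]
  · ring
  · have : ∀ᵐ x : ℝ, x ≠ ℓ := by simp [ae_iff, measure_singleton]
    filter_upwards [this] with x hxne hx
    exact ⟨(sigmoid_profFin h hA1 hA2 x).symm,
      deriv_profFin h hA1 hA2 ⟨hx.1, hx.2.lt_of_ne hxne⟩⟩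

lemma integral_exc_fin_le (h : Data a b) (hA1 : b - 1 / 2 < A) (hA2 : A < 1 / 2)
    (hℓ : 0 < ℓ) (hw : wave A a ℓ = b) (hp : IsPair (pot a) (pot b) u φ) (hb : InBdd b ℓ u φ) :
    ∫ x in (0 : ℝ)..ℓ, exc (pot b) (densFin A a ℓ) (profFin A a ℓ) x ≤
      ∫ x in (0 : ℝ)..ℓ, exc (pot b) u φ x := by
  rw [← integral_exc_fin_add_defect h hA1 hA2 hℓ hw hp hb]
  linarith [intervalIntegral.integral_nonneg (μ := volume) hℓ.le fun x _ =>
    hp.defect_nonneg (J := 1 / 4 - A ^ 2) x]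

lemma eq_fin_of_integral_exc_le (h : Data a b) (hA1 : b - 1 / 2 < A) (hA2 : A < 1 / 2)
    (hℓ : 0 < ℓ) (hw : wave A a ℓ = b) (hp : IsPair (pot a) (pot b) u φ) (hb : InBdd b ℓ u φ)
    (hle : ∫ x in (0 : ℝ)..ℓ, exc (pot b) u φ x ≤
      ∫ x in (0 : ℝ)..ℓ, exc (pot b) (densFin A a ℓ) (profFin A a ℓ) x) :
    u =ᵐ[halfVol] densFin A a ℓ ∧ φ = profFin A a ℓ := by
  have hJ := flux_pos h hA1 hA2
  have hpi := isPair_fin h hA1 hA2 hℓ hw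
  have hs := speed_fin_pos h hA1
  have e1 := hb.1 ℓ le_rfl
  rw [← integral_exc_fin_add_defect h hA1 hA2 hℓ hw hp hb] at hle
  have h2 := hp.ae_eq_of_integral_defect_le hJ hℓ.le (by rwa [e1]) (by linarith)
  have hne : ∀ᵐ x : ℝ, x ≠ ℓ := by simp [ae_iff, measure_singleton]
  have h3 := (riccati_unique (v₁ := fun x => Real.sigmoid (φ x))
    (v₂ := fun x => Real.sigmoid (profFin A a ℓ x)) hℓ
    (continuous_sigmoid.comp hp.adm.continuous).continuousOn
    (continuous_sigmoid.comp hpi.adm.continuous).continuousOn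
    (fun x hx => hp.adm.hasDerivAt_sigmoid_comp (h2.mono fun x hx hxX => (hx hxX).2) hx)
    (fun x hx => hpi.adm.hasDerivAt_sigmoid_comp
      (hne.mono fun x hxne hx => deriv_profFin h hA1 hA2 ⟨hx.1, hx.2.lt_of_ne hxne⟩) hx)
    (by simp only [hp.adm.left 0 le_rfl, hpi.adm.left 0 le_rfl])).2 rfl
  have hφ : φ = profFin A a ℓ := by
    ext x
    rcases le_total x 0 with hx | hx
    · rw [hp.adm.left x hx, hpi.adm.left x hx]
    rcases le_total x ℓ with hxℓ | hxℓ
    · exact Real.sigmoid_injective (h3 x ⟨hx, hxℓ⟩)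
    · rw [hb.1 x hxℓ, profFin_of_ge hℓ hw hxℓ]
  refine ⟨?_, hφ⟩
  rw [halfVol, ← restrict_Ioi_eq_restrict_Ici]
  refine (ae_restrict_iff' measurableSet_Ioi).2 ?_
  filter_upwards [h2, hb.2] with x hx hx' hx0
  rcases le_total x ℓ with hxℓ | hxℓ
  · rw [(hx ⟨hx0, hxℓ⟩).1, hφ, sigmoid_profFin h hA1 hA2]
  · rw [hx' hxℓ, densFin_of_ge hℓ hw hxℓ]

end Finite

/-! ### Lower semicontinuity -/

/-- Truncation of a number in `[0, 1]` to `[δ, 1 - δ]`. -/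
def clamp (δ v : ℝ) : ℝ := max δ (min v (1 - δ))

lemma clamp_mem {δ : ℝ} (hδ : δ ≤ 1 / 2) (v : ℝ) : clamp δ v ∈ Icc δ (1 - δ) :=
  ⟨le_max_left _ _, max_le (by linarith) (min_le_right _ _)⟩

lemma relEnt_pot_clamp_le {δ v : ℝ} (hδ : 0 < δ) (hδ2 : δ ≤ 1 / 2) (hv : v ∈ Icc (0 : ℝ) 1) :
    relEnt v (pot (clamp δ v)) ≤ 2 * δ := by
  have hm := clamp_mem hδ2 v
  have h0 : 0 < clamp δ v := hδ.trans_le hm.1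
  have h1 : 0 < 1 - clamp δ v := by linarith [hm.2]
  refine (relEnt_le hv _).trans ?_
  rw [sigmoid_pot h0 (by linarith), div_le_iff₀ (mul_pos h0 h1)]
  rcases lt_or_ge v δ with h | h
  · have : clamp δ v = δ := by
      rw [clamp, max_eq_left ((min_le_left _ _).trans h.le)]
    rw [this]
    have h2 : (v - δ) ^ 2 ≤ δ ^ 2 := by nlinarith [hv.1]
    nlinarith [mul_nonneg (sq_nonneg δ) (by linarith : 0 ≤ 1 - 2 * δ)]
  rcases lt_or_ge (1 - δ) v with h' | h'
  · have : clamp δ v = 1 - δ := by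
      rw [clamp, min_eq_right h'.le, max_eq_right (by linarith)]
    rw [this]
    have h2 : (v - (1 - δ)) ^ 2 ≤ δ ^ 2 := by nlinarith [hv.2]
    nlinarith [mul_nonneg (sq_nonneg δ) (by linarith : 0 ≤ 1 - 2 * δ)]
  · have : clamp δ v = v := by rw [clamp, min_eq_left h', max_eq_right h]
    rw [this] at h0 h1 ⊢
    rw [sub_self, zero_pow two_ne_zero]
    exact mul_nonneg (by linarith) (mul_pos h0 h1).le

lemma measurable_pot : Measurable pot :=
  Real.measurable_log.comp (measurable_id.div (measurable_const.sub measurable_id))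

lemma measurable_clamp (δ : ℝ) : Measurable (clamp δ) :=
  measurable_const.max (measurable_id.min measurable_const)

lemma abs_pot_clamp_le {δ : ℝ} (hδ : 0 < δ) (hδ2 : δ ≤ 1 / 2) (v : ℝ) :
    |pot (clamp δ v)| ≤ pot (1 - δ) := by
  have hm := clamp_mem hδ2 v
  have mono : ∀ {x y : ℝ}, 0 < x → x ≤ y → y < 1 → pot x ≤ pot y := by
    intro x y hx hxy hy
    rcases hxy.eq_or_lt with rfl | hlt
    · exact le_rfl
    · exact (pot_lt_pot hx hlt hy).le
  rw [abs_le]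
  constructor
  · rw [pot_one_sub, neg_neg]
    exact mono hδ hm.1 (by linarith [hm.2])
  · exact mono (hδ.trans_le hm.1) hm.2 (by linarith)

lemma abs_log_one_add_exp_sub_le (x y : ℝ) :
    |Real.log (1 + Real.exp x) - Real.log (1 + Real.exp y)| ≤ |x - y| := by
  have hm : ∀ x y : ℝ, x ≤ y →
      Real.log (1 + Real.exp x) ≤ Real.log (1 + Real.exp y) ∧
      Real.log (1 + Real.exp y) - Real.log (1 + Real.exp x) ≤ y - x := by
    intro x y hxy
    refine ⟨Real.log_le_log (one_add_exp_pos x) (by gcongr), ?_⟩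
    have := redDens_sub_le hxy
    unfold redDens at this
    linarith
  rcases le_total x y with h | h
  · rw [abs_sub_comm, abs_of_nonneg (sub_nonneg.2 (hm x y h).1), abs_sub_comm x,
      abs_of_nonneg (sub_nonneg.2 h)]
    exact (hm x y h).2
  · rw [abs_of_nonneg (sub_nonneg.2 (hm y x h).1), abs_of_nonneg (sub_nonneg.2 h)]
    exact (hm y x h).2

/-- Convexity of the entropy, with tangents at truncated arguments. -/
lemma exc_sub_ge {α β δ : ℝ} {u φ u₀ φ₀ : ℝ → ℝ} (h : IsPair α β u φ) (h₀ : IsPair α β u₀ φ₀)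
    (hδ : 0 < δ) (hδ2 : δ ≤ 1 / 2) (x : ℝ) :
    (pot (clamp δ (u₀ x)) - φ₀ x) * (u x - u₀ x) +
      pot (clamp δ (deriv φ₀ x)) * (deriv φ x - deriv φ₀ x) - 2 * |φ x - φ₀ x| - 4 * δ ≤
      exc β u φ x - exc β u₀ φ₀ x := by
  set lu := pot (clamp δ (u₀ x)) with hlu
  set lp := pot (clamp δ (deriv φ₀ x)) with hlp
  have a1 := relEnt_nonneg (h.mem x) lu
  have a2 := relEnt_nonneg (h.adm.deriv_mem x) lp
  have a3 := relEnt_pot_clamp_le hδ hδ2 (h₀.mem x)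
  have a4 := relEnt_pot_clamp_le hδ hδ2 (h₀.adm.deriv_mem x)
  rw [← hlu] at a3
  rw [← hlp] at a4
  have a5 := abs_log_one_add_exp_sub_le (φ x) (φ₀ x)
  have a6 := (abs_le.1 a5).2
  have a7 : -|φ x - φ₀ x| ≤ (1 - u x) * (φ x - φ₀ x) := by
    have h1 : |(1 - u x) * (φ x - φ₀ x)| ≤ |φ x - φ₀ x| := by
      rw [abs_mul]
      refine mul_le_of_le_one_left (abs_nonneg _) (abs_le.2 ⟨?_, ?_⟩) <;>
        linarith [(h.mem x).1, (h.mem x).2]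
    linarith [neg_abs_le ((1 - u x) * (φ x - φ₀ x))]
  unfold exc redDens
  unfold relEnt at *
  nlinarith

lemma integral_mul_indicator {u g : ℝ → ℝ} {R : ℝ} (hR : 0 ≤ R) :
    ∫ x, u x * (Ioc 0 R).indicator g x ∂halfVol = ∫ x in (0 : ℝ)..R, u x * g x := by
  have h1 : (fun x => u x * (Ioc 0 R).indicator g x) =
      (Ioc 0 R).indicator fun x => u x * g x := by
    ext x
    by_cases hx : x ∈ Ioc 0 R <;> simp [hx]
  rw [h1, integral_indicator measurableSet_Ioc, halfVol,
    Measure.restrict_restrict measurableSet_Ioc,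
    inter_eq_self_of_subset_left (Ioc_subset_Ioi_self.trans Ioi_subset_Ici_self),
    intervalIntegral.integral_of_le hR]

lemma integrable_indicator_Ioc {g : ℝ → ℝ} {R C : ℝ} (hg : Measurable g)
    (hC : ∀ x, |g x| ≤ C) : Integrable ((Ioc 0 R).indicator g) halfVol := by
  rw [integrable_indicator_iff measurableSet_Ioc]
  exact Measure.integrableOn_of_bounded (M := C)
    ((Measure.restrict_apply_le _ _).trans_lt (by simp)).ne hg.aestronglyMeasurable
    (Eventually.of_forall hC)

section LSC

variable {ι : Type*} {l : Filter ι} {α β : ℝ} {u φ : ι → ℝ → ℝ} {u₀ φ₀ : ℝ → ℝ}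

/-- Lower semicontinuity of the energy on bounded intervals. -/
lemma eventually_lt_integral_exc (h : ∀ i, IsPair α β (u i) (φ i)) (h₀ : IsPair α β u₀ φ₀)
    (hu : ∀ f, Integrable f halfVol →
      Tendsto (fun i => ∫ x, u i x * f x ∂halfVol) l (𝓝 (∫ x, u₀ x * f x ∂halfVol)))
    (hφ : TendstoUniformly φ φ₀ l) {R : ℝ} (hR : 0 ≤ R) {η : ℝ} (hη : 0 < η) :
    ∀ᶠ i in l, (∫ x in (0 : ℝ)..R, exc β u₀ φ₀ x) - η < ∫ x in (0 : ℝ)..R, exc β (u i) (φ i) x := by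
  obtain ⟨δ, hδ, hδ2, hδη⟩ : ∃ δ : ℝ, 0 < δ ∧ δ ≤ 1 / 2 ∧ 4 * δ * R ≤ η / 4 := by
    refine ⟨min (1 / 2) (η / (16 * (R + 1))), by positivity, min_le_left _ _, ?_⟩
    have h1 : min (1 / 2) (η / (16 * (R + 1))) * (16 * (R + 1)) ≤ η := by
      rw [← le_div_iff₀ (by positivity)]; exact min_le_right _ _
    have h2 : 0 < min (1 / 2) (η / (16 * (R + 1))) := by positivity
    nlinarith
  have hlu : Measurable fun x => pot (clamp δ (u₀ x)) - φ₀ x :=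
    (measurable_pot.comp ((measurable_clamp δ).comp h₀.measurable)).sub
      h₀.adm.continuous.measurable
  have hlp : Measurable fun x => pot (clamp δ (deriv φ₀ x)) :=
    measurable_pot.comp ((measurable_clamp δ).comp (measurable_deriv φ₀))
  have hlub : ∀ x, |pot (clamp δ (u₀ x)) - φ₀ x| ≤ pot (1 - δ) + (|α| + |β|) := by
    intro x
    have h1 := abs_pot_clamp_le hδ hδ2 (u₀ x)
    have h2 : |φ₀ x| ≤ |α| + |β| := by
      rw [abs_le]
      constructor
      · linarith [h₀.adm.near_le x, neg_abs_le α, abs_nonneg β]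
      · linarith [h₀.adm.le_far x, le_abs_self β, abs_nonneg α]
    exact (abs_sub _ _).trans (by linarith)
  have hlpb : ∀ x, |pot (clamp δ (deriv φ₀ x))| ≤ pot (1 - δ) := fun x =>
    abs_pot_clamp_le hδ hδ2 _
  have iu : ∀ v : ℝ → ℝ, Measurable v → (∀ x, v x ∈ Icc (0 : ℝ) 1) → ∀ g : ℝ → ℝ, Measurable g →
      ∀ C, (∀ x, |g x| ≤ C) → IntervalIntegrable (fun x => v x * g x) volume 0 R := by
    intro v hv hv1 g hg C hC
    refine intervalIntegrable_of_bounded (C := C) (hv.mul hg).aestronglyMeasurable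
      (Eventually.of_forall fun x _ => ?_)
    rw [abs_mul]
    have : |v x| ≤ 1 := abs_le.2 ⟨by linarith [(hv1 x).1], (hv1 x).2⟩
    exact (mul_le_of_le_one_left (abs_nonneg _) this).trans (hC x)
  have t1 : Tendsto (fun i => ∫ x in (0 : ℝ)..R, (pot (clamp δ (u₀ x)) - φ₀ x) * (u i x - u₀ x)) l
      (𝓝 0) := by
    have := (hu _ (integrable_indicator_Ioc (R := R) hlu hlub)).sub_const
      (∫ x, u₀ x * (Ioc 0 R).indicator (fun x => pot (clamp δ (u₀ x)) - φ₀ x) x ∂halfVol)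
    rw [sub_self] at this
    refine this.congr fun i => ?_
    rw [integral_mul_indicator hR, integral_mul_indicator hR,
      ← intervalIntegral.integral_sub (iu _ (h i).measurable (h i).mem _ hlu _ hlub)
      (iu _ h₀.measurable h₀.mem _ hlu _ hlub)]
    congr 1; ext x; ring
  have t2 : Tendsto (fun i => ∫ x in (0 : ℝ)..R,
      pot (clamp δ (deriv φ₀ x)) * (deriv (φ i) x - deriv φ₀ x)) l (𝓝 0) := by
    have := tendsto_integral_deriv_mul (fun i => (h i).adm.toMonoLip) h₀.adm.toMonoLip
      (fun x => hφ.tendsto_at x) (integrable_indicator_Ioc (R := R) hlp hlpb)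
    refine this.congr fun i => ?_
    rw [integral_mul_indicator (u := fun x => deriv (φ i) x - deriv φ₀ x) hR]
    congr 1; ext x; ring
  obtain ⟨ρ, hρ, hρη⟩ : ∃ ρ : ℝ, 0 < ρ ∧ 2 * ρ * R ≤ η / 4 := by
    refine ⟨η / (8 * (R + 1)), by positivity, ?_⟩
    have h1 : η / (8 * (R + 1)) * (8 * (R + 1)) = η := by field_simp
    have h2 : 0 < η / (8 * (R + 1)) := by positivity
    nlinarith
  filter_upwards [t1.eventually_const_lt (by linarith : -(η / 8) < 0),
    t2.eventually_const_lt (by linarith : -(η / 8) < 0),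
    Metric.tendstoUniformly_iff.1 hφ ρ hρ] with i h1 h2 h3
  have j1 : IntervalIntegrable (fun x => (pot (clamp δ (u₀ x)) - φ₀ x) * (u i x - u₀ x))
      volume 0 R := by
    refine ((iu _ (h i).measurable (h i).mem _ hlu _ hlub).sub
      (iu _ h₀.measurable h₀.mem _ hlu _ hlub)).congr fun x _ => ?_
    ring
  have j2 : IntervalIntegrable (fun x =>
      pot (clamp δ (deriv φ₀ x)) * (deriv (φ i) x - deriv φ₀ x)) volume 0 R := by
    refine ((iu _ (measurable_deriv (φ i)) (h i).adm.deriv_mem _ hlp _ hlpb).sub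
      (iu _ (measurable_deriv φ₀) h₀.adm.deriv_mem _ hlp _ hlpb)).congr fun x _ => ?_
    ring
  have hmono := intervalIntegral.integral_mono_on (μ := volume) hR
    ((j1.add j2).sub (intervalIntegrable_const (c := 2 * ρ + 4 * δ)))
    (((h i).intervalIntegrable_exc 0 R).sub (h₀.intervalIntegrable_exc 0 R)) fun x _ => by
      have := exc_sub_ge (h i) h₀ hδ hδ2 x
      have h4 := h3 x
      rw [dist_comm, Real.dist_eq] at h4
      linarith
  rw [intervalIntegral.integral_sub (j1.add j2) intervalIntegrable_const,
    intervalIntegral.integral_add j1 j2, intervalIntegral.integral_const,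
    intervalIntegral.integral_sub ((h i).intervalIntegrable_exc 0 R)
      (h₀.intervalIntegrable_exc 0 R), smul_eq_mul] at hmono
  linarith

/-- Lower semicontinuity of the energy on the half-line. -/
lemma eventually_lt_energy (hα : -β < α) (hαβ : α < β) (h : ∀ i, IsPair α β (u i) (φ i))
    (h₀ : IsPair α β u₀ φ₀)
    (hu : ∀ f, Integrable f halfVol →
      Tendsto (fun i => ∫ x, u i x * f x ∂halfVol) l (𝓝 (∫ x, u₀ x * f x ∂halfVol)))
    (hφ : TendstoUniformly φ φ₀ l) {t : ℝ}
    (ht : InDom β u₀ φ₀ → t < ∫ x, exc β u₀ φ₀ x ∂halfVol) :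
    ∀ᶠ i in l, InDom β (u i) (φ i) → t < ∫ x, exc β (u i) (φ i) x ∂halfVol := by
  obtain ⟨κ, hκ0, hκ⟩ := exists_redDens_ge hα hαβ
  obtain ⟨δ, hδ, hR⟩ : ∃ δ : ℝ, 0 < δ ∧
      ∀ᶠ R in atTop, t + 4 * δ < ∫ x in (0 : ℝ)..R, exc β u₀ φ₀ x := by
    by_cases hd : InDom β u₀ φ₀
    · have h1 := ht hd
      exact ⟨((∫ x, exc β u₀ φ₀ x ∂halfVol) - t) / 8, by linarith,
        (h₀.tendsto_integral_exc hα hd).eventually_const_lt (by linarith)⟩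
    · refine ⟨1, one_pos, ?_⟩
      by_contra hcon
      rw [Filter.not_eventually] at hcon
      exact hd (h₀.inDom_of_frequently_le hκ0 hκ (hcon.mono fun R hR => not_lt.1 hR))
  obtain ⟨M, hM0, hM⟩ : ∃ M : ℝ, 0 ≤ M ∧ Real.exp (-M) / κ < δ := by
    have hexp : Tendsto (fun M : ℝ => Real.exp (-M) / κ) atTop (𝓝 0) := by
      simpa using (Real.tendsto_exp_neg_atTop_nhds_zero).div_const κ
    exact ((eventually_ge_atTop 0).and (hexp.eventually_lt_const hδ)).exists
  have hMR : ∀ᶠ R in atTop, M * (β - φ₀ R) < δ := by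
    have := (h₀.adm.tendsto.const_sub β).const_mul M
    rw [sub_self, mul_zero] at this
    exact this.eventually_lt_const hδ
  obtain ⟨R, ⟨hR1, hR2⟩, hR0⟩ := ((hR.and hMR).and (eventually_ge_atTop 0)).exists
  have hφR : Tendsto (fun i => M * (β - φ i R)) l (𝓝 (M * (β - φ₀ R))) :=
    ((hφ.tendsto_at R).const_sub β).const_mul M
  filter_upwards [eventually_lt_integral_exc h h₀ hu hφ hR0 hδ,
    hφR.eventually_lt_const hR2] with i h1 h2 hd
  have := (h i).tail_ge hκ0 hκ hα hd hM0 R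
  linarith

end LSC

/-! ### Restriction to bounded intervals and recovery sequences -/

section Recovery

variable {a b ℓ : ℝ} {u φ : ℝ → ℝ}

lemma ae_exc_eq_zero (h : Data a b) (hb : InBdd b ℓ u φ) :
    ∀ᵐ x, ℓ < x → exc (pot b) u φ x = 0 := by
  filter_upwards [hb.2] with x hx hxℓ
  have heq : φ =ᶠ[𝓝 x] fun _ => pot b := by
    filter_upwards [Ioi_mem_nhds hxℓ] with y hy
    exact hb.1 y (le_of_lt hy)
  have h1 := relEnt_sigmoid (pot b)
  rw [h.sigmoid_far] at h1
  rw [exc, hx hxℓ.le, heq.deriv_eq, heq.eq_of_nhds, h1]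
  simp [ent_zero]

lemma inDom_of_inBdd (h : Data a b) (hp : IsPair (pot a) (pot b) u φ) (hb : InBdd b ℓ u φ) :
    InDom (pot b) u φ := by
  obtain ⟨κ, hκ0, hκ⟩ := exists_redDens_ge h.neg_pot_lt h.pot_lt
  refine hp.inDom_of_frequently_le hκ0 hκ (C := ∫ x in (0 : ℝ)..ℓ, exc (pot b) u φ x)
    (Eventually.frequently ?_)
  filter_upwards [eventually_ge_atTop ℓ] with R hR
  rw [← intervalIntegral.integral_add_adjacent_intervals (hp.intervalIntegrable_exc 0 ℓ)
    (hp.intervalIntegrable_exc ℓ R), intervalIntegral.integral_zero_ae (a := ℓ), add_zero]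
  filter_upwards [ae_exc_eq_zero h hb] with x hx hxR
  rw [uIoc_of_le hR] at hxR
  exact hx hxR.1

lemma integral_exc_of_inBdd (h : Data a b) (hp : IsPair (pot a) (pot b) u φ)
    (hb : InBdd b ℓ u φ) :
    ∫ x, exc (pot b) u φ x ∂halfVol = ∫ x in (0 : ℝ)..ℓ, exc (pot b) u φ x := by
  refine tendsto_nhds_unique (hp.tendsto_integral_exc h.neg_pot_lt (inDom_of_inBdd h hp hb)) ?_
  refine tendsto_const_nhds.congr' ?_
  filter_upwards [eventually_ge_atTop ℓ] with R hR
  rw [← intervalIntegral.integral_add_adjacent_intervals (hp.intervalIntegrable_exc 0 ℓ)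
    (hp.intervalIntegrable_exc ℓ R), intervalIntegral.integral_zero_ae (a := ℓ), add_zero]
  filter_upwards [ae_exc_eq_zero h hb] with x hx hxR
  rw [uIoc_of_le hR] at hxR
  exact hx hxR.1

/-- The profile `φ`, raised with slope `1` so as to reach its limit at `ℓ`. -/
def recProf (b ℓ : ℝ) (φ : ℝ → ℝ) (x : ℝ) : ℝ := max (φ x) (min (pot b - ℓ + x) (pot b))

/-- The density `u`, replaced by its limit `b` from the point on where `recProf` may differ from
`φ`. -/
def recDens (a b ℓ : ℝ) (u : ℝ → ℝ) (x : ℝ) : ℝ := if x < ℓ - (pot b - pot a) then u x else b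

lemma isPair_rec (h : Data a b) (hp : IsPair (pot a) (pot b) u φ) (hℓ : pot b - pot a ≤ ℓ) :
    IsPair (pot a) (pot b) (recDens a b ℓ u) (recProf b ℓ φ) := by
  have hlin : MonoLip fun x => pot b - ℓ + x :=
    ⟨fun _ _ hxy => by simpa using hxy, fun x y hxy => by linarith⟩
  have hle : ∀ x, recProf b ℓ φ x ≤ pot b := fun x => max_le (hp.adm.le_far x) (min_le_right _ _)
  refine ⟨Measurable.ite measurableSet_Iio hp.measurable measurable_const, fun x => ?_,
    monoLip_max hp.adm.toMonoLip ((monoLip_min_const (pot b)).comp hlin), fun x hx => ?_, ?_⟩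
  · unfold recDens
    split_ifs
    · exact hp.mem x
    · exact ⟨h.far_pos.le, h.lt_one.le⟩
  · rw [recProf, hp.adm.left x hx, max_eq_left]
    exact (min_le_left _ _).trans (by linarith)
  · exact tendsto_of_tendsto_of_tendsto_of_le_of_le hp.adm.tendsto tendsto_const_nhds
      (fun x => le_max_left _ _) hle

lemma recProf_of_le {x : ℝ} (hφ : IsAdm (pot a) (pot b) φ) (hx : x ≤ ℓ - (pot b - pot a)) :
    recProf b ℓ φ x = φ x :=
  max_eq_left ((min_le_left _ _).trans (by linarith [hφ.near_le x]))

lemma inBdd_rec (h : Data a b) (hφ : IsAdm (pot a) (pot b) φ) :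
    InBdd b ℓ (recDens a b ℓ u) (recProf b ℓ φ) := by
  refine ⟨fun x hx => ?_, Eventually.of_forall fun x hx => ?_⟩
  · rw [recProf, min_eq_right (by linarith), max_eq_right (hφ.le_far x)]
  · rw [recDens, if_neg (by linarith [h.pot_lt])]

lemma abs_recProf_sub_le (hφ : IsAdm (pot a) (pot b) φ) (x : ℝ) :
    |φ x - recProf b ℓ φ x| ≤ pot b - φ (ℓ - (pot b - pot a)) := by
  rcases le_total x (ℓ - (pot b - pot a)) with hx | hx
  · rw [recProf_of_le hφ hx, sub_self, abs_zero]
    linarith [hφ.le_far (ℓ - (pot b - pot a))]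
  · have h1 : recProf b ℓ φ x ≤ pot b := max_le (hφ.le_far x) (min_le_right _ _)
    have h2 : φ x ≤ recProf b ℓ φ x := le_max_left _ _
    have h3 := hφ.mono hx
    rw [abs_sub_comm, abs_of_nonneg (by linarith)]
    linarith

lemma tendstoUniformly_recProf (hφ : IsAdm (pot a) (pot b) φ) :
    TendstoUniformly (fun ℓ => recProf b ℓ φ) φ atTop := by
  rw [Metric.tendstoUniformly_iff]
  intro ε hε
  have h1 : Tendsto (fun ℓ => pot b - φ (ℓ - (pot b - pot a))) atTop (𝓝 0) := by
    have := (hφ.tendsto.comp (tendsto_atTop_add_const_right atTop (-(pot b - pot a))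
      tendsto_id)).const_sub (pot b)
    rw [sub_self] at this
    exact this
  filter_upwards [h1.eventually_lt_const hε] with ℓ hℓ x
  exact (abs_recProf_sub_le hφ x).trans_lt hℓ

lemma tendsto_integral_recDens (hp : IsPair (pot a) (pot b) u φ) (h : Data a b) {f : ℝ → ℝ}
    (hf : Integrable f halfVol) :
    Tendsto (fun ℓ => ∫ x, recDens a b ℓ u x * f x ∂halfVol) atTop
      (𝓝 (∫ x, u x * f x ∂halfVol)) := by
  refine tendsto_integral_filter_of_dominated_convergence (fun x => |f x|) ?_ ?_ hf.norm ?_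
  · refine Eventually.of_forall fun ℓ => ?_
    have : Measurable (recDens a b ℓ u) :=
      Measurable.ite measurableSet_Iio hp.measurable measurable_const
    exact this.aestronglyMeasurable.mul hf.aestronglyMeasurable
  · refine Eventually.of_forall fun ℓ => Eventually.of_forall fun x => ?_
    rw [Real.norm_eq_abs, abs_mul]
    refine mul_le_of_le_one_left (abs_nonneg _) ?_
    unfold recDens
    split_ifs
    · exact abs_le.2 ⟨by linarith [(hp.mem x).1], (hp.mem x).2⟩
    · exact abs_le.2 ⟨by linarith [h.far_pos], h.lt_one.le⟩
  · refine Eventually.of_forall fun x => tendsto_const_nhds.congr' ?_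
    filter_upwards [eventually_gt_atTop (x + (pot b - pot a))] with ℓ hℓ
    rw [recDens, if_pos (by linarith)]

/-- The energy of the recovery sequence. -/
lemma eventually_integral_exc_rec_le (h : Data a b) (hp : IsPair (pot a) (pot b) u φ)
    (hd : InDom (pot b) u φ) {ε : ℝ} (hε : 0 < ε) :
    ∀ᶠ ℓ in atTop, ∫ x in (0 : ℝ)..ℓ, exc (pot b) (recDens a b ℓ u) (recProf b ℓ φ) x ≤
      (∫ x, exc (pot b) u φ x ∂halfVol) + ε := by
  set T := pot b - pot a with hT
  have hT0 : 0 < T := sub_pos.2 h.pot_lt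
  set C := 2 / (Real.sigmoid (pot b) * (1 - Real.sigmoid (pot b))) + 1 with hC
  have hC0 : 0 < C := by
    have := sigmoid_var_pos (pot b)
    positivity
  have hm : Tendsto (fun ℓ : ℝ => ℓ - T) atTop atTop :=
    tendsto_atTop_add_const_right atTop (-T) tendsto_id
  have hlim : Tendsto (fun ℓ => (∫ x in (0 : ℝ)..(ℓ - T), exc (pot b) u φ x) +
      T * (C * (pot b - φ (ℓ - T)))) atTop (𝓝 (∫ x, exc (pot b) u φ x ∂halfVol)) := by
    have h1 := (hp.tendsto_integral_exc h.neg_pot_lt hd).comp hm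
    have h2 := (((hp.adm.tendsto.comp hm).const_sub (pot b)).const_mul C).const_mul T
    have h3 := h1.add h2
    rw [sub_self, mul_zero, mul_zero, add_zero] at h3
    exact h3
  filter_upwards [hlim.eventually_lt_const (by linarith : _ < (∫ x, exc (pot b) u φ x ∂halfVol) + ε),
    eventually_ge_atTop T] with ℓ hℓ hℓT
  refine le_trans ?_ hℓ.le
  have hr := isPair_rec h hp hℓT
  have hmℓ : ℓ - T ≤ ℓ := by linarith
  rw [← intervalIntegral.integral_add_adjacent_intervals (hr.intervalIntegrable_exc 0 (ℓ - T))
    (hr.intervalIntegrable_exc (ℓ - T) ℓ)]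
  refine add_le_add (le_of_eq ?_) ?_
  · refine intervalIntegral.integral_congr_ae ?_
    have hne : ∀ᵐ x : ℝ, x ≠ ℓ - T := by simp [ae_iff, measure_singleton]
    filter_upwards [hne] with x hxne hx
    rw [uIoc_of_le (by linarith)] at hx
    have hlt : x < ℓ - T := hx.2.lt_of_ne hxne
    have heq : recProf b ℓ φ =ᶠ[𝓝 x] φ := by
      filter_upwards [Iio_mem_nhds hlt] with y hy
      exact recProf_of_le hp.adm (le_of_lt hy)
    rw [exc, exc, heq.deriv_eq, heq.eq_of_nhds, recDens, if_pos hlt]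
  · have hbd : ∀ x ∈ Icc (ℓ - T) ℓ, exc (pot b) (recDens a b ℓ u) (recProf b ℓ φ) x ≤
        C * (pot b - φ (ℓ - T)) := by
      intro x hx
      refine (hr.exc_le h.neg_pot_lt x).trans ?_
      rw [recDens, if_neg (not_lt.2 hx.1), h.sigmoid_far, sub_self]
      have h1 : φ (ℓ - T) ≤ recProf b ℓ φ x := (hp.adm.mono hx.1).trans (le_max_left _ _)
      rw [hC, h.sigmoid_far] at *
      refine mul_le_mul_of_nonneg_left ?_ hC0.le
      linarith
    refine (intervalIntegral.integral_mono_on hmℓ (hr.intervalIntegrable_exc _ _)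
      intervalIntegrable_const hbd).trans (le_of_eq ?_)
    rw [intervalIntegral.integral_const, smul_eq_mul, sub_sub_cancel]

end Recovery

/-! ### The functionals on an abstract phase space -/

section Abstract

variable {X : Type*} [TopologicalSpace X]

/-- A minimizing family of a coercive lower semicontinuous functional with a unique minimizer
converges to it. -/
lemma tendsto_of_isUniqueMinimizer {F : X → EReal} (hlsc : LowerSemicontinuous F)
    (hco : Coercive F) {p : X} (hp : IsUniqueMinimizer F p) {r : ℝ} (hr : F p = r) {ι : Type*}
    {l : Filter ι} {y : ι → X} (hy : ∀ ε : ℝ, 0 < ε → ∀ᶠ i in l, F (y i) ≤ (r + ε : ℝ)) :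
    Tendsto y l (𝓝 p) := by
  rw [tendsto_nhds]
  intro V hV hpV
  set K := closure {x | F x ≤ ((r + 1 : ℝ) : EReal)} ∩ Vᶜ with hK
  have hKc : IsCompact K := (hco (r + 1)).inter_right hV.isClosed_compl
  rcases K.eq_empty_or_nonempty with he | hne
  · filter_upwards [hy 1 one_pos] with i hi
    by_contra hcon
    have : y i ∈ K := ⟨subset_closure hi, hcon⟩
    rw [he] at this
    exact this
  · obtain ⟨q, hqK, hq⟩ := (hlsc.lowerSemicontinuousOn K).exists_isMinOn hne hKc
    have hlt : (r : EReal) < F q := by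
      by_contra hcon
      have h1 : F q ≤ F p := by rw [hr]; exact not_lt.1 hcon
      have h2 : q = p := hp.2 q fun x => h1.trans (hp.1 x)
      exact hqK.2 (h2 ▸ hpV)
    obtain ⟨s, hs1, hs2⟩ := EReal.lt_iff_exists_real_btwn.1 hlt
    have hs1' : r < s := EReal.coe_lt_coe_iff.1 hs1
    filter_upwards [hy 1 one_pos, hy (s - r) (by linarith)] with i hi hi'
    by_contra hcon
    have hmem : y i ∈ K := ⟨subset_closure hi, hcon⟩
    have h1 : F q ≤ F (y i) := hq hmem
    rw [add_sub_cancel] at hi'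
    exact absurd (h1.trans hi') (not_le.2 hs2)

end Abstract

/-- A topological space whose points are the pairs `(u, φ)` on `[0, ∞)`, with the weak-* topology
for `u` and the topology of uniform convergence for `φ`. Both phase spaces `𝒳⁺` and, after a
reflection, `𝒳⁻` are of this form. -/
structure HalfLineModel (a b : ℝ) {X : Type*} [TopologicalSpace X] (U Φ : X → ℝ → ℝ) : Prop where
  isPair : ∀ p, IsPair (pot a) (pot b) (U p) (Φ p)
  exists_eq : ∀ u φ, IsPair (pot a) (pot b) u φ → ∃ p, U p =ᵐ[halfVol] u ∧ Φ p = φ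
  ext : ∀ p q, U p =ᵐ[halfVol] U q → Φ p = Φ q → p = q
  le_nhds_iff : ∀ (l : Filter X) (x : X), l ≤ 𝓝 x ↔
    (∀ f, Integrable f halfVol →
      Tendsto (fun p => ∫ t, U p t * f t ∂halfVol) l (𝓝 (∫ t, U x t * f t ∂halfVol))) ∧
    TendstoUniformly Φ (Φ x) l

section Congr

variable {b β ℓ : ℝ} {u v φ : ℝ → ℝ}

lemma exc_congr (h : u =ᵐ[halfVol] v) : exc β u φ =ᵐ[halfVol] exc β v φ := by
  filter_upwards [h] with x hx
  rw [exc, exc, hx]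

lemma inDom_congr (h : u =ᵐ[halfVol] v) : InDom β u φ ↔ InDom β v φ := by
  refine and_congr_left fun _ => integrable_congr ?_
  filter_upwards [h] with x hx
  rw [hx]

lemma inBdd_congr (hℓ : 0 < ℓ) (h : u =ᵐ[halfVol] v) : InBdd b ℓ u φ ↔ InBdd b ℓ v φ := by
  refine and_congr_right fun _ => ?_
  have h1 := (ae_restrict_iff' measurableSet_Ici).1 h
  constructor
  · intro h2
    filter_upwards [h1, h2] with x hx hx2 hxℓ
    rw [← hx (hℓ.le.trans hxℓ), hx2 hxℓ]
  · intro h2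
    filter_upwards [h1, h2] with x hx hx2 hxℓ
    rw [hx (hℓ.le.trans hxℓ), hx2 hxℓ]

lemma integral_exc_congr (hℓ : 0 < ℓ) (h : u =ᵐ[halfVol] v) :
    ∫ x in (0 : ℝ)..ℓ, exc β u φ x = ∫ x in (0 : ℝ)..ℓ, exc β v φ x := by
  refine intervalIntegral.integral_congr_ae ?_
  filter_upwards [(ae_restrict_iff' measurableSet_Ici).1 (exc_congr (β := β) (φ := φ) h)]
    with x hx hxℓ
  rw [uIoc_of_le hℓ.le] at hxℓ
  exact hx hxℓ.1.le

end Congr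

section Functionals

variable {X : Type*} (b : ℝ) (U Φ : X → ℝ → ℝ)

open Classical in
/-- The limiting functional on a model. -/
def modelEnergy (p : X) : EReal :=
  if InDom (pot b) (U p) (Φ p) then ((∫ x, exc (pot b) (U p) (Φ p) x ∂halfVol : ℝ) : EReal) else ⊤

open Classical in
/-- The functional on `(0, ℓ)` on a model. -/
def modelEnergyL (ℓ : ℝ) (p : X) : EReal :=
  if InBdd b ℓ (U p) (Φ p) then ((∫ x in (0 : ℝ)..ℓ, exc (pot b) (U p) (Φ p) x : ℝ) : EReal)
  else ⊤

variable {b U Φ}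

lemma modelEnergy_of_inDom {p : X} (hp : InDom (pot b) (U p) (Φ p)) :
    modelEnergy b U Φ p = ((∫ x, exc (pot b) (U p) (Φ p) x ∂halfVol : ℝ) : EReal) := if_pos hp

lemma inDom_of_lt_top {p : X} (hp : modelEnergy b U Φ p < ⊤) : InDom (pot b) (U p) (Φ p) := by
  by_contra hcon
  rw [modelEnergy, if_neg hcon] at hp
  exact lt_irrefl _ hp

lemma modelEnergyL_of_inBdd {ℓ : ℝ} {p : X} (hp : InBdd b ℓ (U p) (Φ p)) :
    modelEnergyL b U Φ ℓ p = ((∫ x in (0 : ℝ)..ℓ, exc (pot b) (U p) (Φ p) x : ℝ) : EReal) :=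
  if_pos hp

lemma inBdd_of_lt_top {ℓ : ℝ} {p : X} (hp : modelEnergyL b U Φ ℓ p < ⊤) :
    InBdd b ℓ (U p) (Φ p) := by
  by_contra hcon
  rw [modelEnergyL, if_neg hcon] at hp
  exact lt_irrefl _ hp

end Functionals

namespace HalfLineModel

variable {a b : ℝ} {X : Type*} [TopologicalSpace X] {U Φ : X → ℝ → ℝ}

/-- The functional on `(0, ℓ)` is the restriction of the limiting one to the pairs that are constant
beyond `ℓ`. -/
lemma modelEnergy_eq_of_inBdd (hm : HalfLineModel a b U Φ) (h : Data a b) {ℓ : ℝ} {p : X}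
    (hp : InBdd b ℓ (U p) (Φ p)) : modelEnergy b U Φ p = modelEnergyL b U Φ ℓ p := by
  rw [modelEnergyL_of_inBdd hp, modelEnergy_of_inDom (inDom_of_inBdd h (hm.isPair p) hp),
    integral_exc_of_inBdd h (hm.isPair p) hp]

lemma modelEnergy_le (hm : HalfLineModel a b U Φ) (h : Data a b) (ℓ : ℝ) (p : X) :
    modelEnergy b U Φ p ≤ modelEnergyL b U Φ ℓ p := by
  by_cases hp : InBdd b ℓ (U p) (Φ p)
  · exact (hm.modelEnergy_eq_of_inBdd h hp).le
  · rw [modelEnergyL, if_neg hp]; exact le_top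

lemma bounds (hm : HalfLineModel a b U Φ) (h : Data a b) :
    ∃ C : ℝ, 1 < C ∧ ∀ p : X, InDom (pot b) (U p) (Φ p) →
      ∫ x, exc (pot b) (U p) (Φ p) x ∂halfVol ≤ C * ((∫ x, (U p x - b) ^ 2 ∂halfVol) +
        ∫ x, (pot b - Φ p x) ∂halfVol) + C ∧
      1 / C * ((∫ x, (U p x - b) ^ 2 ∂halfVol) + ∫ x, (pot b - Φ p x) ∂halfVol) - C ≤
        ∫ x, exc (pot b) (U p) (Φ p) x ∂halfVol := by
  obtain ⟨κ, hκ0, hκ⟩ := exists_redDens_ge h.neg_pot_lt h.pot_lt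
  set C₁ := 2 / (Real.sigmoid (pot b) * (1 - Real.sigmoid (pot b))) + 1 with hC₁
  set k := min (1 / 4) (κ / 6) with hk
  have hk0 : 0 < k := by positivity
  have hC₁0 : 0 < C₁ := by
    have := sigmoid_var_pos (pot b)
    positivity
  refine ⟨max C₁ (max (1 / k) (2 / κ)) + 1, ?_, fun p hp => ?_⟩
  · linarith [hC₁0.trans_le (le_max_left C₁ (max (1 / k) (2 / κ)))]
  set C := max C₁ (max (1 / k) (2 / κ)) + 1 with hC
  have c1 : C₁ ≤ C := by linarith [le_max_left C₁ (max (1 / k) (2 / κ))]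
  have c2 : 1 / k ≤ C := by
    linarith [le_max_left (1 / k) (2 / κ), le_max_right C₁ (max (1 / k) (2 / κ))]
  have c3 : 2 / κ ≤ C := by
    linarith [le_max_right (1 / k) (2 / κ), le_max_right C₁ (max (1 / k) (2 / κ))]
  have hC0 : 0 < C := hC₁0.trans_le c1
  have h1 := (hm.isPair p).integral_exc_le h.neg_pot_lt hp
  have h2 := (hm.isPair p).le_integral_exc hκ0 hκ h.neg_pot_lt hp
  rw [← hC₁] at h1
  rw [← hk] at h2
  rw [h.sigmoid_far] at h2
  rw [h.sigmoid_far] at h1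
  have hN : 0 ≤ (∫ x, (U p x - b) ^ 2 ∂halfVol) + ∫ x, (pot b - Φ p x) ∂halfVol :=
    add_nonneg (integral_nonneg fun x => sq_nonneg _)
      (integral_nonneg fun x => (hm.isPair p).gap_nonneg x)
  set N := (∫ x, (U p x - b) ^ 2 ∂halfVol) + ∫ x, (pot b - Φ p x) ∂halfVol with hN'
  have c4 : 1 / C ≤ k := by rwa [one_div_le hC0 hk0]
  constructor
  · nlinarith [mul_le_mul_of_nonneg_right c1 hN]
  · nlinarith [mul_le_mul_of_nonneg_right c4 hN]

lemma lowerSemicontinuous (hm : HalfLineModel a b U Φ) (h : Data a b) :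
    LowerSemicontinuous (modelEnergy b U Φ) := by
  intro x t ht
  induction t with
  | bot =>
    refine Eventually.of_forall fun p => ?_
    change ⊥ < modelEnergy b U Φ p
    unfold modelEnergy
    split_ifs
    · exact EReal.bot_lt_coe _
    · exact bot_lt_top
  | top => exact absurd ht not_top_lt
  | coe t =>
    obtain ⟨h1, h2⟩ := (hm.le_nhds_iff (𝓝 x) x).1 le_rfl
    have := eventually_lt_energy h.neg_pot_lt h.pot_lt hm.isPair (hm.isPair x) h1 h2 (t := t)
      fun hd => by
        rw [modelEnergy_of_inDom hd] at ht
        exact EReal.coe_lt_coe_iff.1 ht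
    filter_upwards [this] with p hp
    by_cases hd : InDom (pot b) (U p) (Φ p)
    · rw [modelEnergy_of_inDom hd]
      exact EReal.coe_lt_coe_iff.2 (hp hd)
    · rw [modelEnergy, if_neg hd]
      exact EReal.coe_lt_top t

lemma t2Space (hm : HalfLineModel a b U Φ) : T2Space X := by
  rw [t2_iff_ultrafilter]
  intro x y F hx hy
  obtain ⟨hx1, hx2⟩ := (hm.le_nhds_iff F x).1 hx
  obtain ⟨hy1, hy2⟩ := (hm.le_nhds_iff F y).1 hy
  have hint : ∀ z s, halfVol s < ⊤ → IntegrableOn (U z) s halfVol := fun z s hs =>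
    Measure.integrableOn_of_bounded (M := 1) hs.ne (hm.isPair z).measurable.aestronglyMeasurable
      (Eventually.of_forall fun t =>
        abs_le.2 ⟨by linarith [((hm.isPair z).mem t).1], ((hm.isPair z).mem t).2⟩)
  refine hm.ext x y ?_ ?_
  · refine ae_eq_of_forall_setIntegral_eq_of_sigmaFinite (fun s _ hs => hint x s hs)
      (fun s _ hs => hint y s hs) fun s hs hlt => ?_
    have hf : Integrable (s.indicator fun _ => (1 : ℝ)) halfVol :=
      (integrable_indicator_iff hs).2 (integrableOn_const hlt.ne)
    have := tendsto_nhds_unique (hx1 _ hf) (hy1 _ hf)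
    have e : ∀ z, ∫ t, U z t * s.indicator (fun _ => (1 : ℝ)) t ∂halfVol =
        ∫ t in s, U z t ∂halfVol := by
      intro z
      rw [← integral_indicator hs]
      congr 1
      ext t
      by_cases ht : t ∈ s <;> simp [ht]
    rwa [e, e] at this
  · ext t
    exact tendsto_nhds_unique (hx2.tendsto_at t) (hy2.tendsto_at t)

lemma isCompact_decay (hm : HalfLineModel a b U Φ) (M : ℝ) :
    IsCompact {p : X | ∀ x, 0 ≤ x → x * (pot b - Φ p x) ≤ M} := by
  rw [isCompact_iff_ultrafilter_le_nhds']
  intro F hF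
  obtain ⟨φ₀, hφ₀, hM₀, hlim⟩ := exists_adm_limit F (fun p => (hm.isPair p).adm) hF
  obtain ⟨u₀, hu₀, hu₀1, hlimu⟩ := exists_weakStar_limit F (fun p => (hm.isPair p).measurable)
    (fun p => Eventually.of_forall (hm.isPair p).mem)
  obtain ⟨x, hxu, hxφ⟩ := hm.exists_eq u₀ φ₀ ⟨hu₀, hu₀1, hφ₀⟩
  refine ⟨x, by rw [mem_ofPred_eq, hxφ]; exact hM₀, (hm.le_nhds_iff F x).2 ⟨fun f hf => ?_, ?_⟩⟩
  · have : ∫ t, U x t * f t ∂halfVol = ∫ t, u₀ t * f t ∂halfVol := by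
      refine integral_congr_ae ?_
      filter_upwards [hxu] with t ht
      rw [ht]
    rw [this]
    exact hlimu f hf
  · rw [hxφ]; exact hlim

/-- A bound on the energy controls the rate of convergence of the profile, which is monotone with an
integrable distance to its limit. -/
lemma exists_decay (hm : HalfLineModel a b U Φ) (h : Data a b) (t : ℝ) :
    ∃ M : ℝ, ∀ p : X, modelEnergy b U Φ p ≤ t → ∀ x, 0 ≤ x → x * (pot b - Φ p x) ≤ M := by
  obtain ⟨C, hC1, hC⟩ := hm.bounds h
  refine ⟨C * (t + C), fun p hp x hx => ?_⟩
  have hd := inDom_of_lt_top (hp.trans_lt (EReal.coe_lt_top t))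
  rw [modelEnergy_of_inDom hd, EReal.coe_le_coe_iff] at hp
  have h1 := (hC p hd).2
  have h2 : ∫ x, (pot b - Φ p x) ∂halfVol ≤ C * (t + C) := by
    have h3 : 0 ≤ ∫ x, (U p x - b) ^ 2 ∂halfVol := integral_nonneg fun x => sq_nonneg _
    have h4 : 1 / C * ((∫ x, (U p x - b) ^ 2 ∂halfVol) + ∫ x, (pot b - Φ p x) ∂halfVol) ≤ t + C := by
      linarith
    rw [one_div, inv_mul_le_iff₀ (by linarith)] at h4
    linarith
  refine le_trans ?_ h2
  have hi : IntegrableOn (fun x => pot b - Φ p x) (Ioc 0 x) volume :=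
    ((hm.isPair p).intervalIntegrable_gap 0 x).1
  calc x * (pot b - Φ p x) = ∫ _ in Ioc 0 x, (pot b - Φ p x) := by
        rw [setIntegral_const]
        simp [Measure.real, hx]
    _ ≤ ∫ y in Ioc 0 x, (pot b - Φ p y) := by
        refine setIntegral_mono_on (integrableOn_const (by simp)) hi measurableSet_Ioc fun y hy => ?_
        linarith [(hm.isPair p).adm.mono hy.2]
    _ ≤ ∫ y, (pot b - Φ p y) ∂halfVol :=
        setIntegral_mono_set hd.2 (Eventually.of_forall (hm.isPair p).gap_nonneg)
          (Ioc_subset_Ioi_self.trans Ioi_subset_Ici_self).eventuallyLE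

lemma coercive (hm : HalfLineModel a b U Φ) (h : Data a b) : Coercive (modelEnergy b U Φ) := by
  intro t
  have := hm.t2Space
  obtain ⟨M, hM⟩ := hm.exists_decay h t
  exact (hm.isCompact_decay M).closure_of_subset fun p hp => hM p hp

lemma equiCoercive (hm : HalfLineModel a b U Φ) (h : Data a b) (ℓ : ℕ → ℝ) :
    EquiCoercive fun n => modelEnergyL b U Φ (ℓ n) := by
  intro x hx
  have := hm.t2Space
  obtain ⟨t, ht1, -⟩ := EReal.lt_iff_exists_real_btwn.1 hx
  obtain ⟨M, hM⟩ := hm.exists_decay h t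
  obtain ⟨N, hN⟩ := eventually_atTop.1 (eventually_lt_of_limsup_lt ht1)
  have hfin : (x '' Iio N).Finite := (finite_Iio N).image x
  refine (hfin.isCompact.union (hm.isCompact_decay M)).closure_of_subset ?_
  rintro _ ⟨n, rfl⟩
  rcases lt_or_ge n N with hn | hn
  · exact Or.inl ⟨n, hn, rfl⟩
  · exact Or.inr (hM _ ((hm.modelEnergy_le h (ℓ n) (x n)).trans (hN n hn).le))

lemma exists_recovery (hm : HalfLineModel a b U Φ) (h : Data a b) {x : X}
    (hx : InDom (pot b) (U x) (Φ x)) :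
    ∃ y : ℝ → X, Tendsto y atTop (𝓝 x) ∧ ∀ ε : ℝ, 0 < ε → ∀ᶠ ℓ in atTop,
      modelEnergyL b U Φ ℓ (y ℓ) ≤ ((∫ t, exc (pot b) (U x) (Φ x) t ∂halfVol) + ε : ℝ) := by
  have hp := hm.isPair x
  have hex : ∀ ℓ, ∃ y, pot b - pot a ≤ ℓ →
      U y =ᵐ[halfVol] recDens a b ℓ (U x) ∧ Φ y = recProf b ℓ (Φ x) := by
    intro ℓ
    by_cases hℓ : pot b - pot a ≤ ℓ
    · obtain ⟨y, hy⟩ := hm.exists_eq _ _ (isPair_rec h hp hℓ)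
      exact ⟨y, fun _ => hy⟩
    · exact ⟨x, fun h' => absurd h' hℓ⟩
  choose y hy using hex
  refine ⟨y, ?_, fun ε hε => ?_⟩
  · rw [Tendsto, hm.le_nhds_iff]
    refine ⟨fun f hf => tendsto_map'_iff.2 ?_, ?_⟩
    · refine (tendsto_integral_recDens hp h hf).congr' ?_
      filter_upwards [eventually_ge_atTop (pot b - pot a)] with ℓ hℓ
      refine integral_congr_ae ?_
      filter_upwards [(hy ℓ hℓ).1] with t ht
      rw [ht]
    · have h1 := tendstoUniformly_recProf (b := b) hp.adm
      rw [Metric.tendstoUniformly_iff] at h1 ⊢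
      intro ε hε
      rw [eventually_map]
      filter_upwards [h1 ε hε, eventually_ge_atTop (pot b - pot a)] with ℓ h2 hℓ
      rwa [(hy ℓ hℓ).2]
  · filter_upwards [eventually_integral_exc_rec_le h hp hx hε,
      eventually_ge_atTop (pot b - pot a)] with ℓ h1 hℓ
    have hℓ0 : 0 < ℓ := (sub_pos.2 h.pot_lt).trans_le hℓ
    have hB : InBdd b ℓ (U (y ℓ)) (Φ (y ℓ)) := by
      rw [(hy ℓ hℓ).2, inBdd_congr hℓ0 (hy ℓ hℓ).1]
      exact inBdd_rec h hp.adm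
    rw [modelEnergyL_of_inBdd hB, EReal.coe_le_coe_iff, (hy ℓ hℓ).2,
      integral_exc_congr hℓ0 (hy ℓ hℓ).1]
    exact h1

lemma gammaConverges (hm : HalfLineModel a b U Φ) (h : Data a b) {ℓ : ℕ → ℝ}
    (hℓ : Tendsto ℓ atTop atTop) :
    GammaConverges (fun n => modelEnergyL b U Φ (ℓ n)) (modelEnergy b U Φ) := by
  intro x
  refine ⟨fun y hy => ?_, ?_⟩
  · refine le_of_forall_lt fun t ht => ?_
    obtain ⟨s, hts, hs⟩ := exists_between ht
    refine hts.trans_le (le_liminf_of_le (by isBoundedDefault) ?_)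
    filter_upwards [hy.eventually (hm.lowerSemicontinuous h x s hs)] with n hn
    exact hn.le.trans (hm.modelEnergy_le h (ℓ n) (y n))
  · by_cases hx : InDom (pot b) (U x) (Φ x)
    · obtain ⟨y, hy, hyE⟩ := hm.exists_recovery h hx
      refine ⟨y ∘ ℓ, hy.comp hℓ, ?_⟩
      rw [modelEnergy_of_inDom hx]
      refine le_of_forall_gt fun t ht => ?_
      obtain ⟨s, hs, hst⟩ := EReal.lt_iff_exists_real_btwn.1 ht
      have hs' := EReal.coe_lt_coe_iff.1 hs
      refine lt_of_le_of_lt (limsup_le_of_le (by isBoundedDefault) ?_) hst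
      have := hyE (s - ∫ t, exc (pot b) (U x) (Φ x) t ∂halfVol) (by linarith)
      rw [add_sub_cancel] at this
      exact hℓ.eventually this
    · refine ⟨fun _ => x, tendsto_const_nhds, ?_⟩
      rw [modelEnergy, if_neg hx]
      exact le_top

lemma isUniqueMinimizer_inf (hm : HalfLineModel a b U Φ) (h : Data a b) {p : X}
    (hu : U p =ᵐ[halfVol] densInf a b) (hφ : Φ p = profInf a b) :
    InDom (pot b) (U p) (Φ p) ∧ IsUniqueMinimizer (modelEnergy b U Φ) p := by
  have hd : InDom (pot b) (U p) (Φ p) := by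
    rw [hφ, inDom_congr hu]; exact inDom_inf h
  have he : ∫ x, exc (pot b) (U p) (Φ p) x ∂halfVol =
      ∫ x, exc (pot b) (densInf a b) (profInf a b) x ∂halfVol := by
    rw [hφ]; exact integral_congr_ae (exc_congr hu)
  refine ⟨hd, fun q => ?_, fun q hq => ?_⟩
  · by_cases hqd : InDom (pot b) (U q) (Φ q)
    · rw [modelEnergy_of_inDom hd, modelEnergy_of_inDom hqd, EReal.coe_le_coe_iff, he]
      exact integral_exc_inf_le h (hm.isPair q) hqd
    · rw [modelEnergy, modelEnergy, if_neg hqd]; exact le_top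
  · have h1 := hq p
    rw [modelEnergy_of_inDom hd] at h1
    have hqd := inDom_of_lt_top (h1.trans_lt (EReal.coe_lt_top _))
    rw [modelEnergy_of_inDom hqd, EReal.coe_le_coe_iff, he] at h1
    obtain ⟨h2, h3⟩ := eq_inf_of_integral_exc_le h (hm.isPair q) hqd h1
    exact hm.ext q p (h2.trans hu.symm) (h3.trans hφ.symm)

lemma isUniqueMinimizer_fin (hm : HalfLineModel a b U Φ) (h : Data a b) {A ℓ : ℝ}
    (hA1 : b - 1 / 2 < A) (hA2 : A < 1 / 2) (hℓ : 0 < ℓ) (hw : wave A a ℓ = b) {p : X}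
    (hu : U p =ᵐ[halfVol] densFin A a ℓ) (hφ : Φ p = profFin A a ℓ) :
    IsUniqueMinimizer (modelEnergyL b U Φ ℓ) p := by
  have hb : InBdd b ℓ (U p) (Φ p) := by
    rw [hφ, inBdd_congr hℓ hu]; exact inBdd_fin hℓ hw
  have he : ∫ x in (0 : ℝ)..ℓ, exc (pot b) (U p) (Φ p) x =
      ∫ x in (0 : ℝ)..ℓ, exc (pot b) (densFin A a ℓ) (profFin A a ℓ) x := by
    rw [hφ]; exact integral_exc_congr hℓ hu
  refine ⟨fun q => ?_, fun q hq => ?_⟩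
  · by_cases hqb : InBdd b ℓ (U q) (Φ q)
    · rw [modelEnergyL_of_inBdd hb, modelEnergyL_of_inBdd hqb, EReal.coe_le_coe_iff, he]
      exact integral_exc_fin_le h hA1 hA2 hℓ hw (hm.isPair q) hqb
    · rw [modelEnergyL, modelEnergyL, if_neg hqb]; exact le_top
  · have h1 := hq p
    rw [modelEnergyL_of_inBdd hb] at h1
    have hqb := inBdd_of_lt_top (h1.trans_lt (EReal.coe_lt_top _))
    rw [modelEnergyL_of_inBdd hqb, EReal.coe_le_coe_iff, he] at h1
    obtain ⟨h2, h3⟩ := eq_fin_of_integral_exc_le h hA1 hA2 hℓ hw (hm.isPair q) hqb h1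
    exact hm.ext q p (h2.trans hu.symm) (h3.trans hφ.symm)

/-- Minimizers on `(0, ℓ)` converge to the minimizer on the half-line. -/
lemma tendsto_minimizers (hm : HalfLineModel a b U Φ) (h : Data a b) {p : X}
    (hp : InDom (pot b) (U p) (Φ p)) (hmin : IsUniqueMinimizer (modelEnergy b U Φ) p) {q : ℝ → X}
    (hq : ∀ᶠ ℓ in atTop, ∀ r, modelEnergyL b U Φ ℓ (q ℓ) ≤ modelEnergyL b U Φ ℓ r) :
    Tendsto q atTop (𝓝 p) := by
  obtain ⟨y, -, hy⟩ := hm.exists_recovery h hp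
  refine tendsto_of_isUniqueMinimizer (hm.lowerSemicontinuous h) (hm.coercive h) hmin
    (modelEnergy_of_inDom hp) fun ε hε => ?_
  filter_upwards [hy ε hε, hq] with ℓ h1 h2
  exact (hm.modelEnergy_le h ℓ (q ℓ)).trans ((h2 _).trans h1)

end HalfLineModel

/-! ### The boundary value problem on a bounded interval -/

section BVP

variable {A a b ℓ : ℝ}

lemma solvesBVP_wave (ha : |a - 1 / 2| < A) (hw : wave A a ℓ = b) :
    SolvesBVP Side.pos a b ℓ (wave A a) := by
  have hd := hasDerivAt_wave (A := A) (a := a)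
  refine ⟨continuous_wave.continuousOn, fun x _ => (hd x).differentiableAt, fun x _ => ?_,
    wave_zero ha, hw⟩
  have h1 : deriv (wave A a) = fun x => wave A a x * (1 - wave A a x) - (1 / 4 - A ^ 2) :=
    funext fun x => (hd x).deriv
  have h2 : DifferentiableAt ℝ (fun y => wave A a y * (1 - wave A a y)) x :=
    (hd x).differentiableAt.mul ((hd x).differentiableAt.const_sub 1)
  rw [h1]
  exact h2.hasDerivAt.sub_const _

/-- A solution of the second order equation has a constant flux, so it solves a Riccati equation,
and the boundary values determine the flux. -/
lemma eqOn_wave_of_solvesBVP (ha : |a - 1 / 2| < A) (hℓ : 0 < ℓ) (hw : wave A a ℓ = b) {v : ℝ → ℝ}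
    (hv : SolvesBVP Side.pos a b ℓ v) : EqOn v (wave A a) (Icc 0 ℓ) := by
  have hcl : closure (Side.pos.interval ℓ) = Icc 0 ℓ := closure_Ioo hℓ.ne
  have hd : ∀ x ∈ Ioo 0 ℓ, HasDerivAt (fun y => deriv v y - v y * (1 - v y)) 0 x := by
    intro x hx
    have h1 := hv.differentiable x hx
    have h2 : DifferentiableAt ℝ (fun y => v y * (1 - v y)) x := h1.mul (h1.const_sub 1)
    exact ((hv.equation x hx).sub h2.hasDerivAt).congr_deriv (sub_self _)
  obtain ⟨J, hJ⟩ := isOpen_Ioo.exists_is_const_of_deriv_eq_zero isPreconnected_Ioo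
    (fun x hx => (hd x hx).differentiableAt.differentiableWithinAt) fun x hx => (hd x hx).deriv
  have hr : ∀ x ∈ Ioo 0 ℓ, HasDerivAt v (v x * (1 - v x) - -J) x := by
    intro x hx
    refine (hv.differentiable x hx).hasDerivAt.congr_deriv ?_
    linarith [hJ x hx]
  have := riccati_unique hℓ (hcl ▸ hv.continuousOn) continuous_wave.continuousOn hr
    (fun x _ => hasDerivAt_wave x) (hv.zero.trans (wave_zero ha).symm)
  exact this.2 (this.1 (hv.endpoint.trans hw.symm))

/-- The pair is given by a solution of the boundary value problem on `(0, ℓ)` and is constant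
beyond `ℓ`. -/
def IsFinStationary (a b ℓ : ℝ) (u φ : ℝ → ℝ) : Prop :=
  InBdd b ℓ u φ ∧ ∃ v : ℝ → ℝ, SolvesBVP Side.pos a b ℓ v ∧ u =ᵐ[volume.restrict (Ioo 0 ℓ)] v ∧
    ∀ x ∈ Ioo 0 ℓ, φ x = pot (v x)

lemma isFinStationary_iff {u φ : ℝ → ℝ} (hp : IsPair (pot a) (pot b) u φ) (ha : |a - 1 / 2| < A)
    (hℓ : 0 < ℓ) (hw : wave A a ℓ = b) :
    IsFinStationary a b ℓ u φ ↔ u =ᵐ[halfVol] densFin A a ℓ ∧ φ = profFin A a ℓ := by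
  constructor
  · rintro ⟨hb, v, hv, hu, hφ⟩
    have heq := eqOn_wave_of_solvesBVP ha hℓ hw hv
    constructor
    · rw [halfVol, ← restrict_Ioi_eq_restrict_Ici]
      refine (ae_restrict_iff' measurableSet_Ioi).2 ?_
      filter_upwards [(ae_restrict_iff' measurableSet_Ioo).1 hu, hb.2] with x hx hx' hx0
      rcases lt_or_ge x ℓ with h | h
      · rw [hx ⟨hx0, h⟩, heq ⟨le_of_lt hx0, h.le⟩, densFin_of_mem ⟨le_of_lt hx0, h.le⟩]
      · rw [hx' h, densFin_of_ge hℓ hw h]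
    · ext x
      rcases le_or_gt x 0 with h0 | h0
      · rw [hp.adm.left x h0, profFin, max_eq_right h0, min_eq_left hℓ.le, wavePot, wave_zero ha]
      rcases lt_or_ge x ℓ with h | h
      · rw [hφ x ⟨h0, h⟩, heq ⟨h0.le, h.le⟩, profFin, max_eq_left h0.le, min_eq_left h.le, wavePot]
      · rw [hb.1 x h, profFin_of_ge hℓ hw h]
  · rintro ⟨hu, rfl⟩
    refine ⟨(inBdd_congr hℓ hu).2 (inBdd_fin hℓ hw), wave A a, solvesBVP_wave ha hw, ?_,
      fun x hx => ?_⟩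
    · refine (ae_restrict_iff' measurableSet_Ioo).2 ?_
      filter_upwards [(ae_restrict_iff' measurableSet_Ici).1 hu] with x hx hxm
      rw [hx hxm.1.le, densFin_of_mem ⟨hxm.1.le, hxm.2.le⟩]
    · rw [profFin, max_eq_left hx.1.le, min_eq_left hx.2.le, wavePot]

end BVP

lemma HalfLineModel.exists_fin {a b : ℝ} {X : Type*} [TopologicalSpace X] {U Φ : X → ℝ → ℝ}
    (hm : HalfLineModel a b U Φ) (h : Data a b) {ℓ : ℝ} (hℓ : pot b - pot a < ℓ) :
    ∃ p : X, (∀ q, IsFinStationary a b ℓ (U q) (Φ q) ↔ q = p) ∧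
      IsUniqueMinimizer (modelEnergyL b U Φ ℓ) p := by
  have hℓ0 : 0 < ℓ := (sub_pos.2 h.pot_lt).trans hℓ
  obtain ⟨A, hA1, hA2, hw⟩ := exists_wave_eq h hℓ
  obtain ⟨p, hu, hφ⟩ := hm.exists_eq _ _ (isPair_fin h hA1 hA2 hℓ0 hw)
  refine ⟨p, fun q => ?_, hm.isUniqueMinimizer_fin h hA1 hA2 hℓ0 hw hu hφ⟩
  rw [isFinStationary_iff (hm.isPair q) (h.abs_sub_lt.trans hA1) hℓ0 hw]
  constructor
  · rintro ⟨h1, h2⟩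
    exact hm.ext q p (h1.trans hu.symm) (h2.trans hφ.symm)
  · rintro rfl
    exact ⟨hu, hφ⟩

/-! ### Reflection of the negative half-line -/

namespace Side

/-- The identity for `pos` and `x ↦ -x` for `neg`: it maps `[0, ∞)` to the half-line. It also acts
on the profiles `φ`. -/
def flip : Side → ℝ → ℝ
  | pos => fun x => x
  | neg => fun x => -x

/-- The identity for `pos` and `u ↦ 1 - u` for `neg`, the action of the reflection on densities. -/
def dual : Side → ℝ → ℝ
  | pos => fun u => u
  | neg => fun u => 1 - u

variable (σ : Side)

@[simp]
lemma flip_flip (x : ℝ) : σ.flip (σ.flip x) = x := by cases σ <;> simp [flip]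

@[simp]
lemma dual_dual (x : ℝ) : σ.dual (σ.dual x) = x := by cases σ <;> simp [dual]

@[fun_prop]
lemma continuous_flip : Continuous σ.flip := by cases σ <;> (unfold flip; fun_prop)

@[fun_prop]
lemma continuous_dual : Continuous σ.dual := by cases σ <;> (unfold dual; fun_prop)

lemma dist_flip (x y : ℝ) : dist (σ.flip x) (σ.flip y) = dist x y := by
  cases σ
  · rfl
  · exact dist_neg_neg x y

lemma dual_mem {u : ℝ} (h : u ∈ Icc (0 : ℝ) 1) : σ.dual u ∈ Icc (0 : ℝ) 1 := by
  cases σ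
  · exact h
  · exact ⟨by simp only [dual]; linarith [h.2], by simp only [dual]; linarith [h.1]⟩

lemma pot_dual (u : ℝ) : pot (σ.dual u) = σ.flip (pot u) := by
  cases σ
  · rfl
  · exact pot_one_sub u

lemma dens_dual (u y p : ℝ) : dens (σ.dual u) (σ.flip y) p = dens u y p := by
  cases σ
  · rfl
  · exact dens_reflect u y p

lemma dual_sub_sq (u v : ℝ) : (σ.dual u - σ.dual v) ^ 2 = (u - v) ^ 2 := by
  cases σ
  · rfl
  · simp only [dual]; ring

lemma flip_injective : Function.Injective σ.flip :=
  Function.LeftInverse.injective (g := σ.flip) σ.flip_flip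

lemma dual_injective : Function.Injective σ.dual :=
  Function.LeftInverse.injective (g := σ.dual) σ.dual_dual

lemma flip_preimage_halfLine : σ.flip ⁻¹' σ.halfLine = Ici 0 := by
  cases σ <;> ext x <;> simp [flip, halfLine]

lemma flip_preimage_interval (ℓ : ℝ) : σ.flip ⁻¹' σ.interval ℓ = Ioo 0 ℓ := by
  cases σ <;> ext x <;> simp [flip, interval, and_comm]

lemma flip_preimage_outer (ℓ : ℝ) : σ.flip ⁻¹' σ.outer ℓ = Ici ℓ := by
  cases σ <;> ext x <;> simp [flip, outer]

lemma flip_proj_flip (x : ℝ) : σ.flip (σ.proj (σ.flip x)) = max 0 x := by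
  cases σ
  · rfl
  · simp only [flip, proj]
    rw [← max_neg_neg]; simp

lemma proj_coe (x : σ.halfLine) : σ.proj x = x := by
  cases σ
  · exact Subtype.ext (max_eq_right x.2)
  · exact Subtype.ext (min_eq_right x.2)

lemma tendsto_flip : Tendsto σ.flip atTop σ.infinity := by
  cases σ
  · exact tendsto_id
  · exact tendsto_neg_atTop_atBot

lemma tendsto_flip' : Tendsto σ.flip σ.infinity atTop := by
  cases σ
  · exact tendsto_id
  · exact tendsto_neg_atBot_atTop

lemma measurableEmbedding_flip : MeasurableEmbedding σ.flip := by
  cases σ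
  · exact MeasurableEmbedding.id
  · exact (MeasurableEquiv.neg ℝ).measurableEmbedding

lemma measurePreserving_flip : MeasurePreserving σ.flip volume volume := by
  cases σ
  · exact MeasurePreserving.id volume
  · exact Measure.measurePreserving_neg volume

lemma measurePreserving_restrict (s : Set ℝ) :
    MeasurePreserving σ.flip (volume.restrict (σ.flip ⁻¹' s)) (volume.restrict s) :=
  σ.measurePreserving_flip.restrict_preimage_emb σ.measurableEmbedding_flip s

lemma measurePreserving_μ : MeasurePreserving σ.flip halfVol σ.μ := by
  have := σ.measurePreserving_restrict σ.halfLine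
  rwa [flip_preimage_halfLine] at this

variable {σ}

lemma ae_iff_of_measurePreserving {μ ν : Measure ℝ} (h : MeasurePreserving σ.flip μ ν)
    {P : ℝ → Prop} : (∀ᵐ x ∂ν, P x) ↔ ∀ᵐ x ∂μ, P (σ.flip x) := by
  rw [← h.map_eq, σ.measurableEmbedding_flip.ae_map_iff]

end Side

lemma MonoLip.flip {σ : Side} {φ : ℝ → ℝ} (h : MonoLip φ) :
    MonoLip fun x => σ.flip (φ (σ.flip x)) := by
  cases σ
  · exact h
  · refine ⟨fun x y hxy => neg_le_neg (h.mono (neg_le_neg hxy)), fun x y hxy => ?_⟩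
    have := h.sub_le (-y) (-x) (neg_le_neg hxy)
    simp only [Side.flip]
    linarith

lemma deriv_flip (σ : Side) (φ : ℝ → ℝ) (x : ℝ) :
    deriv (fun x => σ.flip (φ (σ.flip x))) x = deriv φ (σ.flip x) := by
  cases σ
  · rfl
  · simp only [Side.flip]
    rw [deriv.fun_neg, deriv_comp_neg, neg_neg]

/-! ### Profiles on a half-line -/

lemma monoLip_proj (σ : Side) : MonoLip fun x => (σ.proj x : ℝ) := by
  cases σ
  · exact monoLip_max (monoLip_const 0) monoLip_id
  · have : (fun x => (Side.neg.proj x : ℝ)) = fun x => min x 0 :=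
      funext fun x => min_comm 0 x
    rw [this]
    exact monoLip_min_const 0

lemma sub_mem_of_deriv_mem {f : ℝ → ℝ} {x y : ℝ} (hxy : x ≤ y)
    (hf : AbsolutelyContinuousOnInterval f x y)
    (hd : ∀ᵐ t, t ∈ Icc x y → deriv f t ∈ Icc (0 : ℝ) 1) : f y - f x ∈ Icc 0 (y - x) := by
  rw [← hf.integral_deriv_eq_sub]
  have hd' := (ae_restrict_iff' measurableSet_Icc).2 hd
  constructor
  · exact intervalIntegral.integral_nonneg_of_ae_restrict hxy (hd'.mono fun t ht => ht.1)
  · have h1 := intervalIntegral.integral_mono_ae_restrict hxy hf.intervalIntegrable_deriv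
      (intervalIntegrable_const (c := (1 : ℝ))) (hd'.mono fun t ht => ht.2)
    simpa using h1

/-- The datum at the origin after the reflection. -/
def lo (σ : Side) (um up : ℝ) : ℝ := σ.dual (σ.near um up)

/-- The datum at infinity after the reflection. -/
def hi (σ : Side) (um up : ℝ) : ℝ := σ.dual (σ.far um up)

section Profiles

variable {σ : Side} {um up : ℝ}

lemma data_of_unbalanced (h0 : 0 < um) (hlt : um < up) (h1 : up < 1) (hσ : σ.Unbalanced um up) :
    Data (lo σ um up) (hi σ um up) := by
  cases σ <;> simp only [Side.Unbalanced] at hσ <;> constructor <;>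
    simp only [lo, hi, Side.dual, Side.near, Side.far] <;> linarith

lemma IsProfile.monoLip {φ : σ.halfLine → ℝ} (h : IsProfile σ um up φ) :
    MonoLip (extHalf σ φ) := by
  have key : ∀ x y, x ≤ y → x ∈ σ.halfLine → y ∈ σ.halfLine →
      extHalf σ φ y - extHalf σ φ x ∈ Icc 0 (y - x) := by
    intro x y hxy hx hy
    have hm : MeasurableSet σ.halfLine := by
      cases σ
      · exact measurableSet_Ici
      · exact measurableSet_Iic
    have hc : OrdConnected σ.halfLine := by
      cases σ
      · exact ordConnected_Ici
      · exact ordConnected_Iic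
    refine sub_mem_of_deriv_mem hxy (h.absolutelyContinuous x hx y hy) ?_
    filter_upwards [(ae_restrict_iff' hm).1 h.deriv_mem] with t ht hmem
    exact ht (hc.out hx hy hmem)
  have hext : ∀ x, extHalf σ φ (σ.proj x) = extHalf σ φ x := by
    intro x; rw [extHalf, extHalf, Side.proj_coe]
  have hP := monoLip_proj σ
  constructor
  · intro x y hxy
    have := (key _ _ (hP.mono hxy) (σ.proj x).2 (σ.proj y).2).1
    rw [hext, hext] at this
    linarith
  · intro x y hxy
    have := (key _ _ (hP.mono hxy) (σ.proj x).2 (σ.proj y).2).2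
    rw [hext, hext] at this
    exact this.trans (hP.sub_le x y hxy)

lemma IsProfile.isAdm {φ : σ.halfLine → ℝ} (h : IsProfile σ um up φ) :
    IsAdm (pot (lo σ um up)) (pot (hi σ um up)) fun x => σ.flip (extHalf σ φ (σ.flip x)) := by
  refine ⟨h.monoLip.flip, fun x hx => ?_, ?_⟩
  · have h2 : σ.proj (σ.flip x) = σ.proj 0 := by
      cases σ
      · exact Subtype.ext (by simp [Side.proj, Side.flip, hx])
      · exact Subtype.ext (by simp [Side.proj, Side.flip, hx])
    have h1 := h.zero
    rw [extHalf] at h1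
    rw [lo, Side.pot_dual, extHalf, h2, h1]
  · rw [hi, Side.pot_dual]
    exact (σ.continuous_flip.tendsto _).comp (h.tendsto.comp σ.tendsto_flip)

lemma isProfile_of_extHalf_eq {φ : σ.halfLine → ℝ} {ψ : ℝ → ℝ}
    (h : IsAdm (pot (lo σ um up)) (pot (hi σ um up)) ψ)
    (he : extHalf σ φ = fun x => σ.flip (ψ (σ.flip x))) : IsProfile σ um up φ := by
  have hm : MonoLip (extHalf σ φ) := by rw [he]; exact h.toMonoLip.flip
  refine ⟨fun a _ b _ => hm.absolutelyContinuous a b, Eventually.of_forall hm.deriv_mem, ?_, ?_⟩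
  · have h1 : σ.flip 0 = 0 := by cases σ <;> simp [Side.flip]
    rw [he]
    simp only
    rw [h1, h.left 0 le_rfl, lo, Side.pot_dual, Side.flip_flip]
  · rw [he]
    have h1 := (σ.continuous_flip.tendsto _).comp (h.tendsto.comp σ.tendsto_flip')
    rw [hi, Side.pot_dual, Side.flip_flip] at h1
    exact h1

lemma exists_profile {ψ : ℝ → ℝ} (h : IsAdm (pot (lo σ um up)) (pot (hi σ um up)) ψ) :
    ∃ φ : Profile σ um up, (fun x => σ.flip (extHalf σ φ.1 (σ.flip x))) = ψ := by
  have hc : Continuous fun x : σ.halfLine => σ.flip (ψ (σ.flip x)) :=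
    σ.continuous_flip.comp (h.continuous.comp (σ.continuous_flip.comp continuous_subtype_val))
  let φ : BoundedContinuousFunction σ.halfLine ℝ :=
    BoundedContinuousFunction.ofNormedAddCommGroup _ hc
      (max |pot (lo σ um up)| |pot (hi σ um up)|) fun x => by
        have h1 : ‖σ.flip (ψ (σ.flip x))‖ = |ψ (σ.flip x)| := by
          cases σ
          · rfl
          · exact norm_neg _
        rw [h1]
        exact abs_le_max_abs_abs (h.near_le _) (h.le_far _)
  have he : extHalf σ φ = fun x => σ.flip (ψ (σ.flip x)) := by
    ext x
    have h1 : σ.flip (σ.proj x) = max 0 (σ.flip x) := by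
      rw [← Side.flip_proj_flip, Side.flip_flip]
    change σ.flip (ψ (σ.flip (σ.proj x))) = _
    rw [h1]
    congr 1
    rcases le_total (σ.flip x) 0 with hx | hx
    · rw [max_eq_left hx, h.left _ le_rfl, h.left _ hx]
    · rw [max_eq_right hx]
  refine ⟨⟨φ, isProfile_of_extHalf_eq h he⟩, ?_⟩
  rw [he]
  simp

end Profiles

/-! ### The phase spaces as models -/

section Phase

variable {σ : Side} {um up : ℝ}

/-- The density of a pair, reflected to `[0, ∞)` and clamped to `[0, 1]`; clamping changes it only
on a null set. -/
def redU (p : Phase σ um up) (x : ℝ) : ℝ := σ.dual (max 0 (min 1 (uOf σ um up p (σ.flip x))))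

/-- The profile of a pair, reflected to `[0, ∞)`. -/
def redPhi (p : Phase σ um up) (x : ℝ) : ℝ := σ.flip (phiOf σ um up p (σ.flip x))

lemma stronglyMeasurable_uOf (p : Phase σ um up) : StronglyMeasurable (uOf σ um up p) :=
  Lp.stronglyMeasurable p.1.1

lemma redU_ae_eq (p : Phase σ um up) :
    redU p =ᵐ[halfVol] fun x => σ.dual (uOf σ um up p (σ.flip x)) := by
  have h : ∀ᵐ x ∂σ.μ, uOf σ um up p x ∈ Icc (0 : ℝ) 1 := p.1.2
  filter_upwards [(Side.ae_iff_of_measurePreserving σ.measurePreserving_μ).1 h] with x hx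
  rw [redU, min_eq_right hx.2, max_eq_right hx.1]

lemma isPair_red (p : Phase σ um up) :
    IsPair (pot (lo σ um up)) (pot (hi σ um up)) (redU p) (redPhi p) := by
  refine ⟨?_, fun x => σ.dual_mem ⟨le_max_left _ _, max_le zero_le_one (min_le_left _ _)⟩,
    p.2.2.isAdm⟩
  have h1 := (stronglyMeasurable_uOf p).measurable
  exact σ.continuous_dual.measurable.comp (measurable_const.max
    (measurable_const.min (h1.comp σ.continuous_flip.measurable)))

lemma phase_ext {p q : Phase σ um up} (hU : redU p =ᵐ[halfVol] redU q)
    (hΦ : redPhi p = redPhi q) : p = q := by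
  refine Prod.ext (Subtype.ext (Lp.ext ?_)) (Subtype.ext (BoundedContinuousFunction.ext fun x => ?_))
  · refine (Side.ae_iff_of_measurePreserving σ.measurePreserving_μ).2 ?_
    filter_upwards [hU, redU_ae_eq p, redU_ae_eq q] with x h1 h2 h3
    rw [h2, h3] at h1
    exact σ.dual_injective h1
  · have h1 := congrFun hΦ (σ.flip x)
    simp only [redPhi, phiOf, extHalf, Side.flip_flip, Side.proj_coe] at h1
    exact σ.flip_injective h1

lemma exists_phase {u φ : ℝ → ℝ} (h : IsPair (pot (lo σ um up)) (pot (hi σ um up)) u φ) :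
    ∃ p : Phase σ um up, redU p =ᵐ[halfVol] u ∧ redPhi p = φ := by
  obtain ⟨ψ, hψ⟩ := exists_profile h.adm
  have hm : Measurable fun x => σ.dual (u (σ.flip x)) :=
    σ.continuous_dual.measurable.comp (h.measurable.comp σ.continuous_flip.measurable)
  have hmem : ∀ x, σ.dual (u (σ.flip x)) ∈ Icc (0 : ℝ) 1 := fun x => σ.dual_mem (h.mem _)
  have hLp : MemLp (fun x => σ.dual (u (σ.flip x))) ⊤ σ.μ :=
    memLp_top_of_bound hm.aestronglyMeasurable 1 (Eventually.of_forall fun x =>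
      abs_le.2 ⟨by linarith [(hmem x).1], (hmem x).2⟩)
  have hae := hLp.coeFn_toLp
  let v : UnitLinfty σ := ⟨hLp.toLp _, hae.mono fun x hx => by rw [hx]; exact hmem x⟩
  refine ⟨(v, ψ), ?_, hψ⟩
  refine (redU_ae_eq _).trans ?_
  filter_upwards [(Side.ae_iff_of_measurePreserving σ.measurePreserving_μ).1 hae] with x hx
  change σ.dual (hLp.toLp _ (σ.flip x)) = u x
  rw [hx, Side.flip_flip, Side.dual_dual]

lemma integral_redU_mul (p : Phase σ um up) (f : ℝ → ℝ) :
    ∫ x, redU p x * f x ∂halfVol = ∫ x, σ.dual (uOf σ um up p x) * f (σ.flip x) ∂σ.μ := by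
  rw [← σ.measurePreserving_μ.integral_comp σ.measurableEmbedding_flip]
  refine integral_congr_ae ?_
  filter_upwards [redU_ae_eq p] with x hx
  rw [hx, Side.flip_flip]

lemma integrable_uOf_mul (p : Phase σ um up) {f : ℝ → ℝ} (hf : Integrable f σ.μ) :
    Integrable (fun x => uOf σ um up p x * f x) σ.μ := by
  refine hf.bdd_mul (c := 1) (stronglyMeasurable_uOf p).aestronglyMeasurable ?_
  have h : ∀ᵐ x ∂σ.μ, uOf σ um up p x ∈ Icc (0 : ℝ) 1 := p.1.2
  filter_upwards [h] with x hx
  exact abs_le.2 ⟨by linarith [hx.1], hx.2⟩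

/-- Weak-* convergence is not affected by the reflection, which is affine on densities. -/
lemma tendsto_integral_dual_iff {l : Filter (Phase σ um up)} {p : Phase σ um up} {f : ℝ → ℝ}
    (hf : Integrable f σ.μ) :
    Tendsto (fun q => ∫ x, σ.dual (uOf σ um up q x) * f x ∂σ.μ) l
      (𝓝 (∫ x, σ.dual (uOf σ um up p x) * f x ∂σ.μ)) ↔
    Tendsto (fun q => ∫ x, uOf σ um up q x * f x ∂σ.μ) l
      (𝓝 (∫ x, uOf σ um up p x * f x ∂σ.μ)) := by
  cases σ
  · exact Iff.rfl
  · have h : ∀ q : Phase Side.neg um up,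
        ∫ x, Side.neg.dual (uOf Side.neg um up q x) * f x ∂Side.neg.μ =
        (∫ x, f x ∂Side.neg.μ) - ∫ x, uOf Side.neg um up q x * f x ∂Side.neg.μ := by
      intro q
      rw [← integral_sub hf (integrable_uOf_mul q hf)]
      refine integral_congr_ae (Eventually.of_forall fun x => ?_)
      simp only [Side.dual]
      ring
    simp only [h]
    constructor
    · intro h1
      have := h1.const_sub (∫ x, f x ∂Side.neg.μ)
      simpa using this
    · intro h1
      exact h1.const_sub _

lemma tendstoUniformly_redPhi_iff {l : Filter (Phase σ um up)} {p : Phase σ um up} :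
    TendstoUniformly redPhi (redPhi p) l ↔
      TendstoUniformly (fun (q : Phase σ um up) => (q.2.1 : σ.halfLine → ℝ)) p.2.1 l := by
  rw [Metric.tendstoUniformly_iff, Metric.tendstoUniformly_iff]
  refine forall₂_congr fun ε _ => eventually_congr (Eventually.of_forall fun q => ?_)
  constructor
  · intro h x
    have := h (σ.flip x)
    simp only [redPhi, Side.dist_flip, phiOf, extHalf, Side.flip_flip, Side.proj_coe] at this
    exact this
  · intro h x
    rw [redPhi, redPhi, Side.dist_flip]
    exact h _

lemma le_nhds_phase_iff (l : Filter (Phase σ um up)) (p : Phase σ um up) : l ≤ 𝓝 p ↔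
    (∀ f, Integrable f halfVol →
      Tendsto (fun q : Phase σ um up => ∫ t, redU q t * f t ∂halfVol) l
        (𝓝 (∫ t, redU p t * f t ∂halfVol))) ∧
    TendstoUniformly redPhi (redPhi p) l := by
  have h1 : l ≤ 𝓝 p ↔ Tendsto Prod.fst l (𝓝 p.1) ∧ Tendsto Prod.snd l (𝓝 p.2) :=
    tendsto_id'.symm.trans (Prod.tendsto_iff id p)
  have h2 : Tendsto (Prod.fst : Phase σ um up → UnitLinfty σ) l (𝓝 p.1) ↔ ∀ f : Lp ℝ 1 σ.μ,
      Tendsto (fun q : Phase σ um up => ∫ x, uOf σ um up q x * f x ∂σ.μ) l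
        (𝓝 (∫ x, uOf σ um up p x * f x ∂σ.μ)) := by
    rw [nhds_induced, tendsto_comap_iff, tendsto_pi_nhds]
    rfl
  have h3 : Tendsto (Prod.snd : Phase σ um up → Profile σ um up) l (𝓝 p.2) ↔
      TendstoUniformly redPhi (redPhi p) l := by
    rw [tendsto_subtype_rng, BoundedContinuousFunction.tendsto_iff_tendstoUniformly,
      tendstoUniformly_redPhi_iff]
  rw [h1, h2, h3]
  refine and_congr_left fun _ => ⟨fun h f hf => ?_, fun h f => ?_⟩
  · have hg : Integrable (fun x => f (σ.flip x)) σ.μ := by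
      rw [← σ.measurePreserving_μ.integrable_comp_emb σ.measurableEmbedding_flip]
      refine hf.congr (Eventually.of_forall fun x => ?_)
      simp
    simp only [integral_redU_mul]
    rw [tendsto_integral_dual_iff hg]
    have h4 : ∀ q : Phase σ um up, ∫ x, uOf σ um up q x * hg.toL1 _ x ∂σ.μ =
        ∫ x, uOf σ um up q x * f (σ.flip x) ∂σ.μ := by
      intro q
      refine integral_congr_ae ?_
      filter_upwards [hg.coeFn_toL1] with x hx
      rw [hx]
    simpa only [h4] using h (hg.toL1 _)
  · have hf := L1.integrable_coeFn f
    have hg : Integrable (fun x => f (σ.flip x)) halfVol :=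
      (σ.measurePreserving_μ.integrable_comp_emb σ.measurableEmbedding_flip).2 hf
    have h4 := h _ hg
    simp only [integral_redU_mul, Side.flip_flip] at h4
    exact (tendsto_integral_dual_iff hf).1 h4

lemma halfLineModel (σ : Side) (um up : ℝ) : HalfLineModel (lo σ um up) (hi σ um up)
    (redU : Phase σ um up → ℝ → ℝ) redPhi :=
  ⟨isPair_red, fun _ _ => exists_phase, fun _ _ => phase_ext, le_nhds_phase_iff⟩

end Phase

/-! ### The functionals on the phase spaces -/

section Functionals

variable {σ : Side} {um up : ℝ}

lemma excess_flip_ae_eq (h : Data (lo σ um up) (hi σ um up)) (p : Phase σ um up) :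
    (fun x => excess σ um up p (σ.flip x)) =ᵐ[halfVol]
      exc (pot (hi σ um up)) (redU p) (redPhi p) := by
  filter_upwards [redU_ae_eq p] with x hx
  have h1 : deriv (redPhi p) x = deriv (phiOf σ um up p) (σ.flip x) := deriv_flip _ _ _
  have h2 : dens (σ.far um up) (pot (σ.far um up)) 0 = redDens (pot (hi σ um up)) := by
    rw [← dens_far h.far_pos h.lt_one]
    rw [hi, Side.pot_dual, Side.dens_dual]
  rw [exc, excess, h2, h1, hx, ← σ.dens_dual, dens_eq, redPhi]
  ring

lemma integral_excess (h : Data (lo σ um up) (hi σ um up)) (p : Phase σ um up) :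
    ∫ x, excess σ um up p x ∂σ.μ = ∫ x, exc (pot (hi σ um up)) (redU p) (redPhi p) x ∂halfVol := by
  rw [← σ.measurePreserving_μ.integral_comp σ.measurableEmbedding_flip]
  exact integral_congr_ae (excess_flip_ae_eq h p)

lemma integrable_excess_iff (h : Data (lo σ um up) (hi σ um up)) (p : Phase σ um up) :
    Integrable (excess σ um up p) σ.μ ↔
      Integrable (exc (pot (hi σ um up)) (redU p) (redPhi p)) halfVol := by
  rw [← σ.measurePreserving_μ.integrable_comp_emb σ.measurableEmbedding_flip]
  exact integrable_congr (excess_flip_ae_eq h p)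

lemma integral_excess_interval (h : Data (lo σ um up) (hi σ um up)) {ℓ : ℝ} (hℓ : 0 < ℓ)
    (p : Phase σ um up) : ∫ x in σ.interval ℓ, excess σ um up p x =
      ∫ x in (0 : ℝ)..ℓ, exc (pot (hi σ um up)) (redU p) (redPhi p) x := by
  have hmp := σ.measurePreserving_restrict (σ.interval ℓ)
  rw [σ.flip_preimage_interval] at hmp
  rw [← hmp.integral_comp σ.measurableEmbedding_flip, intervalIntegral.integral_of_le hℓ.le,
    integral_Ioc_eq_integral_Ioo]
  refine integral_congr_ae (ae_restrict_of_ae_restrict_of_subset ?_ (excess_flip_ae_eq h p))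
  exact fun x hx => hx.1.le

lemma far_sub_sq (p : Phase σ um up) :
    (fun x => (uOf σ um up p (σ.flip x) - σ.far um up) ^ 2) =ᵐ[halfVol]
      fun x => (redU p x - hi σ um up) ^ 2 := by
  filter_upwards [redU_ae_eq p] with x hx
  rw [hx, hi, Side.dual_sub_sq]

lemma abs_phiOf_sub (p : Phase σ um up) (x : ℝ) :
    ‖phiOf σ um up p (σ.flip x) - pot (σ.far um up)‖ = pot (hi σ um up) - redPhi p x := by
  have h1 : ‖phiOf σ um up p (σ.flip x) - pot (σ.far um up)‖ =
      dist (redPhi p x) (pot (hi σ um up)) := by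
    rw [hi, Side.pot_dual, redPhi, Side.dist_flip, Real.dist_eq, Real.norm_eq_abs]
  rw [h1, dist_comm, Real.dist_eq, abs_of_nonneg ((isPair_red p).gap_nonneg x)]

lemma continuous_phiOf (p : Phase σ um up) : Continuous (phiOf σ um up p) := p.2.2.monoLip.continuous

lemma aestronglyMeasurable_uOf_sub (p : Phase σ um up) :
    AEStronglyMeasurable (fun x => uOf σ um up p x - σ.far um up) σ.μ :=
  ((stronglyMeasurable_uOf p).sub stronglyMeasurable_const).aestronglyMeasurable

lemma aestronglyMeasurable_phiOf_sub (p : Phase σ um up) :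
    AEStronglyMeasurable (fun x => phiOf σ um up p x - pot (σ.far um up)) σ.μ :=
  ((continuous_phiOf p).sub continuous_const).aestronglyMeasurable

lemma mem_domD_iff (h : Data (lo σ um up) (hi σ um up)) (p : Phase σ um up) :
    p ∈ domD σ um up ↔ InDom (pot (hi σ um up)) (redU p) (redPhi p) := by
  have h1 : normU σ um up p < ⊤ ↔
      Integrable (fun x => (redU p x - Real.sigmoid (pot (hi σ um up))) ^ 2) halfVol := by
    rw [h.sigmoid_far, ← integrable_congr (far_sub_sq p)]
    have h2 := memLp_two_iff_integrable_sq (aestronglyMeasurable_uOf_sub p)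
    rw [MemLp, and_iff_right (aestronglyMeasurable_uOf_sub p)] at h2
    exact h2.trans (σ.measurePreserving_μ.integrable_comp_emb σ.measurableEmbedding_flip).symm
  have h2 : normPhi σ um up p < ⊤ ↔
      Integrable (fun x => pot (hi σ um up) - redPhi p x) halfVol := by
    have h3 := memLp_one_iff_integrable (f := fun x => phiOf σ um up p x - pot (σ.far um up))
      (μ := σ.μ)
    rw [MemLp, and_iff_right (aestronglyMeasurable_phiOf_sub p)] at h3
    refine h3.trans ?_
    rw [← integrable_norm_iff (aestronglyMeasurable_phiOf_sub p),
      ← σ.measurePreserving_μ.integrable_comp_emb σ.measurableEmbedding_flip]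
    exact integrable_congr (Eventually.of_forall (abs_phiOf_sub p))
  rw [domD, mem_ofPred_eq, ENNReal.add_lt_top, h1, h2, InDom]

lemma toReal_normU_sq (p : Phase σ um up) :
    (normU σ um up p).toReal ^ 2 = ∫ x, (redU p x - hi σ um up) ^ 2 ∂halfVol := by
  rw [normU, toReal_eLpNorm (aestronglyMeasurable_uOf_sub p),
    lpNorm_eq_integral_norm_rpow_toReal two_ne_zero ENNReal.ofNat_ne_top
      (aestronglyMeasurable_uOf_sub p), ← integral_congr_ae (far_sub_sq p),
    σ.measurePreserving_μ.integral_comp σ.measurableEmbedding_flip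
      (g := fun x => (uOf σ um up p x - σ.far um up) ^ 2)]
  simp only [ENNReal.toReal_ofNat, Real.rpow_ofNat, Real.norm_eq_abs, sq_abs]
  rw [← Real.rpow_mul_natCast (integral_nonneg fun x => sq_nonneg _)]
  norm_num

lemma toReal_normPhi (p : Phase σ um up) :
    (normPhi σ um up p).toReal = ∫ x, (pot (hi σ um up) - redPhi p x) ∂halfVol := by
  rw [normPhi, toReal_eLpNorm (aestronglyMeasurable_phiOf_sub p),
    lpNorm_one_eq_integral_norm (aestronglyMeasurable_phiOf_sub p),
    ← σ.measurePreserving_μ.integral_comp σ.measurableEmbedding_flip]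
  exact integral_congr_ae (Eventually.of_forall (abs_phiOf_sub p))

lemma energy_eq (h : Data (lo σ um up) (hi σ um up)) :
    energy σ um up = modelEnergy (hi σ um up) redU redPhi := by
  ext p
  by_cases hp : p ∈ domD σ um up
  · rw [energy, modelEnergy, if_pos hp, if_pos ((mem_domD_iff h p).1 hp), integral_excess h]
  · rw [energy, modelEnergy, if_neg hp, if_neg fun hd => hp ((mem_domD_iff h p).2 hd)]

lemma mem_setB_iff {ℓ : ℝ} (hℓ : 0 < ℓ) (p : Phase σ um up) :
    p ∈ setB σ um up ℓ ↔ InBdd (hi σ um up) ℓ (redU p) (redPhi p) := by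
  have h1 : (∀ x ∈ σ.outer ℓ, phiOf σ um up p x = pot (σ.far um up)) ↔
      ∀ x, ℓ ≤ x → redPhi p x = pot (hi σ um up) := by
    have hmem : ∀ x, σ.flip x ∈ σ.outer ℓ ↔ ℓ ≤ x := fun x => by
      rw [← mem_preimage, σ.flip_preimage_outer, mem_Ici]
    constructor
    · intro h x hx
      rw [redPhi, h _ ((hmem x).2 hx), hi, Side.pot_dual]
    · intro h x hx
      have h2 := h (σ.flip x) ((hmem _).1 (by rwa [Side.flip_flip]))
      rw [redPhi, Side.flip_flip, hi, Side.pot_dual] at h2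
      exact σ.flip_injective h2
  have h2 : (∀ᵐ x ∂(volume.restrict (σ.outer ℓ)), uOf σ um up p x = σ.far um up) ↔
      ∀ᵐ x, ℓ ≤ x → redU p x = hi σ um up := by
    have hmp := σ.measurePreserving_restrict (σ.outer ℓ)
    rw [σ.flip_preimage_outer] at hmp
    rw [Side.ae_iff_of_measurePreserving hmp, ae_restrict_iff' measurableSet_Ici]
    refine eventually_congr ?_
    filter_upwards [(ae_restrict_iff' measurableSet_Ici).1 (redU_ae_eq p)] with x hx
    refine forall_congr' fun hxℓ : ℓ ≤ x => ?_
    rw [hx (hℓ.le.trans hxℓ), hi, σ.dual_injective.eq_iff]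
  rw [setB, mem_ofPred_eq, h1, h2, InBdd]

lemma energyL_eq (h : Data (lo σ um up) (hi σ um up)) {ℓ : ℝ} (hℓ : 0 < ℓ) :
    energyL σ um up ℓ = modelEnergyL (hi σ um up) redU redPhi ℓ := by
  ext p
  by_cases hp : p ∈ setB σ um up ℓ
  · rw [energyL, modelEnergyL, if_pos hp, if_pos ((mem_setB_iff hℓ p).1 hp),
      integral_excess_interval h hℓ]
  · rw [energyL, modelEnergyL, if_neg hp, if_neg fun hd => hp ((mem_setB_iff hℓ p).2 hd)]

/-! ### The stationary pairs on the phase spaces -/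

lemma dual_uBar_flip (h : Data (lo σ um up) (hi σ um up)) (x : ℝ) :
    σ.dual (uBar σ um up (σ.flip x)) = wave (hi σ um up - 1 / 2) (lo σ um up) x := by
  have h2 := h.half_lt
  have h3 := div_mem_Ioo h.abs_sub_lt
  cases σ
  · have hA : ampl Side.pos um up = up - 1 / 2 := abs_of_pos h2
    have h0 : up - 1 / 2 ≠ 0 := h2.ne'
    simp only [Side.dual, Side.flip, uBar, centre, hA, wave, hi, lo, Side.near, Side.far]
    rw [sub_neg_eq_add, mul_add, mul_div_cancel₀ _ h0]
  · simp only [hi, lo, Side.dual, Side.near, Side.far] at h2 h3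
    have hA : ampl Side.neg um up = 1 - um - 1 / 2 := by
      rw [ampl, abs_of_neg (by simp only [Side.far]; linarith), Side.far]
      ring
    have h0 : 1 - um - 1 / 2 ≠ 0 := h2.ne'
    have h4 : (up - 1 / 2) / (1 - um - 1 / 2) = -((1 - up - 1 / 2) / (1 - um - 1 / 2)) := by
      rw [← neg_div]; congr 1; ring
    simp only [Side.dual, Side.flip, uBar, centre, hA, wave, hi, lo, Side.near, Side.far]
    rw [h4, artanh_neg_eq h3]
    have h5 : (1 - um - 1 / 2) * (-x - -(-Real.artanh ((1 - up - 1 / 2) / (1 - um - 1 / 2)) /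
        (1 - um - 1 / 2))) =
        -((1 - um - 1 / 2) * x + Real.artanh ((1 - up - 1 / 2) / (1 - um - 1 / 2))) := by
      rw [neg_div, neg_neg, mul_sub, mul_div_cancel₀ _ h0]
      ring
    rw [h5, Real.tanh_neg]
    ring

lemma isStationaryPair_iff (h : Data (lo σ um up) (hi σ um up)) (p : Phase σ um up) :
    IsStationaryPair σ um up p ↔ redU p =ᵐ[halfVol] densInf (lo σ um up) (hi σ um up) ∧
      redPhi p = profInf (lo σ um up) (hi σ um up) := by
  refine and_congr ?_ ?_
  · rw [EventuallyEq, Side.ae_iff_of_measurePreserving σ.measurePreserving_μ]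
    refine eventually_congr ?_
    filter_upwards [redU_ae_eq p, ae_restrict_mem measurableSet_Ici] with x hx hx0
    rw [hx, densInf, max_eq_left hx0, ← dual_uBar_flip h, σ.dual_injective.eq_iff]
  · have hmem : ∀ x, σ.flip x ∈ σ.halfLine ↔ 0 ≤ x := fun x => by
      rw [← mem_preimage, σ.flip_preimage_halfLine, mem_Ici]
    have hpot : ∀ x, pot (wave (hi σ um up - 1 / 2) (lo σ um up) x) =
        σ.flip (pot (uBar σ um up (σ.flip x))) := fun x => by
      rw [← dual_uBar_flip h, Side.pot_dual]
    constructor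
    · intro h1
      ext x
      rcases le_total x 0 with hx | hx
      · rw [(isPair_red p).adm.left x hx, (isPair_inf h).adm.left x hx]
      · rw [profInf, max_eq_left hx, wavePot, hpot, redPhi, h1 _ ((hmem x).2 hx)]
    · intro h1 x hx
      have hx' : 0 ≤ σ.flip x := (hmem _).1 (by rwa [Side.flip_flip])
      have h2 := congrFun h1 (σ.flip x)
      rw [profInf, max_eq_left hx', wavePot, hpot, redPhi, Side.flip_flip] at h2
      exact σ.flip_injective h2

lemma hasDerivAt_reflect {v : ℝ → ℝ} {x : ℝ}
    (h : HasDerivAt (deriv v) (deriv (fun y => v y * (1 - v y)) (-x)) (-x)) :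
    HasDerivAt (deriv fun y => 1 - v (-y))
      (deriv (fun y => (1 - v (-y)) * (1 - (1 - v (-y)))) x) x := by
  have h1 : (deriv fun y => 1 - v (-y)) = fun y => deriv v (-y) := by
    ext y
    rw [deriv_const_sub, deriv_comp_neg, neg_neg]
  have h2 : (fun y => (1 - v (-y)) * (1 - (1 - v (-y)))) = fun y =>
      (fun z => v z * (1 - v z)) (-y) := by
    ext y; ring
  rw [h1, h2, deriv_comp_neg (fun z => v z * (1 - v z))]
  exact (h.comp x (hasDerivAt_neg x)).congr_deriv (by ring)

lemma SolvesBVP.reflect_neg {ℓ a b : ℝ} {v : ℝ → ℝ} (hℓ : 0 < ℓ)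
    (h : SolvesBVP Side.neg a b ℓ v) :
    SolvesBVP Side.pos (1 - b) (1 - a) ℓ fun x => 1 - v (-x) := by
  have hcl : closure (Side.pos.interval ℓ) = Icc 0 ℓ := closure_Ioo hℓ.ne
  have hcl' : closure (Side.neg.interval ℓ) = Icc (-ℓ) 0 := closure_Ioo (by linarith)
  have hmem : ∀ x ∈ Ioo 0 ℓ, -x ∈ Ioo (-ℓ) 0 := fun x hx =>
    ⟨neg_lt_neg hx.2, neg_lt_zero.2 hx.1⟩
  refine ⟨?_, fun x hx => ?_, fun x hx => hasDerivAt_reflect (h.equation _ (hmem x hx)), ?_, ?_⟩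
  · rw [hcl]
    refine continuousOn_const.sub ((hcl' ▸ h.continuousOn).comp continuousOn_neg fun x hx => ?_)
    exact ⟨neg_le_neg hx.2, neg_nonpos.2 hx.1⟩
  · exact ((h.differentiable _ (hmem x hx)).comp x differentiable_neg.differentiableAt).const_sub 1
  · simp only [neg_zero, h.zero]; rfl
  · exact congrArg (1 - ·) h.endpoint

lemma SolvesBVP.reflect_pos {ℓ a b : ℝ} {v : ℝ → ℝ} (hℓ : 0 < ℓ)
    (h : SolvesBVP Side.pos a b ℓ v) :
    SolvesBVP Side.neg (1 - b) (1 - a) ℓ fun x => 1 - v (-x) := by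
  have hcl : closure (Side.pos.interval ℓ) = Icc 0 ℓ := closure_Ioo hℓ.ne
  have hcl' : closure (Side.neg.interval ℓ) = Icc (-ℓ) 0 := closure_Ioo (by linarith)
  have hmem : ∀ x ∈ Ioo (-ℓ) 0, -x ∈ Ioo 0 ℓ := fun x hx =>
    ⟨neg_pos.2 hx.2, by linarith [hx.1]⟩
  refine ⟨?_, fun x hx => ?_, fun x hx => hasDerivAt_reflect (h.equation _ (hmem x hx)), ?_, ?_⟩
  · rw [hcl']
    refine continuousOn_const.sub ((hcl ▸ h.continuousOn).comp continuousOn_neg fun x hx => ?_)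
    exact ⟨neg_nonneg.2 hx.2, by linarith [hx.1]⟩
  · exact ((h.differentiable _ (hmem x hx)).comp x differentiable_neg.differentiableAt).const_sub 1
  · simp only [neg_zero, h.zero]; rfl
  · simp only [Side.endpoint, neg_neg]
    exact congrArg (1 - ·) h.endpoint

lemma solvesBVP_dual {ℓ : ℝ} (hℓ : 0 < ℓ) {v : ℝ → ℝ} (h : SolvesBVP σ um up ℓ v) :
    SolvesBVP Side.pos (lo σ um up) (hi σ um up) ℓ fun x => σ.dual (v (σ.flip x)) := by
  cases σ
  · exact h
  · exact h.reflect_neg hℓ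

lemma solvesBVP_of_dual {ℓ : ℝ} (hℓ : 0 < ℓ) {v : ℝ → ℝ}
    (h : SolvesBVP Side.pos (lo σ um up) (hi σ um up) ℓ v) :
    SolvesBVP σ um up ℓ fun x => σ.dual (v (σ.flip x)) := by
  cases σ
  · exact h
  · have := h.reflect_pos hℓ
    simp only [lo, hi, Side.dual, Side.near, Side.far, sub_sub_cancel] at this
    exact this

lemma isStationaryPairL_iff {ℓ : ℝ} (hℓ : 0 < ℓ) (p : Phase σ um up) :
    IsStationaryPairL σ um up ℓ p ↔
      IsFinStationary (lo σ um up) (hi σ um up) ℓ (redU p) (redPhi p) := by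
  refine and_congr (mem_setB_iff hℓ p) ?_
  have hmp := σ.measurePreserving_restrict (σ.interval ℓ)
  rw [σ.flip_preimage_interval] at hmp
  have hmem : ∀ x, σ.flip x ∈ σ.interval ℓ ↔ x ∈ Ioo 0 ℓ := fun x => by
    rw [← mem_preimage, σ.flip_preimage_interval]
  have hU : redU p =ᵐ[volume.restrict (Ioo 0 ℓ)] fun x => σ.dual (uOf σ um up p (σ.flip x)) :=
    ae_restrict_of_ae_restrict_of_subset (fun x hx => hx.1.le) (redU_ae_eq p)
  constructor
  · rintro ⟨v, hv, hu, hφ⟩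
    refine ⟨_, solvesBVP_dual hℓ hv, ?_, fun x hx => ?_⟩
    · filter_upwards [hU, (Side.ae_iff_of_measurePreserving hmp).1 hu] with x h1 h2
      rw [h1, h2]
    · rw [Side.pot_dual, redPhi, hφ _ ((hmem x).2 hx)]
  · rintro ⟨v, hv, hu, hφ⟩
    refine ⟨_, solvesBVP_of_dual hℓ hv, ?_, fun x hx => ?_⟩
    · rw [EventuallyEq, Side.ae_iff_of_measurePreserving hmp]
      filter_upwards [hU, hu] with x h1 h2
      rw [Side.flip_flip, ← h2, h1, Side.dual_dual]
    · have h1 := hφ (σ.flip x) ((hmem _).1 (by rwa [Side.flip_flip]))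
      rw [redPhi, Side.flip_flip] at h1
      rw [Side.pot_dual, ← h1, Side.flip_flip]

lemma pot_sub_pot_eq (σ : Side) (um up : ℝ) :
    pot (hi σ um up) - pot (lo σ um up) = pot up - pot um := by
  cases σ
  · rfl
  · simp only [hi, lo, Side.dual, Side.near, Side.far, pot_one_sub]
    ring

end Functionals

end

end BurgersHalfLine

theorem theoremt (σ : Side) (um up : ℝ) (h0 : 0 < um) (hlt : um < up) (h1 : up < 1)
    (hσ : σ.Unbalanced um up) :
    ∃ pbar : Phase σ um up, IsStationaryPair σ um up pbar ∧
      -- part (i)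
      ((∃ C : ℝ, 1 < C ∧ ∀ p ∈ domD σ um up,
          Integrable (excess σ um up p) σ.μ ∧
          energy σ um up p ≤
            ((C * ((normU σ um up p).toReal ^ 2 + (normPhi σ um up p).toReal) + C : ℝ) : EReal) ∧
          ((1 / C * ((normU σ um up p).toReal ^ 2 + (normPhi σ um up p).toReal) - C : ℝ) : EReal)
            ≤ energy σ um up p) ∧
        LowerSemicontinuous (energy σ um up) ∧
        Coercive (energy σ um up) ∧
        IsUniqueMinimizer (energy σ um up) pbar) ∧
      -- part (ii)
      ((∀ ℓ : ℕ → ℝ, (∀ n, 0 < ℓ n) → EquiCoercive (fun n => energyL σ um up (ℓ n))) ∧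
        (∀ ℓ : ℕ → ℝ, (∀ n, 0 < ℓ n) → Tendsto ℓ atTop atTop →
          GammaConverges (fun n => energyL σ um up (ℓ n)) (energy σ um up)) ∧
        (∀ ℓ : ℝ, pot up - pot um < ℓ → ∃ p : Phase σ um up,
          (∀ q, IsStationaryPairL σ um up ℓ q ↔ q = p) ∧
          IsUniqueMinimizer (energyL σ um up ℓ) p) ∧
        (∀ p : ℝ → Phase σ um up,
          (∀ ℓ : ℝ, pot up - pot um < ℓ → IsStationaryPairL σ um up ℓ (p ℓ)) →
          Tendsto p atTop (𝓝 pbar))) := by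
  have h := data_of_unbalanced h0 hlt h1 hσ
  have hm := halfLineModel σ um up
  obtain ⟨pbar, hbu, hbφ⟩ := hm.exists_eq _ _ (isPair_inf h)
  obtain ⟨hbd, hbmin⟩ := hm.isUniqueMinimizer_inf h hbu hbφ
  have hpos : ∀ ℓ, pot up - pot um < ℓ → 0 < ℓ := fun ℓ hℓ =>
    (sub_pos.2 (pot_lt_pot h0 hlt h1)).trans hℓ
  have hfin : ∀ ℓ, pot up - pot um < ℓ → ∃ p : Phase σ um up,
      (∀ q, IsStationaryPairL σ um up ℓ q ↔ q = p) ∧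
        IsUniqueMinimizer (energyL σ um up ℓ) p := by
    intro ℓ hℓ
    obtain ⟨p, hp, hmin⟩ := hm.exists_fin h (by rwa [pot_sub_pot_eq])
    refine ⟨p, fun q => ?_, ?_⟩
    · rw [isStationaryPairL_iff (hpos ℓ hℓ), hp]
    · rwa [energyL_eq h (hpos ℓ hℓ)]
  refine ⟨pbar, (isStationaryPair_iff h pbar).2 ⟨hbu, hbφ⟩, ⟨?_, ?_, ?_, ?_⟩,
    fun ℓ hℓ => ?_, fun ℓ hℓ hlim => ?_, hfin, fun p hp => ?_⟩
  · obtain ⟨C, hC, hbd⟩ := hm.bounds h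
    refine ⟨C, hC, fun p hp => ?_⟩
    have hp' := (mem_domD_iff h p).1 hp
    rw [energy_eq h, modelEnergy_of_inDom hp', toReal_normU_sq, toReal_normPhi,
      EReal.coe_le_coe_iff, EReal.coe_le_coe_iff]
    exact ⟨(integrable_excess_iff h p).2 ((isPair_red p).integrable_exc h.neg_pot_lt hp'),
      hbd p hp'⟩
  · rw [energy_eq h]; exact hm.lowerSemicontinuous h
  · rw [energy_eq h]; exact hm.coercive h
  · rwa [energy_eq h]
  · have := hm.equiCoercive h ℓ
    simpa only [energyL_eq h (hℓ _)] using this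
  · rw [energy_eq h]
    simpa only [energyL_eq h (hℓ _)] using hm.gammaConverges h hlim
  · refine hm.tendsto_minimizers h hbd hbmin ?_
    filter_upwards [eventually_gt_atTop (pot up - pot um)] with ℓ hℓ
    obtain ⟨q, hq, hmin⟩ := hfin ℓ hℓ
    rw [energyL_eq h (hpos ℓ hℓ)] at hmin
    rw [(hq _).1 (hp ℓ hℓ)]
    exact hmin.1
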